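/- Let $K$ be a non-archimedean local field with uniformizer $\varpi$, ring of integers $\mathcal O_K$ and residue field $\mathbb F_q$. For a perfect $\mathbb F_q$-algebra $R$ let $\mathbb W(R)$ be $R[[\varpi]]$ if $\operatorname{char} K>0$, and the ring of $K$-ramified Witt vectors of $R$ if $\operatorname{char} K=0$. For $h\ge 0$ put $\mathbb W_h(R)=\mathbb W(R)/\varpi^h$, and let $\sigma$ be the Frobenius of $\mathbb W_h(R)$ induced by $x\mapsto x^q$. Let $n\ge 2$, $0\le\kappa<n$, $n'=\gcd(n,\kappa)$, $n=n'n_0$, $\kappa=n'k_0$, let $h\ge 1$ and $1\le i_0\le n'-1$, and put $s=n_0i_0$. Let $c=\begin{pmatrix}0&\varpi\\1_{n_0-1}&0\end{pmatrix}^{k_0}$ and let $b_r$ be the block-diagonal matrix with $r$ blocks $c$. All perfect schemes are considered over $\overline{\mathbb F}_q$, as functors on perfect $\overline{\mathbb F}_q$-algebras. For $r\ge1$ let $Z_{n_0,r,h}$ be the space of vectors $x=(x_i)_{i=1}^{n_0r}$ with $x_i\in\mathbb W_h$ if $i\equiv1\bmod n_0$ and $x_i\in\mathbb W_{h-1}$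 otherwise. Let $g_{n_0,r}(x)$ be the $n_0r\times n_0r$-matrix whose $i$-th column is $\varpi^{-\lfloor (i-1)k_0/n_0\rfloor}(b_r\sigma)^{i-1}(x)$. Its determinant $|g_{n_0,r}(x)|$ is a well-defined element of $\mathbb W_h$. Put $$Y_{n_0,r,h}=\{x\in Z_{n_0,r,h}: |g_{n_0,r}(x)|\in\mathbb W_h^\times\},\qquad X_h=\{x\in Y_{n_0,n',h}: |g_{n_0,n'}(x)|\in\mathbb W_h^\times(\mathbb F_q)\}.$$ Let $l$ be an integer with $k_0l\equiv1\bmod n_0$. Let $N_h$ be the finite group of block matrices $(A_{ij})_{1\le i,j\le n'}$, with blocks of size $n_0\times n_0$, such that $A_{ii}=1$, $A_{ij}=0$ unless $i=j$ or $i\le i_0<j$, and, for $i\le i_0<j$, $$A_{ij}=\sum_{\lambda=0}^{n_0-1}\varpi^{-\lfloor\lambda k_0/n_0\rfloor}c^\lambda\operatorname{diag}\bigl(a_\lambda,\sigma^{l}(a_\lambda),\dots,\sigma^{(n_0-1)l}(a_\lambda)\bigr),$$ with $a_0\in\mathbb W_h(\mathbb F_{q^{n_0}})$ and $a_\lambda\in\mathbb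 W_{h-1}(\mathbb F_{q^{n_0}})$ for $\lambda>0$ (the $a_\lambda$ depend on $i,j$). For $1\le i\le s$ let $m_i(x)$ be the minor of $g_{n_0,n'}(x)$ formed by the rows $i,s+1,\dots,n$ and the first $n-s+1$ columns, taken in $\mathbb W_h$ if $i\equiv 1\bmod n_0$ and in $\mathbb W_{h-1}$ otherwise. **Statement.** $X_h$ is an affine perfect scheme, $N_h$ acts on it by matrix multiplication, and the assignment $x\mapsto\bigl(m=(m_i(x))_{i=1}^{s},\ x'=(x_i)_{i=s+1}^{n}\bigr)$ is an $N_h$-invariant morphism on $X_h$ which induces an isomorphism of perfect schemes $$N_h\backslash X_h\ \xrightarrow{\ \sim\ }\ \Bigl\{(m,x')\in Y_{n_0,i_0,h}\times Y_{n_0,n'-i_0,h}:\ \frac{|g_{n_0,i_0}(m)|}{\prod_{j=1}^{s-1}\sigma^j\bigl(|g_{n_0,n'-i_0}(x')|\bigr)}\in\mathbb W_h^\times(\mathbb F_q)\Bigr\},$$ where $N_h\backslash X_h$ is the quotient of the affine scheme $X_h$ by the finite group $N_h$, i.e. the spectrum of the ring of $N_h$-invariant functions. For $\kappa=0$ one has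 $n_0=1$, $k_0=0$, $n'=n$, $s=i_0$. In this case $g_{1,r}(x)=g_r(x)$ is the matrix with columns $x,\sigma(x),\dots,\sigma^{r-1}(x)$, $N_h\subset \mathrm{GL}_n(\mathcal O_K/\varpi^h)$ is the group of unipotent block matrices $\begin{pmatrix}1_{i_0}&*\\0&1_{n-i_0}\end{pmatrix}$, and $N_h\backslash X_h$ is identified with the set of $(m,x')\in Y_{i_0,h}\times Y_{n-i_0,h}$ such that $|g_{i_0}(m)|\,/\,\prod_{j=1}^{i_0-1}\sigma^j(|g_{n-i_0}(x')|)\in\mathbb W_h^\times(\mathbb F_q)$, where $Y_{r,h}=Y_{1,r,h}$. -/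

import Mathlib

open CategoryTheory AlgebraicGeometry
open scoped ValuativeRel

namespace LoopDL

universe u

noncomputable section

/-! ## Truncated `K`-ramified Witt vectors -/

section Witt

variable (O : Type u) [CommRing O]

/-- For an `O`-algebra `R`, the `O`-algebra map `O[(R, ·)] → R`, `[a] ↦ a`, from the monoid algebra
of the multiplicative monoid of `R`. -/
def augmentation (R : Type u) [CommRing R] [Algebra O R] : MonoidAlgebra O R →ₐ[O] R :=
  MonoidAlgebra.lift O R R (MonoidHom.id R)

/-- The kernel of `O[(R, ·)] → R`. -/
def augIdeal (R : Type u) [CommRing R] [Algebra O R] : Ideal (MonoidAlgebra O R) :=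
  RingHom.ker (augmentation O R)

/-- The truncated Witt vectors `𝕎_h(R)`, in the construction of Cuntz and Deninger.

Let `O = 𝒪_K` be the ring of integers of a local field with uniformizer `ϖ` and residue field
`𝔽_q`, and let `R` be a perfect `𝔽_q`-algebra. Up to unique isomorphism there is exactly one flat
`O/ϖ^h`-algebra which lifts `R`. It is `R[ϖ]/(ϖ^h)` if `K` has positive characteristic, it is the
ring of truncated `K`-ramified Witt vectors (that is, `W(R) ⊗_{W(𝔽_q)} 𝒪_K` modulo `ϖ^h`) if `K` has
mixed characteristic, and in both cases it is the quotient of the monoid algebra `O[(R, ·)]` by the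
`h`-th power of the kernel of `O[(R, ·)] → R`. The class of the basis element `[a]` is the
Teichmüller representative of `a`. Only perfect `𝔽_q`-algebras `R` are used below. -/
abbrev TruncWitt (h : ℕ) (R : Type u) [CommRing R] [Algebra O R] : Type u :=
  MonoidAlgebra O R ⧸ (augIdeal O R) ^ h

variable {O} {R S : Type u} [CommRing R] [Algebra O R] [CommRing S] [Algebra O S]

theorem augIdeal_pow_le_comap (h : ℕ) (f : R →ₐ[O] S) :
    (augIdeal O R) ^ h ≤
      ((augIdeal O S) ^ h).comap (MonoidAlgebra.mapDomainRingHom O (f : R →* S)) := by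
  have key : (augmentation O S : MonoidAlgebra O S →+* S).comp
      (MonoidAlgebra.mapDomainRingHom O (f : R →* S)) =
      (f : R →+* S).comp (augmentation O R : MonoidAlgebra O R →+* R) := by
    ext x <;> simp [augmentation]
  have h1 : augIdeal O R ≤
      (augIdeal O S).comap (MonoidAlgebra.mapDomainRingHom O (f : R →* S)) := by
    intro x hx
    have hx' : augmentation O R x = 0 := hx
    have := RingHom.congr_fun key x
    simp only [RingHom.comp_apply] at this
    change augmentation O S _ = 0
    refine this.trans ?_
    change f (augmentation O R x) = 0
    rw [hx', map_zero]
  exact (Ideal.pow_right_mono h1 h).trans (Ideal.le_comap_pow _ h)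

/-- Functoriality of `𝕎_h`, given by `[a] ↦ [f a]`. -/
def wMap (h : ℕ) (f : R →ₐ[O] S) : TruncWitt O h R →+* TruncWitt O h S :=
  Ideal.quotientMap _ (MonoidAlgebra.mapDomainRingHom O (f : R →* S)) (augIdeal_pow_le_comap h f)

/-- The truncation `𝕎_h → 𝕎_{h'}` for `h' ≤ h`. -/
def wRed {h h' : ℕ} (hh : h' ≤ h) : TruncWitt O h R →+* TruncWitt O h' R :=
  Ideal.Quotient.factor (Ideal.pow_le_pow_right hh)

theorem wRed_surjective {h h' : ℕ} (hh : h' ≤ h) :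
    Function.Surjective (wRed (O := O) (R := R) hh) :=
  Ideal.Quotient.factor_surjective _

end Witt

/-! ## Perfect algebras over the algebraic closure of the residue field -/

section Perf

variable (O : Type u) [CommRing O] [IsLocalRing O]

/-- An algebraic closure `\overline{𝔽}_q` of the residue field `𝔽_q` of `O`. -/
abbrev GeomField : Type u := AlgebraicClosure (IsLocalRing.ResidueField O)

/-- A perfect `\overline{𝔽}_q`-algebra: its absolute Frobenius `x ↦ x^p` is bijective. -/
structure PerfAlg where
  carrier : Type u
  [commRing : CommRing carrier]
  [algebra : Algebra (GeomField O) carrier]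
  perfect : Function.Bijective fun x : carrier => x ^ ringChar (GeomField O)

instance : CoeSort (PerfAlg O) (Type u) := ⟨PerfAlg.carrier⟩

attribute [instance] PerfAlg.commRing PerfAlg.algebra

variable {O}

instance (R : PerfAlg O) : Algebra O R :=
  ((algebraMap (GeomField O) R).comp (algebraMap O (GeomField O))).toAlgebra

instance (R : PerfAlg O) : Algebra (IsLocalRing.ResidueField O) R :=
  ((algebraMap (GeomField O) R).comp
    (algebraMap (IsLocalRing.ResidueField O) (GeomField O))).toAlgebra

instance (R : PerfAlg O) : IsScalarTower O (GeomField O) R :=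
  IsScalarTower.of_algebraMap_eq fun _ => rfl

instance (R : PerfAlg O) : IsScalarTower O (IsLocalRing.ResidueField O) R :=
  IsScalarTower.of_algebraMap_eq fun _ => rfl

variable [Finite (IsLocalRing.ResidueField O)]

theorem perfect_geomField :
    Function.Bijective fun x : GeomField O => x ^ ringChar (GeomField O) := by
  have hne : ringChar (GeomField O) ≠ 0 := by
    rw [← Algebra.ringChar_eq (IsLocalRing.ResidueField O) (GeomField O)]
    exact CharP.ringChar_ne_zero_of_finite _
  have := ringChar.charP (GeomField O)
  have hp : (ringChar (GeomField O)).Prime :=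
    (CharP.char_is_prime_or_zero (GeomField O) (ringChar (GeomField O))).resolve_right hne
  have : ExpChar (GeomField O) (ringChar (GeomField O)) := ExpChar.prime hp
  exact bijective_frobenius (GeomField O) (ringChar (GeomField O))

variable (O) in
/-- `\overline{𝔽}_q` as a perfect `\overline{𝔽}_q`-algebra. -/
def PerfAlg.base : PerfAlg O where
  carrier := GeomField O
  perfect := perfect_geomField

/-- The structure map `\overline{𝔽}_q → R`. -/
def PerfAlg.ofBase (R : PerfAlg O) : PerfAlg.base O →ₐ[GeomField O] R :=
  Algebra.ofId (GeomField O) R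

/-- The `q`-Frobenius `x ↦ x^q` of `R`. -/
def frob (R : PerfAlg O) : R →ₐ[O] R :=
  letI := Fintype.ofFinite (IsLocalRing.ResidueField O)
  (FiniteField.frobeniusAlgHom (IsLocalRing.ResidueField O) R).restrictScalars O

/-- The Frobenius `σ` on `𝕎_h(R)`. -/
def sigma {h : ℕ} {R : PerfAlg O} : TruncWitt O h R →+* TruncWitt O h R := wMap h (frob R)

/-- The condition `w ∈ 𝕎_h^×(𝔽_q)` on an element `w ∈ 𝕎_h(R)`: it is an `R`-valued point of the
finite constant closed subscheme `𝕎_h^×(𝔽_q)` of `𝕎_h^×`, i.e. a unit which is fixed by `σ`. -/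
def IsFqUnit {h : ℕ} {R : PerfAlg O} (w : TruncWitt O h R) : Prop :=
  IsUnit w ∧ sigma w = w

end Perf

/-! ## The matrices `ϖ^{-⌊j k₀ / n₀⌋} c^j` -/

section Matrices

variable {O : Type u} [CommRing O] (ϖ : O) (n₀ k₀ : ℕ)

/-- The `n₀ × n₀`-matrix with blocks `0, ϖ` in the first and `1_{n₀-1}, 0` in the second block row:
`e_a ↦ e_{a+1}` for `a < n₀`, and `e_{n₀} ↦ ϖ e_1`. -/
def cyc : Matrix (Fin n₀) (Fin n₀) O := Matrix.of fun a' a =>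
  if (a : ℕ) + 1 = a' then 1 else if (a' : ℕ) = 0 ∧ (a : ℕ) + 1 = n₀ then ϖ else 0

/-- The integral matrix `ϖ^{-⌊j k₀ / n₀⌋} c^j`, where `c = cyc ^ k₀`; see `scaledPow_spec`. -/
def scaledPow (j : ℕ) : Matrix (Fin n₀) (Fin n₀) O := Matrix.of fun a' a =>
  if (a' : ℕ) = ((a : ℕ) + k₀ * j) % n₀ then ϖ ^ (((a : ℕ) + k₀ * j) / n₀ - k₀ * j / n₀) else 0

theorem cyc_pow (m : ℕ) : cyc ϖ n₀ ^ m = Matrix.of fun a' a : Fin n₀ =>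
    if (a' : ℕ) = ((a : ℕ) + m) % n₀ then ϖ ^ (((a : ℕ) + m) / n₀) else 0 := by
  induction m with
  | zero =>
    ext a' a
    have := a.2
    simp only [pow_zero, Matrix.one_apply, Matrix.of_apply, add_zero, Nat.mod_eq_of_lt a.2,
      Nat.div_eq_of_lt a.2, Fin.ext_iff]
  | succ m ih =>
    ext a' a
    have hn : 0 < n₀ := a.pos
    rw [pow_succ', ih, Matrix.mul_apply]
    obtain ⟨e, he0⟩ : ∃ e, e = ((a : ℕ) + m) % n₀ := ⟨_, rfl⟩
    obtain ⟨d, hd0⟩ : ∃ d, d = ((a : ℕ) + m) / n₀ := ⟨_, rfl⟩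
    have h1 := Nat.div_add_mod ((a : ℕ) + m) n₀
    have h2 := Nat.mod_lt ((a : ℕ) + m) hn
    simp only [Matrix.of_apply]
    rw [← he0, ← hd0] at h1
    rw [← he0] at h2
    rw [← he0, ← hd0, Finset.sum_eq_single (⟨e, h2⟩ : Fin n₀)]
    · simp only [cyc, Matrix.of_apply, if_true]
      have h3 := a'.2
      by_cases he : e + 1 = n₀
      · have hs : (a : ℕ) + (m + 1) = n₀ * (d + 1) := by rw [Nat.mul_succ]; omega
        rw [hs, Nat.mul_mod_right, Nat.mul_div_cancel_left _ hn]
        rw [if_neg (by omega)]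
        by_cases h0 : (a' : ℕ) = 0
        · rw [if_pos ⟨h0, he⟩, if_pos h0, pow_succ']
        · rw [if_neg (fun h => h0 h.1), if_neg h0, zero_mul]
      · have hs : (a : ℕ) + (m + 1) = (e + 1) + n₀ * d := by omega
        have hlt : e + 1 < n₀ := by omega
        rw [hs, Nat.add_mul_mod_self_left, Nat.add_mul_div_left _ _ hn,
          Nat.mod_eq_of_lt hlt, Nat.div_eq_of_lt hlt, zero_add]
        by_cases h0 : e + 1 = (a' : ℕ)
        · rw [if_pos h0, if_pos h0.symm, one_mul]
        · rw [if_neg h0, if_neg (fun h => he h.2), if_neg (fun h => h0 h.symm), zero_mul]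
    · intro b _ hb
      rw [if_neg (fun h => hb (Fin.ext h)), mul_zero]
    · intro h
      exact absurd (Finset.mem_univ _) h

theorem scaledPow_spec (j : ℕ) :
    ϖ ^ (j * k₀ / n₀) • scaledPow ϖ n₀ k₀ j = (cyc ϖ n₀ ^ k₀) ^ j := by
  rw [← pow_mul, cyc_pow]
  ext a' a
  simp only [scaledPow, Matrix.smul_apply, Matrix.of_apply, smul_eq_mul, mul_ite, mul_zero]
  congr 1
  rw [← pow_add, mul_comm j k₀]
  congr 1
  have : k₀ * j / n₀ ≤ ((a : ℕ) + k₀ * j) / n₀ := Nat.div_le_div_right (by omega)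
  omega

end Matrices

/-! ## The schemes `Z_{n₀,r,h}`, `X_h` and the target, as functors of points -/

section Spaces

variable {O : Type u} [CommRing O] [IsLocalRing O]

/-- The truncation level of the `a`-th coordinate of a block: `h` for the first one, else `h - 1`. -/
def lev (h : ℕ) {n₀ : ℕ} (a : Fin n₀) : ℕ := if (a : ℕ) = 0 then h else h - 1

theorem lev_le (h : ℕ) {n₀ : ℕ} (a : Fin n₀) : lev h a ≤ h := by
  unfold lev
  split_ifs <;> omega

/-- The `R`-points of `Z_{n₀,r,h}`: vectors with `n₀ r` coordinates, the `i`-th one being in `𝕎_h` if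
`i ≡ 1` modulo `n₀` and in `𝕎_{h-1}` otherwise. The index `i = n₀ ρ + a + 1` is written as the pair
`(ρ, a)`, where `ρ` is the number of the block and `a` the place in the block, both counted from
zero. -/
abbrev Z (n₀ r h : ℕ) (R : PerfAlg O) : Type u :=
  Fin r → (a : Fin n₀) → TruncWitt O (lev h a) R

variable {n₀ r h : ℕ} {R S : PerfAlg O}

/-- Functoriality of `Z_{n₀,r,h}`. -/
def zMap (f : R →ₐ[GeomField O] S) (x : Z n₀ r h R) : Z n₀ r h S :=
  fun ρ a => wMap (lev h a) (f.restrictScalars O) (x ρ a)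

/-- A lift of an element of `𝕎_{lev h a}` to `𝕎_h`. It is only used in expressions which do not
depend on the choice of the lift. -/
def wLift {R : PerfAlg O} (a : Fin n₀) (w : TruncWitt O (lev h a) R) : TruncWitt O h R :=
  Function.surjInv (wRed_surjective (lev_le h a)) w

variable [Finite (IsLocalRing.ResidueField O)] (ϖ : O) (k₀ : ℕ)

/-- The entry in row `(ρ, a')` and column `j` (counted from zero) of `g_{n₀,r}(x)`: the respective
coordinate of `ϖ^{-⌊j k₀ / n₀⌋} (b_r σ)^j (x)`, where `b_r` is block-diagonal with blocks `c`. -/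
def gEntry (x : Z n₀ r h R) (p : Fin r × Fin n₀) (j : ℕ) : TruncWitt O h R :=
  ∑ a : Fin n₀, scaledPow ϖ n₀ k₀ j p.2 a • sigma^[j] (wLift a (x p.1 a))

/-- The determinant `|g_{n₀,r}(x)|` in `𝕎_h(R)`. -/
def detG (x : Z n₀ r h R) : TruncWitt O h R :=
  Matrix.det (Matrix.of fun i j : Fin (r * n₀) => gEntry ϖ k₀ x (finProdFinEquiv.symm i) j)

variable (n₀ r h R) in
/-- The `R`-points of `X_h`, for `n' = r` and `n = n' n₀`. -/
def X : Set (Z n₀ r h R) := {x | IsFqUnit (detG ϖ k₀ x)}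

variable (n₀ r h R) in
/-- The `R`-points of `Y_{n₀,r,h}`. -/
def Y : Set (Z n₀ r h R) := {x | IsUnit (detG ϖ k₀ x)}

variable {i₀ j₀ : ℕ}

/-- The minor `m_i(x)`, for `i = (ρ, a)` in one of the first `i₀` blocks: the determinant of the
submatrix of `g_{n₀,n'}(x)`, `n' = i₀ + j₀`, which consists of the `i`-th row, followed by the last
`n - s = j₀ n₀` rows, and of the first `n - s + 1` columns; it is taken in `𝕎_{lev h a}`. -/
def minor (x : Z n₀ (i₀ + j₀) h R) (ρ : Fin i₀) (a : Fin n₀) : TruncWitt O (lev h a) R :=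
  let row : Fin (j₀ * n₀ + 1) → Fin (i₀ + j₀) × Fin n₀ :=
    Fin.cons (Fin.castAdd j₀ ρ, a) fun t =>
      (Fin.natAdd i₀ (finProdFinEquiv.symm t).1, (finProdFinEquiv.symm t).2)
  wRed (lev_le h a)
    (Matrix.det (Matrix.of fun i j : Fin (j₀ * n₀ + 1) => gEntry ϖ k₀ x (row i) j))

/-- The assignment `x ↦ (m, x')`. -/
def alpha (x : Z n₀ (i₀ + j₀) h R) : Z n₀ i₀ h R × Z n₀ j₀ h R :=
  (minor ϖ k₀ x, fun ρ => x (Fin.natAdd i₀ ρ))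

/-- The `R`-points of the target: pairs `(m, x')` in `Y_{n₀,i₀,h} × Y_{n₀,j₀,h}` such that
`|g(m)| / ∏_{j=1}^{s-1} σ^j |g(x')|` is in `𝕎_h^×(𝔽_q)`, where `s = n₀ i₀`. -/
def Target (n₀ i₀ j₀ h : ℕ) (R : PerfAlg O) (ϖ : O) (k₀ : ℕ) :
    Set (Z n₀ i₀ h R × Z n₀ j₀ h R) :=
  {y | y.1 ∈ Y n₀ i₀ h R ϖ k₀ ∧ y.2 ∈ Y n₀ j₀ h R ϖ k₀ ∧
    ∃ c : TruncWitt O h R, IsFqUnit c ∧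
      detG ϖ k₀ y.1 = c * ∏ j ∈ Finset.Icc 1 (n₀ * i₀ - 1), sigma^[j] (detG ϖ k₀ y.2)}

end Spaces

/-! ## The group `N_h` and its action -/

section Group

variable {O : Type u} [CommRing O] [IsLocalRing O] [Finite (IsLocalRing.ResidueField O)]

variable (O) in
/-- The group `N_h`. It consists of the unipotent block matrices with identity diagonal blocks and,
in block row `i < i₀` and block column `i₀ + j`, `j < j₀`, the block `blockMat (u i j)` (all other
blocks vanish), with parameters `u i j t` in `𝕎_h(𝔽_{q^{n₀}})` for `t = 0`, and in
`𝕎_{h-1}(𝔽_{q^{n₀}})` for `0 < t < n₀`. Such matrices are multiplied by adding the blocks, so the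
group is written additively. `𝔽_{q^{n₀}}`-points are points over the algebraic closure which are
fixed by `σ^{n₀}`. -/
def N (n₀ i₀ j₀ h : ℕ) :
    AddSubgroup (Fin i₀ → Fin j₀ → (t : Fin n₀) → TruncWitt O (lev h t) (PerfAlg.base O)) where
  carrier := {u | ∀ i j t, sigma^[n₀] (u i j t) = u i j t}
  add_mem' := by
    intro u v hu hv i j t
    simp only [Pi.add_apply]
    rw [iterate_map_add, hu i j t, hv i j t]
  zero_mem' := by
    intro i j t
    simp only [Pi.zero_apply]
    rw [iterate_map_zero]
  neg_mem' := by
    intro u hu i j t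
    simp only [Pi.neg_apply]
    rw [iterate_map_neg, hu i j t]

variable {n₀ i₀ j₀ h : ℕ} (ϖ : O) (k₀ l : ℕ)

/-- The `n₀ × n₀`-block
`∑_t ϖ^{-⌊t k₀ / n₀⌋} c^t diag(a_t, σ^l(a_t), σ^{2l}(a_t), …, σ^{(n₀-1)l}(a_t))`. -/
def blockMat (a : (t : Fin n₀) → TruncWitt O (lev h t) (PerfAlg.base O)) :
    Matrix (Fin n₀) (Fin n₀) (TruncWitt O h (PerfAlg.base O)) :=
  ∑ t : Fin n₀, (scaledPow ϖ n₀ k₀ t).map (algebraMap O _) *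
    Matrix.diagonal fun p : Fin n₀ => sigma^[p * l] (wLift t (a t))

/-- The action of the element of `N_h` with parameters `u` on `Z_{n₀,n',h}`, `n' = i₀ + j₀`: the
product of the block matrix with the vector `x`. -/
def act (u : Fin i₀ → Fin j₀ → (t : Fin n₀) → TruncWitt O (lev h t) (PerfAlg.base O))
    {R : PerfAlg O} (x : Z n₀ (i₀ + j₀) h R) : Z n₀ (i₀ + j₀) h R :=
  Fin.addCases
    (fun i a => x (Fin.castAdd j₀ i) a + wRed (lev_le h a)
      (∑ j : Fin j₀, ((blockMat ϖ k₀ l (u i j)).map (wMap h (R.ofBase.restrictScalars O))).mulVec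
        (fun b => wLift b (x (Fin.natAdd i₀ j) b)) a))
    (fun j => x (Fin.natAdd i₀ j))

end Group

/-! ## Representability and the quotient -/

section Quotient

variable {O : Type u} [CommRing O] [IsLocalRing O] [Finite (IsLocalRing.ResidueField O)]

/-- The perfect scheme `Spec A` represents `X_h`, with universal point `ξ`. -/
def RepresentsX (ϖ : O) (n₀ k₀ r h : ℕ) (A : PerfAlg O) (ξ : Z n₀ r h A) : Prop :=
  ∀ R : PerfAlg O, Set.BijOn (fun f : A →ₐ[GeomField O] R => zMap f ξ) Set.univ (X n₀ r h R ϖ k₀)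

/-- The perfect scheme `Spec B` represents the target, with universal point `ζ`. -/
def RepresentsTarget (ϖ : O) (n₀ k₀ i₀ j₀ h : ℕ) (B : PerfAlg O)
    (ζ : Z n₀ i₀ h B × Z n₀ j₀ h B) : Prop :=
  ∀ R : PerfAlg O, Set.BijOn (fun f : B →ₐ[GeomField O] R => Prod.map (zMap f) (zMap f) ζ)
    Set.univ (Target n₀ i₀ j₀ h R ϖ k₀)

/-- For `X_h = Spec A` with universal point `ξ`, the algebra `A^{N_h}` of those elements of `A` which
are fixed by the endomorphisms `ψ` of `A` that correspond to the elements `u` of `N_h`, that is, with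
`ψ(ξ) = u · ξ`. -/
def invariants (ϖ : O) {n₀ i₀ j₀ h : ℕ} (k₀ l : ℕ) (A : PerfAlg O) (ξ : Z n₀ (i₀ + j₀) h A) :
    Subalgebra (GeomField O) A :=
  ⨅ u ∈ N O n₀ i₀ j₀ h, ⨅ ψ : A →ₐ[GeomField O] A, ⨅ _ : zMap ψ ξ = act ϖ k₀ l u ξ,
    AlgHom.equalizer ψ (AlgHom.id (GeomField O) A)

/-- The quotient scheme `N_h \ X_h` of the affine scheme `X_h = Spec A` by the finite group `N_h`. -/
def quotientScheme (ϖ : O) {n₀ i₀ j₀ h : ℕ} (k₀ l : ℕ) (A : PerfAlg O)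
    (ξ : Z n₀ (i₀ + j₀) h A) : Scheme.{u} :=
  Spec (CommRingCat.of (invariants ϖ k₀ l A ξ))

/-- For `φ : B → A` with values in `A^{N_h}`, the induced morphism `N_h \ X_h → Spec B`. -/
def quotientMap (ϖ : O) {n₀ i₀ j₀ h : ℕ} (k₀ l : ℕ) (A : PerfAlg O) (ξ : Z n₀ (i₀ + j₀) h A)
    {B : PerfAlg O} (φ : B →ₐ[GeomField O] A) (hφ : ∀ b, φ b ∈ invariants ϖ k₀ l A ξ) :
    quotientScheme ϖ k₀ l A ξ ⟶ Spec (CommRingCat.of B) :=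
  Spec.map (CommRingCat.ofHom (φ.codRestrict (invariants ϖ k₀ l A ξ) hφ).toRingHom)

end Quotient

end

end LoopDL

/-!
The ring `𝕎_h(R)` of a perfect algebra is studied through its presentation `O[(R, ·)] / I ^ h`:
Frobenius is bijective on `I`, which gives `I = I ^ h + (ϖ)` (`augIdeal_le_sup`), and a derivation
argument gives flatness over `O / ϖ ^ h` (`mem_augIdeal_of_smul_mem`). So `𝕎_h(R)` has unique
Teichmüller expansions (`teich_expansion_bijective`), and units are detected by the residue in `R`.

Write `Π` for the operator `e_a ↦ e_{a+1}`, `e_{n₀} ↦ ϖ e_1` on `𝕎_h ^ n₀`, and `Φ_j` for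
`ϖ^{-⌊j k₀ / n₀⌋} (c σ)^j`, a power of `Π` composed with `σ ^ j`. The truncated coordinates amount
to working modulo `Π ^ (n₀ (h - 1) + 1)` (`negl_iff`), and none of the determinants in question
depends on the choice of lifts to `𝕎_h` (`IsLift.detG`, `IsLift.minor`).

Expanding the minors `m_i(x)` along their first row shows that the `ρ`-th block of `m(x)` is
`P_{x'}(x_ρ)`, where `P_{x'} = ∑_t C_t Φ_t` is an additive operator (`twPoly`) with coefficients
depending on `x'` only, which vanishes at the blocks of `x'`. The following facts prove the theorem.

* The product formula `|g(x)| ∏_{j < s} σ^j |g(x')| = ± |g(m)| |g(x')|` (`det_gMat_mul_prod`), a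
  block triangular form of `g(x)` times the matrix of coefficients of the operators `Φ_j P_{x'}`.
  Moreover `|g(x)|` is invertible exactly if the residues of the leading coordinates are linearly
  independent over `𝔽_{q^{n₀}}` at all geometric points, so `|g(x')|` is invertible on `X_h`. Hence
  `X_h` is the preimage of the target (`mem_X_iff`).
* The blocks of the matrices in `N_h` commute with the `Φ_j`, hence with `P_{x'}`
  (`twPoly_blockAct`), and therefore `x ↦ (m, x')` is invariant under `N_h`.
* Modulo `Π` the operator `P_{x'}` is an additive polynomial in `x ↦ x ^ q ^ n₀` whose linear and
  leading coefficients are invertible (`isUnit_res_cof_zero`, `isUnit_res_cof_top`) and whose kernel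
  on a field is spanned over `𝔽_{q^{n₀}}` by the residues of `x'`. Successive approximation with
  respect to `Π` shows that the fibres of `x ↦ (m, x')` over an algebraically closed field are
  orbits of `N_h` (`exists_act_eq`). In the same way, every point of the target lifts to `X_h` after
  adjoining roots of étale additive polynomials (`exists_cover_alpha`). The algebra which arises is
  again perfect, the base is a direct summand of it, and all geometric points of the base lift to it.

Both sides are representable, being cut out by equations and invertibility conditions in the free
perfect algebra on the Teichmüller components. Let `φ : B → A` be the map on functions, and let
`ι : B → E` be a cover on which the universal point of the target lifts to `X_h`, so that `ι` factors
as `g φ`. As `ι` has a retraction, `φ` is injective. If `a` is an `N_h`-invariant function, the value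
of `g(a)` at a geometric point of `E` depends only on its image in the target. Thus
`g(a) ⊗ 1 - 1 ⊗ g(a)` is nilpotent in `E ⊗_B E`, and since Frobenius can be inverted on both factors,
`g(a)` comes from an element `b` of `B` (`IsCover.exists_eq`). Then `a = φ(b)`, because they agree at
all geometric points and `A` is reduced.
-/

open CategoryTheory AlgebraicGeometry
open scoped ValuativeRel

namespace LoopDL

universe u

set_option linter.unusedSectionVars false
set_option linter.unusedDecidableInType false
set_option linter.unusedFintypeInType false

/-! ### Frobenius on perfect algebras -/

section Frobenius

variable {O : Type u} [CommRing O] [IsLocalRing O] [Finite (IsLocalRing.ResidueField O)]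

variable (O) in
/-- The cardinality `q` of the residue field. -/
noncomputable def resCard : ℕ := Nat.card (IsLocalRing.ResidueField O)

theorem frob_apply (R : PerfAlg O) (a : R) : frob R a = a ^ resCard O := by
  let := Fintype.ofFinite (IsLocalRing.ResidueField O)
  change a ^ Fintype.card (IsLocalRing.ResidueField O) = _
  rw [resCard, Nat.card_eq_fintype_card]

variable (O) in
theorem resCard_eq_pow : (ringChar (GeomField O)).Prime ∧
    ∃ n : ℕ, 0 < n ∧ resCard O = ringChar (GeomField O) ^ n := by
  let := Fintype.ofFinite (IsLocalRing.ResidueField O)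
  rw [← Algebra.ringChar_eq (IsLocalRing.ResidueField O) (GeomField O)]
  obtain ⟨n, hp, h⟩ := FiniteField.card (IsLocalRing.ResidueField O)
    (ringChar (IsLocalRing.ResidueField O))
  exact ⟨hp, n, n.2, by rw [resCard, Nat.card_eq_fintype_card, h]⟩

variable (O) in
theorem one_lt_resCard : 1 < resCard O := by
  obtain ⟨hp, n, hn, h⟩ := resCard_eq_pow O
  rw [h]
  exact Nat.one_lt_pow hn.ne' hp.one_lt

theorem frob_iterate_apply (R : PerfAlg O) (n : ℕ) (a : R) :
    (frob R)^[n] a = a ^ resCard O ^ n := by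
  induction n with
  | zero => simp
  | succ n ih => rw [Function.iterate_succ_apply', ih, frob_apply, ← pow_mul, pow_succ]

theorem frob_bijective (R : PerfAlg O) : Function.Bijective (frob R) := by
  obtain ⟨-, n, -, h⟩ := resCard_eq_pow O
  have : (frob R : R → R) = (fun x : R => x ^ ringChar (GeomField O))^[n] := by
    funext a
    rw [frob_apply, h, pow_iterate]
  rw [this]
  exact R.perfect.iterate n

theorem natCast_ringChar_geomField (A : Type*) [CommRing A] [Algebra (GeomField O) A] :
    ((ringChar (GeomField O) : ℕ) : A) = 0 := by
  rw [← map_natCast (algebraMap (GeomField O) A), ringChar.Nat.cast_ringChar, map_zero]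

theorem PerfAlg.add_pow_ringChar (R : PerfAlg O) (n : ℕ) (a b : R) :
    (a + b) ^ ringChar (GeomField O) ^ n =
      a ^ ringChar (GeomField O) ^ n + b ^ ringChar (GeomField O) ^ n := by
  obtain ⟨r, hr⟩ := exists_add_pow_prime_pow_eq (resCard_eq_pow O).1 a b n
  rw [hr, natCast_ringChar_geomField]
  ring

instance (R : PerfAlg O) : IsReduced R := by
  have hp := (resCard_eq_pow O).1
  refine ⟨fun x ⟨n, hn⟩ => ?_⟩
  have h1 : (fun x : R => x ^ ringChar (GeomField O))^[n] x = 0 := by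
    rw [pow_iterate]
    exact pow_eq_zero_of_le (Nat.lt_pow_self hp.one_lt).le hn
  have h2 : (fun x : R => x ^ ringChar (GeomField O))^[n] 0 = 0 := by
    rw [pow_iterate]
    exact zero_pow (pow_pos hp.pos n).ne'
  exact (R.perfect.injective.iterate n) (h1.trans h2.symm)

theorem algebraMap_eq_residue (R : PerfAlg O) (c : O) :
    algebraMap O R c = algebraMap (IsLocalRing.ResidueField O) R (IsLocalRing.residue O c) := by
  rfl

end Frobenius

/-! ### The Cuntz–Deninger ring of a perfect algebra -/

section CuntzDeninger

variable {O : Type u} [CommRing O] [IsDomain O] [IsDiscreteValuationRing O]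
  [Finite (IsLocalRing.ResidueField O)] {ϖ : O} [hϖ : Fact (Irreducible ϖ)]

theorem uniformizer_dvd_iff {c : O} : ϖ ∣ c ↔ IsLocalRing.residue O c = 0 := by
  rw [IsLocalRing.residue_eq_zero_iff,
    ((IsDiscreteValuationRing.irreducible_iff_uniformizer ϖ).1 hϖ.out), Ideal.mem_span_singleton]

theorem uniformizer_dvd_resChar : ϖ ∣ ((ringChar (GeomField O) : ℕ) : O) := by
  rw [uniformizer_dvd_iff, map_natCast,
    ← Algebra.ringChar_eq (IsLocalRing.ResidueField O) (GeomField O),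
    ringChar.Nat.cast_ringChar]

theorem algebraMap_uniformizer (R : PerfAlg O) : algebraMap O R ϖ = 0 := by
  rw [algebraMap_eq_residue, uniformizer_dvd_iff.1 dvd_rfl, map_zero]

theorem uniformizer_dvd_pow_sub (c : O) : ϖ ∣ c ^ resCard O - c := by
  let := Fintype.ofFinite (IsLocalRing.ResidueField O)
  rw [uniformizer_dvd_iff, map_sub, map_pow, resCard, Nat.card_eq_fintype_card,
    FiniteField.pow_card, sub_self]

variable (R : PerfAlg O)

/-- The Frobenius `[a] ↦ [a ^ q]` of `O[(R, ·)]`. -/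
noncomputable def monFrob : MonoidAlgebra O R →+* MonoidAlgebra O R :=
  MonoidAlgebra.mapDomainRingHom O ((frob R : R →ₐ[O] R) : R →* R)

theorem monFrob_single (a : R) (c : O) :
    monFrob R (MonoidAlgebra.single a c) = MonoidAlgebra.single (frob R a) c := by
  simp [monFrob]

theorem augmentation_monFrob (x : MonoidAlgebra O R) :
    augmentation O R (monFrob R x) = frob R (augmentation O R x) := by
  have : (augmentation O R : MonoidAlgebra O R →+* R).comp (monFrob R) =
      (frob R : R →+* R).comp (augmentation O R : MonoidAlgebra O R →+* R) := by
    ext x <;> simp [augmentation, monFrob]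
  exact RingHom.congr_fun this x

theorem monFrob_mem_augIdeal {x : MonoidAlgebra O R} :
    monFrob R x ∈ augIdeal O R ↔ x ∈ augIdeal O R := by
  simp only [augIdeal, RingHom.mem_ker]
  rw [augmentation_monFrob]
  exact map_eq_zero_iff _ (frob_bijective R).injective

theorem monFrob_surjective : Function.Surjective (monFrob R) := by
  intro x
  induction x using MonoidAlgebra.induction_linear with
  | zero => exact ⟨0, map_zero _⟩
  | add x y hx hy =>
    obtain ⟨a, rfl⟩ := hx
    obtain ⟨b, rfl⟩ := hy
    exact ⟨a + b, map_add _ _ _⟩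
  | single a c =>
    obtain ⟨b, rfl⟩ := (frob_bijective R).surjective a
    exact ⟨_, monFrob_single R b c⟩

variable (ϖ) in
/-- `(x + y) ^ q - x ^ q - y ^ q` is divisible by `ϖ x y`. -/
theorem exists_add_pow_resCard {A : Type*} [CommRing A] [Algebra O A] (x y : A) :
    ∃ r, (x + y) ^ resCard O = x ^ resCard O + y ^ resCard O + ϖ • (x * y * r) := by
  obtain ⟨hp, n, -, hq⟩ := resCard_eq_pow O
  obtain ⟨r, hr⟩ := exists_add_pow_prime_pow_eq hp x y n
  obtain ⟨u, hu⟩ := uniformizer_dvd_resChar (ϖ := ϖ)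
  refine ⟨algebraMap O A u * r, ?_⟩
  rw [hq, hr, ← map_natCast (algebraMap O A), hu, map_mul, Algebra.smul_def]
  ring

theorem uniformizer_mem_augIdeal (x : MonoidAlgebra O R) : ϖ • x ∈ augIdeal O R := by
  simp only [augIdeal, RingHom.mem_ker, map_smul]
  rw [Algebra.smul_def, algebraMap_uniformizer, zero_mul]

variable (ϖ) in
/-- Frobenius on `O[(R, ·)]` is a lift of the `q`-th power modulo `ϖ`. -/
theorem monFrob_eq_pow_add (x : MonoidAlgebra O R) :
    ∃ d, monFrob R x = x ^ resCard O + ϖ • d := by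
  induction x using MonoidAlgebra.induction_linear with
  | zero => exact ⟨0, by simp [(zero_lt_one.trans (one_lt_resCard O)).ne']⟩
  | add x y hx hy =>
    obtain ⟨d, hd⟩ := hx
    obtain ⟨e, he⟩ := hy
    obtain ⟨r, hr⟩ := exists_add_pow_resCard ϖ x y
    refine ⟨d + e - x * y * r, ?_⟩
    rw [map_add, hd, he, hr, smul_sub, smul_add]
    ring
  | single a c =>
    obtain ⟨u, hu⟩ := uniformizer_dvd_pow_sub (ϖ := ϖ) c
    refine ⟨MonoidAlgebra.single (a ^ resCard O) (-u), ?_⟩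
    rw [monFrob_single, frob_apply, MonoidAlgebra.single_pow, MonoidAlgebra.smul_single,
      ← MonoidAlgebra.single_add]
    congr 1
    rw [smul_eq_mul, mul_neg, ← hu]
    ring

variable (ϖ) in
/-- For the Frobenius `F` of `O[(R, ·)]` and the kernel `I` of the augmentation, the `ϖ`-derivation
`x ↦ (F(x) - x ^ q) / ϖ` lowers the `I`-adic filtration by at most one step. -/
theorem exists_mem_pow_monFrob (h : ℕ) {x : MonoidAlgebra O R} (hx : x ∈ augIdeal O R ^ (h + 1)) :
    ∃ d ∈ augIdeal O R ^ h, monFrob R x = x ^ resCard O + ϖ • d := by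
  induction h generalizing x with
  | zero =>
    obtain ⟨d, hd⟩ := monFrob_eq_pow_add ϖ R x
    exact ⟨d, by simp, hd⟩
  | succ h ih =>
    have h0 : resCard O ≠ 0 := (zero_lt_one.trans (one_lt_resCard O)).ne'
    have key : x ∈ augIdeal O R ^ (h + 2) ∧
        ∃ d ∈ augIdeal O R ^ (h + 1), monFrob R x = x ^ resCard O + ϖ • d := by
      rw [pow_succ'] at hx
      induction hx using Submodule.mul_induction_on' with
      | mem_mul_mem a ha b hb =>
        refine ⟨by rw [pow_succ']; exact Ideal.mul_mem_mul ha hb, ?_⟩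
        obtain ⟨d, hd⟩ := monFrob_eq_pow_add ϖ R a
        obtain ⟨e, he, he'⟩ := ih hb
        refine ⟨d * monFrob R b + a ^ resCard O * e, Ideal.add_mem _ (Ideal.mul_mem_left _ _ ?_) ?_,
          ?_⟩
        · have := Ideal.le_comap_pow (monFrob R) (K := augIdeal O R) (h + 1)
          refine this (Ideal.pow_right_mono (fun z hz => ?_) (h + 1) hb)
          exact (monFrob_mem_augIdeal R).2 hz
        · rw [pow_succ']
          exact Ideal.mul_mem_mul (Ideal.pow_mem_of_mem _ ha _ (Nat.pos_of_ne_zero h0)) he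
        · rw [map_mul, smul_add, ← smul_mul_assoc, ← mul_smul_comm]
          calc monFrob R a * monFrob R b
              = (a ^ resCard O + ϖ • d) * monFrob R b := by rw [← hd]
            _ = a ^ resCard O * (b ^ resCard O + ϖ • e) + ϖ • d * monFrob R b := by
                rw [← he']; ring
            _ = _ := by ring
      | add a _ b _ ha hb =>
        obtain ⟨ha, d, hd, hd'⟩ := ha
        obtain ⟨hb, e, he, he'⟩ := hb
        refine ⟨Ideal.add_mem _ ha hb, ?_⟩
        obtain ⟨r, hr⟩ := exists_add_pow_resCard ϖ a b
        refine ⟨d + e - a * b * r, Ideal.sub_mem _ (Ideal.add_mem _ hd he) ?_, ?_⟩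
        · exact Ideal.mul_mem_right _ _ (Ideal.mul_mem_right _ _
            (Ideal.pow_le_pow_right (Nat.le_succ _) ha))
        · rw [map_add, hd', he', hr, smul_sub, smul_add]
          ring
    exact key.2

/-- The truncated Witt vectors are flat: `ϖ ^ k x ∈ I ^ (k + 1)` only if `x ∈ I`. For the induction,
the `ϖ`-derivation is applied to `ϖ ^ (k + 1) x`: the term with the `q`-th power is divisible by a
high power of `ϖ`, which leaves `ϖ ^ k F(x) ∈ I ^ (k + 1)`. -/
theorem mem_augIdeal_of_smul_mem (k : ℕ) {x : MonoidAlgebra O R}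
    (hx : ϖ ^ k • x ∈ augIdeal O R ^ (k + 1)) : x ∈ augIdeal O R := by
  induction k generalizing x with
  | zero => simpa using hx
  | succ k ih =>
    have hq := one_lt_resCard O
    obtain ⟨d, hd, hd'⟩ := exists_mem_pow_monFrob ϖ R (k + 1) hx
    have hF : monFrob R (ϖ ^ (k + 1) • x) = ϖ ^ (k + 1) • monFrob R x := by
      simp [monFrob, MonoidAlgebra.mapDomain_smul]
    obtain ⟨m, hm⟩ : ∃ m, (k + 1) * resCard O = (k + 1 + m) + 1 := by
      refine ⟨(k + 1) * resCard O - (k + 2), ?_⟩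
      have : (k + 1) * 2 ≤ (k + 1) * resCard O := Nat.mul_le_mul_left _ hq
      omega
    rw [hF, smul_pow, ← pow_mul, hm, pow_succ', pow_succ', mul_smul, mul_smul, ← smul_add] at hd'
    have h1 : ϖ ^ k • monFrob R x = ϖ ^ (k + 1 + m) • x ^ resCard O + d := by
      have hinj : Function.Injective fun y : MonoidAlgebra O R => ϖ • y := by
        intro a b hab
        ext z
        have := congrArg (fun w : MonoidAlgebra O R => w.coeff z) hab
        simpa [hϖ.out.ne_zero] using this
      exact hinj hd'
    have hpow : ∀ j : ℕ, ∀ y : MonoidAlgebra O R, ϖ ^ j • y ∈ augIdeal O R ^ j := by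
      intro j y
      have : ϖ ^ j • y = (ϖ • (1 : MonoidAlgebra O R)) ^ j * y := by
        rw [smul_pow, one_pow, smul_mul_assoc, one_mul]
      rw [this]
      exact Ideal.mul_mem_right _ _ (Ideal.pow_mem_pow (uniformizer_mem_augIdeal R 1) j)
    refine (monFrob_mem_augIdeal R).1 (ih ?_)
    rw [h1]
    exact Ideal.add_mem _ (Ideal.pow_le_pow_right (by omega) (hpow _ _)) hd

variable (ϖ) in
/-- As Frobenius is bijective on `I`, each element of `I` is a `q`-th power in `I` up to a multiple
of `ϖ`; so `I ⊆ I ^ h + (ϖ)` for all `h`. -/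
theorem augIdeal_le_sup (h : ℕ) {x : MonoidAlgebra O R} (hx : x ∈ augIdeal O R) :
    ∃ y ∈ augIdeal O R ^ h, ∃ d, x = y + ϖ • d := by
  obtain ⟨n, hn⟩ : ∃ n, h ≤ resCard O ^ n := ⟨h, (Nat.lt_pow_self (one_lt_resCard O)).le⟩
  suffices H : ∀ n, ∀ x ∈ augIdeal O R, ∃ z ∈ augIdeal O R, ∃ d,
      x = z ^ resCard O ^ n + ϖ • d by
    obtain ⟨z, hz, d, hd⟩ := H n x hx
    exact ⟨_, Ideal.pow_le_pow_right hn (Ideal.pow_mem_pow hz _), d, hd⟩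
  clear hn hx x n
  intro n
  induction n with
  | zero => exact fun x hx => ⟨x, hx, 0, by simp⟩
  | succ n ih =>
    intro x hx
    obtain ⟨y, rfl⟩ := monFrob_surjective R x
    obtain ⟨z, hz, d, hd⟩ := ih y ((monFrob_mem_augIdeal R).1 hx)
    have hF : monFrob R (ϖ • d) = ϖ • monFrob R d := by
      simp [monFrob, MonoidAlgebra.mapDomain_smul]
    obtain ⟨e, he⟩ := monFrob_eq_pow_add ϖ R (z ^ resCard O ^ n)
    refine ⟨z, hz, e + monFrob R d, ?_⟩
    rw [hd, map_add, hF, he, smul_add, ← pow_mul, ← pow_succ, add_assoc]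

variable (ϖ) in
/-- `I ^ k ⊆ I ^ h + (ϖ ^ k)`. -/
theorem augIdeal_pow_le_sup (k h : ℕ) {x : MonoidAlgebra O R} (hx : x ∈ augIdeal O R ^ k) :
    ∃ y ∈ augIdeal O R ^ h, ∃ d, x = y + ϖ ^ k • d := by
  induction k generalizing x with
  | zero => exact ⟨0, Ideal.zero_mem _, x, by simp⟩
  | succ k ih =>
    rw [pow_succ'] at hx
    induction hx using Submodule.mul_induction_on' with
    | mem_mul_mem a ha b hb =>
      obtain ⟨y, hy, d, hd⟩ := augIdeal_le_sup ϖ R h ha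
      obtain ⟨z, hz, e, he⟩ := ih hb
      refine ⟨y * b + ϖ • d * z, Ideal.add_mem _ (Ideal.mul_mem_right _ _ hy)
        (Ideal.mul_mem_left _ _ hz), d * e, ?_⟩
      have : ϖ ^ (k + 1) • (d * e) = (ϖ • d) * (ϖ ^ k • e) := by
        rw [smul_mul_smul_comm, pow_succ']
      rw [this]
      nth_rewrite 1 [hd]
      rw [add_mul]
      nth_rewrite 2 [he]
      ring
    | add a _ b _ ha hb =>
      obtain ⟨y, hy, d, hd⟩ := ha
      obtain ⟨z, hz, e, he⟩ := hb
      exact ⟨y + z, Ideal.add_mem _ hy hz, d + e, by rw [hd, he, smul_add]; ring⟩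

end CuntzDeninger

/-! ### Truncated Witt vectors -/

section TruncWitt

variable {O : Type u} [CommRing O] {h h' : ℕ}

/-- The Teichmüller representative. -/
noncomputable def teich {R : Type u} [CommRing R] [Algebra O R] : R →* TruncWitt O h R :=
  (Ideal.Quotient.mk (augIdeal O R ^ h) : MonoidAlgebra O R →* _).comp (MonoidAlgebra.of O R)

theorem mk_single {R : Type u} [CommRing R] [Algebra O R] (a : R) (c : O) :
    (Ideal.Quotient.mk (augIdeal O R ^ h) (MonoidAlgebra.single a c) : TruncWitt O h R) =
      c • teich a := by
  change _ = Ideal.Quotient.mk _ (c • MonoidAlgebra.of O R a)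
  simp

/-- The multiples of Teichmüller representatives generate `𝕎_h(R)` additively. -/
theorem truncWitt_induction {R : Type u} [CommRing R] [Algebra O R] {P : TruncWitt O h R → Prop}
    (h1 : ∀ (c : O) (a : R), P (c • teich a)) (h2 : ∀ v w, P v → P w → P (v + w))
    (w : TruncWitt O h R) : P w := by
  obtain ⟨x, rfl⟩ := Ideal.Quotient.mk_surjective w
  induction x using MonoidAlgebra.induction_linear with
  | zero => simpa using h1 0 0
  | add x y hx hy => rw [map_add]; exact h2 _ _ hx hy
  | single a c => rw [mk_single]; exact h1 c a

section Functoriality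

variable {R S T : Type u} [CommRing R] [Algebra O R] [CommRing S] [Algebra O S] [CommRing T]
  [Algebra O T]

theorem wMap_smul (f : R →ₐ[O] S) (c : O) (w : TruncWitt O h R) :
    wMap h f (c • w) = c • wMap h f w := by
  obtain ⟨x, rfl⟩ := Ideal.Quotient.mk_surjective w
  change Ideal.Quotient.mk _ (MonoidAlgebra.mapDomainRingHom O (f : R →* S) (c • x)) =
    Ideal.Quotient.mk _ (c • MonoidAlgebra.mapDomainRingHom O (f : R →* S) x)
  congr 1
  simp [MonoidAlgebra.mapDomain_smul]

theorem wMap_teich (f : R →ₐ[O] S) (a : R) :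
    wMap h f (teich a) = teich (f a) := by
  change Ideal.Quotient.mk _ (MonoidAlgebra.mapDomainRingHom O (f : R →* S) _) =
    Ideal.Quotient.mk _ _
  simp

theorem wRed_smul (hh : h' ≤ h) (c : O) (w : TruncWitt O h R) :
    wRed hh (c • w) = c • wRed hh w := by
  obtain ⟨x, rfl⟩ := Ideal.Quotient.mk_surjective w
  rfl

theorem wRed_teich (hh : h' ≤ h) (a : R) :
    wRed hh (teich a : TruncWitt O h R) = teich a := rfl

theorem wMap_comp (f : R →ₐ[O] S) (g : S →ₐ[O] T) (w : TruncWitt O h R) :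
    wMap h (g.comp f) w = wMap h g (wMap h f w) := by
  induction w using truncWitt_induction with
  | h1 c a => simp only [wMap_smul, wMap_teich, AlgHom.comp_apply]
  | h2 v w hv hw => rw [map_add, map_add, map_add, hv, hw]

theorem wMap_id (w : TruncWitt O h R) : wMap h (AlgHom.id O R) w = w := by
  induction w using truncWitt_induction with
  | h1 c a => simp only [wMap_smul, wMap_teich, AlgHom.id_apply]
  | h2 v w hv hw => rw [map_add, hv, hw]

theorem wRed_wMap (hh : h' ≤ h) (f : R →ₐ[O] S) (w : TruncWitt O h R) :
    wRed hh (wMap h f w) = wMap h' f (wRed hh w) := by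
  induction w using truncWitt_induction with
  | h1 c a => simp only [wMap_smul, wRed_smul, wRed_teich, wMap_teich]
  | h2 v w hv hw => simp only [map_add, hv, hw]

end Functoriality

section Frob

variable [IsLocalRing O] [Finite (IsLocalRing.ResidueField O)] {R S : PerfAlg O}

theorem sigma_smul (c : O) (w : TruncWitt O h R) : sigma (c • w) = c • sigma w := wMap_smul _ _ _

/-- The Frobenius of `𝕎_h(R)` as a homomorphism of `O`-algebras. -/
noncomputable def sigmaAlg (h : ℕ) (R : PerfAlg O) : TruncWitt O h R →ₐ[O] TruncWitt O h R :=
  { (sigma : TruncWitt O h R →+* TruncWitt O h R) with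
    commutes' := fun c => by
      change sigma (algebraMap O _ c) = algebraMap O _ c
      rw [Algebra.algebraMap_eq_smul_one, sigma_smul, map_one] }

theorem coe_sigmaAlg : (sigmaAlg h R : TruncWitt O h R → TruncWitt O h R) = sigma := rfl

theorem sigma_teich (a : R) : sigma (teich a : TruncWitt O h R) = teich (a ^ resCard O) := by
  rw [sigma, wMap_teich, frob_apply]

theorem sigma_iterate_teich (n : ℕ) (a : R) :
    sigma^[n] (teich a : TruncWitt O h R) = teich (a ^ resCard O ^ n) := by
  induction n with
  | zero => simp
  | succ n ih => rw [Function.iterate_succ_apply', ih, sigma_teich, ← pow_mul, pow_succ]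

theorem sigma_iterate_smul (n : ℕ) (c : O) (w : TruncWitt O h R) :
    sigma^[n] (c • w) = c • sigma^[n] w := by
  induction n with
  | zero => rfl
  | succ n ih => rw [Function.iterate_succ_apply', ih, Function.iterate_succ_apply', sigma_smul]

theorem wMap_sigma (f : R →ₐ[GeomField O] S) (w : TruncWitt O h R) :
    wMap h (f.restrictScalars O) (sigma w) = sigma (wMap h (f.restrictScalars O) w) := by
  induction w using truncWitt_induction with
  | h1 c a => simp only [wMap_smul, sigma_smul, sigma_teich, wMap_teich, map_pow]
  | h2 v w hv hw => simp only [map_add, hv, hw]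

theorem wMap_sigma_iterate (f : R →ₐ[GeomField O] S) (n : ℕ) (w : TruncWitt O h R) :
    wMap h (f.restrictScalars O) (sigma^[n] w) = sigma^[n] (wMap h (f.restrictScalars O) w) := by
  induction n with
  | zero => rfl
  | succ n ih => rw [Function.iterate_succ_apply', wMap_sigma, ih, Function.iterate_succ_apply']

theorem wRed_sigma (hh : h' ≤ h) (w : TruncWitt O h R) :
    wRed hh (sigma w) = sigma (wRed hh w) := wRed_wMap hh _ w

theorem wRed_sigma_iterate (hh : h' ≤ h) (n : ℕ) (w : TruncWitt O h R) :
    wRed hh (sigma^[n] w) = sigma^[n] (wRed hh w) := by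
  induction n with
  | zero => rfl
  | succ n ih => rw [Function.iterate_succ_apply', wRed_sigma, ih, Function.iterate_succ_apply']

end Frob

/-! ### Residues and the `ϖ`-adic filtration -/

section Residue

variable [IsDomain O] [IsDiscreteValuationRing O]
  [Finite (IsLocalRing.ResidueField O)] {ϖ : O} [hϖ : Fact (Irreducible ϖ)] {R S : PerfAlg O}

/-- The residue map `𝕎_h(R) → R` for `h ≥ 1`. -/
noncomputable def res [NeZero h] : TruncWitt O h R →+* R :=
  Ideal.Quotient.lift (augIdeal O R ^ h) (augmentation O R : MonoidAlgebra O R →+* R) fun x hx => by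
    have : x ∈ augIdeal O R := Ideal.pow_le_self (NeZero.ne h) hx
    exact this

theorem res_mk [NeZero h] (x : MonoidAlgebra O R) :
    res (Ideal.Quotient.mk (augIdeal O R ^ h) x : TruncWitt O h R) = augmentation O R x := rfl

theorem res_teich [NeZero h] (a : R) : res (teich a : TruncWitt O h R) = a := by
  change augmentation O R (MonoidAlgebra.of O R a) = a
  simp [augmentation]

theorem res_smul [NeZero h] (c : O) (w : TruncWitt O h R) : res (c • w) = c • res w := by
  obtain ⟨x, rfl⟩ := Ideal.Quotient.mk_surjective w
  exact map_smul (augmentation O R) c x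

theorem uniformizer_smul (a : R) : ϖ • a = 0 := by
  rw [Algebra.smul_def, algebraMap_uniformizer, zero_mul]

theorem res_uniformizer_smul [NeZero h] (w : TruncWitt O h R) : res (ϖ • w) = 0 := by
  rw [res_smul, uniformizer_smul]

variable (ϖ) in
theorem exists_eq_smul_of_res_eq_zero [NeZero h] {w : TruncWitt O h R} (hw : res w = 0) :
    ∃ v, w = ϖ • v := by
  obtain ⟨x, rfl⟩ := Ideal.Quotient.mk_surjective w
  obtain ⟨y, hy, d, rfl⟩ := augIdeal_le_sup ϖ R h (x := x) hw
  refine ⟨Ideal.Quotient.mk _ d, ?_⟩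
  rw [map_add, Ideal.Quotient.eq_zero_iff_mem.2 hy, zero_add]
  rfl

theorem uniformizer_pow_smul_eq_zero {k : ℕ} (hk : h ≤ k) (w : TruncWitt O h R) : ϖ ^ k • w = 0 := by
  obtain ⟨x, rfl⟩ := Ideal.Quotient.mk_surjective w
  change Ideal.Quotient.mk _ (ϖ ^ k • x) = 0
  rw [Ideal.Quotient.eq_zero_iff_mem]
  have : ϖ ^ k • x = (ϖ • (1 : MonoidAlgebra O R)) ^ k * x := by
    rw [smul_pow, one_pow, smul_mul_assoc, one_mul]
  rw [this]
  exact Ideal.mul_mem_right _ _ (Ideal.pow_le_pow_right hk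
    (Ideal.pow_mem_pow (uniformizer_mem_augIdeal R 1) k))

theorem res_eq_zero_of_smul_eq_zero [NeZero h] {k : ℕ} (hk : k < h) {w : TruncWitt O h R}
    (hw : ϖ ^ k • w = 0) : res w = 0 := by
  obtain ⟨x, rfl⟩ := Ideal.Quotient.mk_surjective w
  change Ideal.Quotient.mk _ (ϖ ^ k • x) = 0 at hw
  rw [Ideal.Quotient.eq_zero_iff_mem] at hw
  exact mem_augIdeal_of_smul_mem R k (Ideal.pow_le_pow_right hk hw)

variable (ϖ) in
theorem wRed_eq_zero_iff (hh : h' ≤ h) {w : TruncWitt O h R} :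
    wRed hh w = 0 ↔ ∃ v, w = ϖ ^ h' • v := by
  constructor
  · intro hw
    obtain ⟨x, rfl⟩ := Ideal.Quotient.mk_surjective w
    have hx : x ∈ augIdeal O R ^ h' := Ideal.Quotient.eq_zero_iff_mem.1 hw
    obtain ⟨y, hy, d, rfl⟩ := augIdeal_pow_le_sup ϖ R h' h hx
    refine ⟨Ideal.Quotient.mk _ d, ?_⟩
    rw [map_add, Ideal.Quotient.eq_zero_iff_mem.2 hy, zero_add]
    rfl
  · rintro ⟨v, rfl⟩
    rw [wRed_smul, uniformizer_pow_smul_eq_zero le_rfl]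

theorem res_sigma [NeZero h] (w : TruncWitt O h R) : res (sigma w) = res w ^ resCard O := by
  obtain ⟨x, rfl⟩ := Ideal.Quotient.mk_surjective w
  rw [res_mk, ← frob_apply]
  exact augmentation_monFrob R x

theorem res_sigma_iterate [NeZero h] (n : ℕ) (w : TruncWitt O h R) :
    res (sigma^[n] w) = res w ^ resCard O ^ n := by
  induction n with
  | zero => simp
  | succ n ih => rw [Function.iterate_succ_apply', res_sigma, ih, ← pow_mul, pow_succ]

theorem res_wMap [NeZero h] (f : R →ₐ[GeomField O] S) (w : TruncWitt O h R) :
    res (wMap h (f.restrictScalars O) w) = f (res w) := by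
  induction w using truncWitt_induction with
  | h1 c a =>
    simp only [wMap_smul, wMap_teich, res_smul, res_teich, AlgHom.restrictScalars_apply]
    exact (map_smul (f.restrictScalars O) c a).symm
  | h2 v w hv hw => simp only [map_add, hv, hw]

theorem isUnit_iff_res [NeZero h] {w : TruncWitt O h R} : IsUnit w ↔ IsUnit (res w) := by
  refine ⟨fun hw => hw.map res, fun hw => ?_⟩
  obtain ⟨ϖ, hϖ⟩ := IsDiscreteValuationRing.exists_irreducible O
  have := Fact.mk hϖ
  obtain ⟨b, hb⟩ := hw.exists_right_inv
  have : res (1 - w * teich b) = 0 := by rw [map_sub, map_mul, res_teich, hb, map_one, sub_self]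
  obtain ⟨v, hv⟩ := exists_eq_smul_of_res_eq_zero ϖ this
  have hn : IsNilpotent (ϖ • v) :=
    ⟨h, by rw [smul_pow, uniformizer_pow_smul_eq_zero le_rfl]⟩
  have h1 : IsUnit (w * teich b) := by
    have : w * teich b = 1 - ϖ • v := by rw [← hv]; ring
    rw [this]
    exact hn.isUnit_one_sub
  exact isUnit_of_mul_isUnit_left h1

theorem res_add_teich_sub [NeZero h] (w : TruncWitt O h R) : res (w - teich (res w)) = 0 := by
  rw [map_sub, res_teich, sub_self]

variable (ϖ) in
/-- Every element of `𝕎_h(R)` has a unique Teichmüller expansion. -/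
theorem teich_expansion_bijective (h : ℕ) (R : PerfAlg O) :
    Function.Bijective fun t : Fin h → R =>
      (∑ k : Fin h, ϖ ^ (k : ℕ) • teich (t k) : TruncWitt O h R) := by
  rcases Nat.eq_zero_or_pos h with rfl | hpos
  · have : Subsingleton (TruncWitt O 0 R) := by
      refine Ideal.Quotient.subsingleton_iff.2 (by simp)
    exact ⟨fun a b _ => Subsingleton.elim _ _, fun w => ⟨fun i => i.elim0, Subsingleton.elim _ _⟩⟩
  have : NeZero h := ⟨hpos.ne'⟩
  constructor
  · intro t t' htt
    funext k
    obtain ⟨k, hk⟩ := k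
    induction k using Nat.strong_induction_on with
    | _ k ih =>
    have hdiff : ∑ i : Fin h, (ϖ ^ (i : ℕ) • teich (t i) - ϖ ^ (i : ℕ) • teich (t' i) :
        TruncWitt O h R) = 0 := by
      rw [Finset.sum_sub_distrib]
      exact sub_eq_zero.2 htt
    obtain ⟨v, hv⟩ : ∃ v : TruncWitt O h R, ∑ i ∈ Finset.univ.erase (⟨k, hk⟩ : Fin h),
        (ϖ ^ (i : ℕ) • teich (t i) - ϖ ^ (i : ℕ) • teich (t' i)) = ϖ ^ k • ϖ • v := by
      refine Finset.sum_induction _ (fun w => ∃ v : TruncWitt O h R, w = ϖ ^ k • ϖ • v) ?_ ?_ ?_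
      · rintro _ _ ⟨a, rfl⟩ ⟨b, rfl⟩
        exact ⟨a + b, by simp only [smul_add]⟩
      · exact ⟨0, by simp⟩
      · intro i hi
        have hne : (i : ℕ) ≠ k := fun hik => (Finset.ne_of_mem_erase hi) (Fin.ext hik)
        rcases lt_or_gt_of_ne hne with hlt | hgt
        · exact ⟨0, by rw [ih i hlt i.2]; simp⟩
        · obtain ⟨m, hm⟩ := Nat.exists_eq_add_of_lt hgt
          refine ⟨ϖ ^ m • (teich (t i) - teich (t' i)), ?_⟩
          rw [← smul_sub, hm, smul_smul, smul_smul]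
          congr 1
          ring
    rw [← Finset.add_sum_erase _ _ (Finset.mem_univ (⟨k, hk⟩ : Fin h)), hv, ← smul_sub,
      ← smul_add] at hdiff
    have := res_eq_zero_of_smul_eq_zero hk hdiff
    rw [map_add, res_uniformizer_smul, add_zero, map_sub, res_teich, res_teich] at this
    exact sub_eq_zero.1 this
  · intro w
    suffices H : ∀ n, ∃ t : ℕ → R, ∃ v : TruncWitt O h R,
        w = ∑ k ∈ Finset.range n, ϖ ^ k • teich (t k) + ϖ ^ n • v by
      obtain ⟨t, v, hv⟩ := H h
      refine ⟨fun k => t k, ?_⟩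
      rw [hv, uniformizer_pow_smul_eq_zero le_rfl, add_zero]
      exact Fin.sum_univ_eq_sum_range (fun k => ϖ ^ k • (teich (t k) : TruncWitt O h R)) h
    intro n
    induction n with
    | zero => exact ⟨fun _ => 0, w, by simp⟩
    | succ n ih =>
      obtain ⟨t, v, hv⟩ := ih
      obtain ⟨v', hv'⟩ := exists_eq_smul_of_res_eq_zero ϖ (res_add_teich_sub v)
      refine ⟨Function.update t n (res v), v', ?_⟩
      rw [Finset.sum_range_succ, Function.update_self, pow_succ, mul_smul, add_assoc, ← smul_add,
        ← hv', add_sub_cancel]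
      rw [hv]
      congr 1
      refine Finset.sum_congr rfl fun k hk => ?_
      rw [Function.update_of_ne (Finset.mem_range.1 hk).ne]

end Residue

end TruncWitt

/-! ### Semilinear algebra on `W ^ n₀` -/

section SemilinearAlgebra

variable {O : Type*} [CommRing O] (ϖ : O) {W : Type*} [CommRing W] [Algebra O W] (σ : W →ₐ[O] W)
  {n₀ : ℕ} (k₀ : ℕ)

/-- The operator `e_a ↦ e_{a+1}`, `e_{n₀} ↦ ϖ e_1` on `W ^ n₀`, an `n₀`-th root of `ϖ`. -/
noncomputable def piL : Module.End W (Fin n₀ → W) :=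
  Matrix.toLinAlgEquiv' ((cyc ϖ n₀).map (algebraMap O W))

/-- The operator `ϖ^{-⌊j k₀ / n₀⌋} (c σ)^j` on `W ^ n₀`. -/
noncomputable def Phi (j : ℕ) (v : Fin n₀ → W) : Fin n₀ → W :=
  fun a' => ∑ a : Fin n₀, scaledPow ϖ n₀ k₀ j a' a • (σ ^ j) (v a)

theorem scaledPow_eq_cyc_pow (j : ℕ) : scaledPow ϖ n₀ k₀ j = cyc ϖ n₀ ^ (k₀ * j % n₀) := by
  rw [cyc_pow]
  ext a' a
  have hn : 0 < n₀ := a.pos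
  have h1 : ((a : ℕ) + k₀ * j) % n₀ = ((a : ℕ) + k₀ * j % n₀) % n₀ := by simp
  have h2 : ((a : ℕ) + k₀ * j) / n₀ - k₀ * j / n₀ = ((a : ℕ) + k₀ * j % n₀) / n₀ := by
    have h3 : (a : ℕ) + k₀ * j = ((a : ℕ) + k₀ * j % n₀) + n₀ * (k₀ * j / n₀) := by
      have := Nat.div_add_mod (k₀ * j) n₀
      omega
    nth_rewrite 1 [h3]
    rw [Nat.add_mul_div_left _ _ hn, Nat.add_sub_cancel]
  simp only [scaledPow, Matrix.of_apply, h1, h2]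

theorem piL_pow_apply (i : ℕ) (v : Fin n₀ → W) (a' : Fin n₀) :
    (piL ϖ ^ i) v a' = ∑ a : Fin n₀, (cyc ϖ n₀ ^ i) a' a • v a := by
  rw [piL, ← map_pow, ← RingHom.mapMatrix_apply, ← map_pow, Matrix.toLinAlgEquiv'_apply]
  simp only [Matrix.mulVec, dotProduct, RingHom.mapMatrix_apply, Matrix.map_apply,
    Algebra.smul_def]

theorem piL_pow_apply' (i : ℕ) (v : Fin n₀ → W) (a' : Fin n₀) :
    (piL ϖ ^ i) v a' = ∑ a : Fin n₀,
      if (a' : ℕ) = ((a : ℕ) + i) % n₀ then ϖ ^ (((a : ℕ) + i) / n₀) • v a else 0 := by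
  rw [piL_pow_apply, cyc_pow]
  simp only [Matrix.of_apply, ite_smul, zero_smul]

theorem Phi_eq (j : ℕ) (v : Fin n₀ → W) :
    Phi ϖ σ k₀ j v = (piL ϖ ^ (k₀ * j % n₀)) fun a => (σ ^ j) (v a) := by
  funext a'
  rw [piL_pow_apply, Phi, scaledPow_eq_cyc_pow]

theorem piL_pow_smul (i : ℕ) (c : O) (v : Fin n₀ → W) :
    (piL ϖ ^ i) (c • v) = c • (piL ϖ ^ i) v := by
  rw [← algebraMap_smul W c v, map_smul, algebraMap_smul]

theorem piL_pow_self (v : Fin n₀ → W) : (piL ϖ ^ n₀) v = ϖ • v := by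
  funext a'
  have hn : 0 < n₀ := a'.pos
  rw [piL_pow_apply', Finset.sum_eq_single a']
  · rw [Nat.add_mod_right, Nat.mod_eq_of_lt a'.2, if_pos rfl, Nat.add_div_right _ hn,
      Nat.div_eq_of_lt a'.2, pow_one, Pi.smul_apply]
  · intro a _ ha
    rw [Nat.add_mod_right, Nat.mod_eq_of_lt a.2, if_neg fun h => ha (Fin.ext h.symm)]
  · exact fun h => absurd (Finset.mem_univ _) h

theorem piL_pow_mul_self (i : ℕ) (v : Fin n₀ → W) : (piL ϖ ^ (n₀ * i)) v = ϖ ^ i • v := by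
  induction i with
  | zero => simp
  | succ i ih =>
    rw [Nat.mul_succ, pow_add, Module.End.mul_apply, piL_pow_self, piL_pow_smul, ih, smul_smul,
      pow_succ']

theorem piL_pow_mod (i : ℕ) (v : Fin n₀ → W) :
    (piL ϖ ^ i) v = ϖ ^ (i / n₀) • (piL ϖ ^ (i % n₀)) v := by
  conv_lhs => rw [← Nat.div_add_mod i n₀]
  rw [pow_add, Module.End.mul_apply, piL_pow_mul_self]

theorem piL_pow_pow_apply (i j : ℕ) (v : Fin n₀ → W) :
    (piL ϖ ^ i) ((piL ϖ ^ j) v) = (piL ϖ ^ (i + j)) v := by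
  rw [pow_add, Module.End.mul_apply]

theorem map_piL_pow {W' : Type*} [CommRing W'] [Algebra O W'] (f : W →+ W')
    (hf : ∀ (c : O) w, f (c • w) = c • f w) (i : ℕ) (v : Fin n₀ → W) :
    (fun a => f ((piL ϖ ^ i) v a)) = (piL ϖ ^ i) fun a => f (v a) := by
  funext a'
  simp only [piL_pow_apply, map_sum, hf]

theorem sigma_pow_piL_pow (j i : ℕ) (v : Fin n₀ → W) :
    (fun a => (σ ^ j) ((piL ϖ ^ i) v a)) = (piL ϖ ^ i) fun a => (σ ^ j) (v a) :=
  map_piL_pow ϖ ((σ ^ j : W →ₐ[O] W) : W →+ W) (fun c w => map_smul (σ ^ j) c w) i v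

theorem Phi_zero (j : ℕ) : Phi ϖ σ k₀ j (0 : Fin n₀ → W) = 0 := by
  funext a
  simp [Phi]

theorem Phi_add (j : ℕ) (v w : Fin n₀ → W) :
    Phi ϖ σ k₀ j (v + w) = Phi ϖ σ k₀ j v + Phi ϖ σ k₀ j w := by
  funext a
  simp only [Phi, Pi.add_apply, map_add, smul_add, Finset.sum_add_distrib]

theorem Phi_smul (j : ℕ) (c : W) (v : Fin n₀ → W) :
    Phi ϖ σ k₀ j (c • v) = (σ ^ j) c • Phi ϖ σ k₀ j v := by
  funext a
  simp only [Phi, Pi.smul_apply, smul_eq_mul, map_mul, Finset.mul_sum, mul_smul_comm]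

theorem Phi_sum {ι : Type*} (s : Finset ι) (j : ℕ) (v : ι → Fin n₀ → W) :
    Phi ϖ σ k₀ j (∑ i ∈ s, v i) = ∑ i ∈ s, Phi ϖ σ k₀ j (v i) :=
  map_sum (AddMonoidHom.mk' (Phi ϖ σ k₀ j) (Phi_add ϖ σ k₀ j)) v s

theorem Phi_piL_pow (j i : ℕ) (v : Fin n₀ → W) :
    Phi ϖ σ k₀ j ((piL ϖ ^ i) v) = (piL ϖ ^ i) (Phi ϖ σ k₀ j v) := by
  rw [Phi_eq, Phi_eq, sigma_pow_piL_pow, piL_pow_pow_apply, piL_pow_pow_apply, add_comm]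

theorem Phi_Phi (i j : ℕ) (v : Fin n₀ → W) :
    Phi ϖ σ k₀ i (Phi ϖ σ k₀ j v) =
      ϖ ^ ((k₀ * i % n₀ + k₀ * j % n₀) / n₀) • Phi ϖ σ k₀ (i + j) v := by
  rw [Phi_eq ϖ σ k₀ j, Phi_piL_pow, Phi_eq, Phi_eq, piL_pow_pow_apply, piL_pow_mod,
    add_comm (k₀ * j % n₀), mul_add, ← Nat.add_mod, pow_add]
  rfl

/-! ### The determinants `|g(x)|` and the twisted polynomial of a vector -/

/-- The matrix `g_{n₀,r}(x)` of a vector over `W`. -/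
noncomputable def gMat {r : ℕ} (x : Fin r → Fin n₀ → W) : Matrix (Fin (r * n₀)) (Fin (r * n₀)) W :=
  Matrix.of fun i j => Phi ϖ σ k₀ j (x (finProdFinEquiv.symm i).1) (finProdFinEquiv.symm i).2

variable {j₀ : ℕ}

/-- The cofactor of the `t`-th entry of the first row in the matrix with rows
`v, x'_1, …, x'_{j₀ n₀}` and columns `Φ_0, …, Φ_{j₀ n₀}`. -/
noncomputable def cof (y : Fin j₀ → Fin n₀ → W) (t : ℕ) : W :=
  (-1) ^ t * Matrix.det (Matrix.of fun i c : Fin (j₀ * n₀) =>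
    Phi ϖ σ k₀ (if (c : ℕ) < t then c else c + 1) (y (finProdFinEquiv.symm i).1)
      (finProdFinEquiv.symm i).2)

/-- The twisted polynomial attached to `y`: an additive operator on `W ^ n₀` which kills the
components of `y`, and whose value at `v` has as coordinates the maximal minors with one row taken
from `v` and the other rows from `y`. -/
noncomputable def twPoly (y : Fin j₀ → Fin n₀ → W) (v : Fin n₀ → W) : Fin n₀ → W :=
  ∑ t ∈ Finset.range (j₀ * n₀ + 1), cof ϖ σ k₀ y t • Phi ϖ σ k₀ t v

theorem twPoly_add (y : Fin j₀ → Fin n₀ → W) (v w : Fin n₀ → W) :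
    twPoly ϖ σ k₀ y (v + w) = twPoly ϖ σ k₀ y v + twPoly ϖ σ k₀ y w := by
  simp only [twPoly, Phi_add, smul_add, Finset.sum_add_distrib]

theorem twPoly_zero (y : Fin j₀ → Fin n₀ → W) : twPoly ϖ σ k₀ y 0 = 0 := by
  simp only [twPoly, Phi_zero, smul_zero, Finset.sum_const_zero]

theorem twPoly_neg (y : Fin j₀ → Fin n₀ → W) (v : Fin n₀ → W) :
    twPoly ϖ σ k₀ y (-v) = -twPoly ϖ σ k₀ y v := by
  rw [eq_neg_iff_add_eq_zero, ← twPoly_add, neg_add_cancel, twPoly_zero]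

theorem twPoly_sub (y : Fin j₀ → Fin n₀ → W) (v w : Fin n₀ → W) :
    twPoly ϖ σ k₀ y (v - w) = twPoly ϖ σ k₀ y v - twPoly ϖ σ k₀ y w := by
  rw [sub_eq_add_neg, twPoly_add, twPoly_neg, sub_eq_add_neg]

theorem twPoly_sum {ι : Type*} (s : Finset ι) (y : Fin j₀ → Fin n₀ → W) (v : ι → Fin n₀ → W) :
    twPoly ϖ σ k₀ y (∑ i ∈ s, v i) = ∑ i ∈ s, twPoly ϖ σ k₀ y (v i) :=
  map_sum (AddMonoidHom.mk' (twPoly ϖ σ k₀ y) (twPoly_add ϖ σ k₀ y)) v s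

theorem twPoly_piL_pow (y : Fin j₀ → Fin n₀ → W) (i : ℕ) (v : Fin n₀ → W) :
    twPoly ϖ σ k₀ y ((piL ϖ ^ i) v) = (piL ϖ ^ i) (twPoly ϖ σ k₀ y v) := by
  simp only [twPoly, Phi_piL_pow, map_sum, map_smul]

theorem twPoly_apply (y : Fin j₀ → Fin n₀ → W) (v : Fin n₀ → W) (a : Fin n₀) :
    twPoly ϖ σ k₀ y v a = Matrix.det (Matrix.of fun i j : Fin (j₀ * n₀ + 1) =>
      (Fin.cons (Phi ϖ σ k₀ j v a) (fun t => Phi ϖ σ k₀ j (y (finProdFinEquiv.symm t).1)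
        (finProdFinEquiv.symm t).2) : Fin (j₀ * n₀ + 1) → W) i) := by
  rw [Matrix.det_succ_row_zero, twPoly, Finset.sum_apply, Finset.sum_range]
  refine Finset.sum_congr rfl fun t _ => ?_
  rw [Pi.smul_apply, smul_eq_mul, cof, Matrix.of_apply, Fin.cons_zero, mul_right_comm]
  congr 2
  ext i c
  simp only [Matrix.of_apply, Matrix.submatrix_apply, Fin.cons_succ]
  congr 1
  by_cases hc : (c : ℕ) < t
  · rw [if_pos hc, Fin.succAbove_of_castSucc_lt _ _ (by simpa [Fin.lt_def] using hc)]
    rfl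
  · rw [if_neg hc, Fin.succAbove_of_le_castSucc _ _ (by simpa [Fin.le_def] using hc)]
    rfl

theorem twPoly_self (y : Fin j₀ → Fin n₀ → W) (j : Fin j₀) : twPoly ϖ σ k₀ y (y j) = 0 := by
  funext a
  rw [twPoly_apply, Pi.zero_apply]
  refine Matrix.det_zero_of_row_eq (i := 0) (j := (finProdFinEquiv (j, a)).succ)
    (Fin.succ_ne_zero _).symm ?_
  funext c
  simp only [Matrix.of_apply, Fin.cons_zero, Fin.cons_succ, Equiv.symm_apply_apply]

theorem cof_top (y : Fin j₀ → Fin n₀ → W) :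
    cof ϖ σ k₀ y (j₀ * n₀) = (-1) ^ (j₀ * n₀) * (gMat ϖ σ k₀ y).det := by
  rw [cof, gMat]
  congr 2
  ext i c
  simp only [Matrix.of_apply, c.2, if_true]

/-- The coefficient of `Φ_i` in `Φ_j ∘ twPoly y`. -/
noncomputable def windowCoeff (y : Fin j₀ → Fin n₀ → W) (j i : ℕ) : W :=
  if j ≤ i ∧ i - j ≤ j₀ * n₀ then
    ϖ ^ ((k₀ * j % n₀ + k₀ * (i - j) % n₀) / n₀) • (σ ^ j) (cof ϖ σ k₀ y (i - j)) else 0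

theorem sum_windowCoeff (y : Fin j₀ → Fin n₀ → W) (v : Fin n₀ → W) (a : Fin n₀) {j N : ℕ}
    (hN : j + j₀ * n₀ < N) :
    ∑ i ∈ Finset.range N, Phi ϖ σ k₀ i v a * windowCoeff ϖ σ k₀ y j i =
      Phi ϖ σ k₀ j (twPoly ϖ σ k₀ y v) a := by
  have h1 : ∑ i ∈ Finset.Ico j (j + j₀ * n₀ + 1), Phi ϖ σ k₀ i v a * windowCoeff ϖ σ k₀ y j i =
      ∑ i ∈ Finset.range N, Phi ϖ σ k₀ i v a * windowCoeff ϖ σ k₀ y j i := by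
    refine Finset.sum_subset (fun i hi => ?_) fun i _ hi => ?_
    · rw [Finset.mem_Ico] at hi
      exact Finset.mem_range.2 (by omega)
    · rw [Finset.mem_Ico] at hi
      rw [windowCoeff, if_neg (by omega), mul_zero]
  rw [← h1, Finset.sum_Ico_eq_sum_range, twPoly, Phi_sum, Finset.sum_apply]
  refine Finset.sum_congr (by congr 1; omega) fun t ht => ?_
  rw [Finset.mem_range] at ht
  rw [Phi_smul, Phi_Phi, windowCoeff, if_pos (by omega), Nat.add_sub_cancel_left, Pi.smul_apply,
    Pi.smul_apply, mul_smul_comm, smul_eq_mul, mul_comm (Phi ϖ σ k₀ (j + t) v a),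
    mul_smul_comm]

theorem exists_sign_det_submatrix {m n : Type*} [Fintype m] [DecidableEq m] [Fintype n]
    [DecidableEq n] (e₁ e₂ : n ≃ m) (M : Matrix m m W) :
    ∃ ε : ℤˣ, (M.submatrix e₁ e₂).det = ((ε : ℤ) : W) * M.det := by
  refine ⟨Equiv.Perm.sign (e₁.symm.trans e₂), ?_⟩
  rw [← Matrix.det_permute', ← Matrix.det_submatrix_equiv_self e₁]
  congr 1
  ext i j
  simp

/-- The product formula `|g(x)| ∏_{j < s} σ^j |g(x')| = ± |g(m)| |g(x')|`. The matrix `E`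
below consists of `j₀ n₀` columns of the identity matrix and of the coefficients of the operators
`Φ_j ∘ twPoly x'`; it is upper triangular, with diagonal entries `1` and `± σ^j |g(x')|`, and
`g(x) E` is block triangular with diagonal blocks `g(x')` and `g(m)`. -/
theorem det_gMat_mul_prod {i₀ : ℕ} (x : Fin (i₀ + j₀) → Fin n₀ → W) :
    ∃ ε : ℤˣ, (gMat ϖ σ k₀ x).det *
        ∏ j ∈ Finset.range (i₀ * n₀), (σ ^ j) (gMat ϖ σ k₀ fun j => x (Fin.natAdd i₀ j)).det =
      ((ε : ℤ) : W) * ((gMat ϖ σ k₀ fun i =>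
          twPoly ϖ σ k₀ (fun j => x (Fin.natAdd i₀ j)) (x (Fin.castAdd j₀ i))).det *
        (gMat ϖ σ k₀ fun j => x (Fin.natAdd i₀ j)).det) := by
  set y : Fin j₀ → Fin n₀ → W := fun j => x (Fin.natAdd i₀ j) with hy
  set m : Fin i₀ → Fin n₀ → W := fun i => twPoly ϖ σ k₀ y (x (Fin.castAdd j₀ i)) with hm
  have hN : i₀ * n₀ + j₀ * n₀ = (i₀ + j₀) * n₀ := (add_mul _ _ _).symm
  have hN' : j₀ * n₀ + i₀ * n₀ = (i₀ + j₀) * n₀ := by rw [← hN, add_comm]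
  let e₁ : Fin (j₀ * n₀) ⊕ Fin (i₀ * n₀) ≃ Fin ((i₀ + j₀) * n₀) :=
    ((Equiv.sumComm _ _).trans finSumFinEquiv).trans (finCongr hN)
  let e₂ : Fin (j₀ * n₀) ⊕ Fin (i₀ * n₀) ≃ Fin ((i₀ + j₀) * n₀) :=
    finSumFinEquiv.trans (finCongr hN')
  have hpos : ∀ {r : ℕ}, Fin (r * n₀) → 0 < n₀ := fun {r} t =>
    Nat.pos_of_ne_zero fun h0 => absurd t.2 (by simp [h0])
  have hrow1 : ∀ t : Fin (j₀ * n₀), finProdFinEquiv.symm (e₁ (Sum.inl t)) =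
      (Fin.natAdd i₀ (finProdFinEquiv.symm t).1, (finProdFinEquiv.symm t).2) := by
    intro t
    have h0 := hpos t
    have hv : (e₁ (Sum.inl t) : ℕ) = t + n₀ * i₀ := by
      simp [e₁, mul_comm, add_comm]
    refine Prod.ext (Fin.ext ?_) (Fin.ext ?_)
    · change (e₁ (Sum.inl t) : ℕ) / n₀ = i₀ + t / n₀
      rw [hv, Nat.add_mul_div_left _ _ h0, add_comm]
    · change (e₁ (Sum.inl t) : ℕ) % n₀ = t % n₀
      rw [hv, Nat.add_mul_mod_self_left]
  have hrow2 : ∀ t : Fin (i₀ * n₀), finProdFinEquiv.symm (e₁ (Sum.inr t)) =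
      (Fin.castAdd j₀ (finProdFinEquiv.symm t).1, (finProdFinEquiv.symm t).2) := by
    intro t
    have hv : (e₁ (Sum.inr t) : ℕ) = t := by simp [e₁]
    refine Prod.ext (Fin.ext ?_) (Fin.ext ?_)
    · change (e₁ (Sum.inr t) : ℕ) / n₀ = t / n₀
      rw [hv]
    · change (e₁ (Sum.inr t) : ℕ) % n₀ = t % n₀
      rw [hv]
  have hcol1 : ∀ t : Fin (j₀ * n₀), (e₂ (Sum.inl t) : ℕ) = t := fun t => by simp [e₂]
  have hcol2 : ∀ t : Fin (i₀ * n₀), (e₂ (Sum.inr t) : ℕ) = j₀ * n₀ + t := fun t => by simp [e₂]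
  let G := (gMat ϖ σ k₀ x).submatrix e₁ e₂
  let E : Matrix (Fin (j₀ * n₀) ⊕ Fin (i₀ * n₀)) (Fin (j₀ * n₀) ⊕ Fin (i₀ * n₀)) W :=
    Matrix.fromBlocks 1 (Matrix.of fun i j => windowCoeff ϖ σ k₀ y j i) 0
      (Matrix.of fun i j => windowCoeff ϖ σ k₀ y j (j₀ * n₀ + i))
  have hcolsum : ∀ (v : Fin n₀ → W) (a : Fin n₀) (j : Fin (i₀ * n₀)),
      ∑ c, Phi ϖ σ k₀ (e₂ c) v a * E c (Sum.inr j) = Phi ϖ σ k₀ j (twPoly ϖ σ k₀ y v) a := by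
    intro v a j
    rw [← sum_windowCoeff ϖ σ k₀ y v a (j := j) (N := (i₀ + j₀) * n₀) (by have := j.2; omega),
      Finset.sum_range, ← Equiv.sum_comp e₂]
    refine Finset.sum_congr rfl fun c _ => ?_
    rcases c with c | c
    · rw [hcol1]
      rfl
    · rw [hcol2]
      rfl
  have hGE : G * E = Matrix.fromBlocks (gMat ϖ σ k₀ y) 0
      (Matrix.of fun i j => G (Sum.inr i) (Sum.inl j)) (gMat ϖ σ k₀ m) := by
    ext i j
    rw [Matrix.mul_apply]
    rcases j with j | j
    · have hE : ∀ c, G i c * E c (Sum.inl j) = if c = Sum.inl j then G i c else 0 := by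
        intro c
        rcases c with c | c <;> simp [E, Matrix.one_apply]
      rw [Finset.sum_congr rfl fun c _ => hE c, Finset.sum_ite_eq' Finset.univ,
        if_pos (Finset.mem_univ _)]
      rcases i with i | i
      · simp only [G, Matrix.submatrix_apply, gMat, Matrix.of_apply, hrow1, hcol1,
          Matrix.fromBlocks_apply₁₁, hy]
      · rfl
    · rcases i with i | i
      · simp only [G, Matrix.submatrix_apply, gMat, Matrix.of_apply, hrow1]
        rw [hcolsum]
        change Phi ϖ σ k₀ j (twPoly ϖ σ k₀ y (y _)) _ = 0
        rw [twPoly_self, Phi_zero, Pi.zero_apply]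
      · simp only [G, Matrix.submatrix_apply, gMat, Matrix.of_apply, hrow2]
        rw [hcolsum]
        rfl
  have hdetE : E.det = ∏ j ∈ Finset.range (i₀ * n₀),
      (-1) ^ (j₀ * n₀) * (σ ^ j) (gMat ϖ σ k₀ y).det := by
    rw [Matrix.det_fromBlocks_zero₂₁, Matrix.det_one, one_mul, Matrix.det_of_isUpperTriangular,
      Finset.prod_range]
    · refine Finset.prod_congr rfl fun j _ => ?_
      have h0 := hpos j
      rw [Matrix.of_apply, windowCoeff, if_pos (by omega), Nat.add_sub_cancel, cof_top,
        ← mul_assoc k₀, Nat.mul_mod_left, add_zero,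
        Nat.div_eq_of_lt (Nat.mod_lt _ h0), pow_zero, one_smul, map_mul, map_pow, map_neg, map_one]
    · intro i j hij
      have : (j : ℕ) < i := hij
      rw [Matrix.of_apply, windowCoeff, if_neg (by omega)]
  obtain ⟨ε, hε⟩ := exists_sign_det_submatrix e₁ e₂ (gMat ϖ σ k₀ x)
  have hdet := congrArg Matrix.det hGE
  rw [Matrix.det_mul, Matrix.det_fromBlocks_zero₁₂, hdetE, hε, Finset.prod_mul_distrib,
    Finset.prod_const, Finset.card_range, ← pow_mul] at hdet
  refine ⟨ε * (-1) ^ (j₀ * n₀ * (i₀ * n₀)), ?_⟩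
  rw [mul_comm (gMat ϖ σ k₀ m).det, ← hdet]
  have hε2 : ((ε : ℤ) : W) * ((ε : ℤ) : W) = 1 := by
    rw [← Int.cast_mul, ← Units.val_mul, Int.units_mul_self]
    simp
  have hs2 : ((-1 : W) ^ (j₀ * n₀ * (i₀ * n₀))) * ((-1 : W) ^ (j₀ * n₀ * (i₀ * n₀))) = 1 := by
    rw [← mul_pow]; simp
  push_cast
  set q := (-1 : W) ^ (j₀ * n₀ * (i₀ * n₀))
  calc _ = (((ε : ℤ) : W) * ((ε : ℤ) : W)) * (q * q) * ((gMat ϖ σ k₀ x).det *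
        ∏ j ∈ Finset.range (i₀ * n₀), (σ ^ j) (gMat ϖ σ k₀ y).det) := by rw [hε2, hs2]; ring
    _ = _ := by ring

end SemilinearAlgebra

/-! ### Independence of lifts -/

section PiFiltration

variable {O : Type*} [CommRing O] (ϖ : O) {W : Type*} [CommRing W] [Algebra O W] {n₀ : ℕ}

theorem exists_piL_pow_apply_eq_smul {i : ℕ} {a' : Fin n₀} (ha : (a' : ℕ) < i) (v : Fin n₀ → W) :
    ∃ c, (piL ϖ ^ i) v a' = ϖ • c := by
  rw [piL_pow_apply']
  refine Finset.sum_induction _ (fun w : W => ∃ c, w = ϖ • c) ?_ ⟨0, by simp⟩ ?_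
  · rintro _ _ ⟨c, rfl⟩ ⟨d, rfl⟩
    exact ⟨c + d, (smul_add _ _ _).symm⟩
  · intro a _
    split_ifs with h
    · have hpos : (((a : ℕ) + i) / n₀) ≠ 0 := by
        intro h0
        have hlt : (a : ℕ) + i < n₀ := by
          rcases (Nat.div_eq_zero_iff).1 h0 with h1 | h1
          · exact absurd a.pos (by omega)
          · exact h1
        rw [Nat.mod_eq_of_lt hlt] at h
        omega
      obtain ⟨m, hm⟩ := Nat.exists_eq_succ_of_ne_zero hpos
      exact ⟨ϖ ^ m • v a, by rw [hm, pow_succ', mul_smul]⟩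
    · exact ⟨0, by simp⟩

/-- The image of `Π` consists of the vectors whose leading coordinate is divisible by `ϖ`. -/
theorem exists_eq_piL (hn : 0 < n₀) {v : Fin n₀ → W} {c : W} (hc : v ⟨0, hn⟩ = ϖ • c) :
    ∃ w, v = piL ϖ w := by
  refine ⟨fun a => if ha : (a : ℕ) + 1 < n₀ then v ⟨a + 1, ha⟩ else c, ?_⟩
  funext a'
  rw [← pow_one (piL ϖ), piL_pow_apply']
  rcases Nat.eq_zero_or_pos (a' : ℕ) with h0 | h0
  · rw [Finset.sum_eq_single (⟨n₀ - 1, by omega⟩ : Fin n₀)]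
    · have h1 : n₀ - 1 + 1 = n₀ := by omega
      simp only [h1, h0, Nat.mod_self, if_true, Nat.div_self hn, pow_one, lt_irrefl, dif_neg,
        not_false_eq_true]
      rw [← hc]
      congr 1
      exact Fin.ext h0
    · intro a _ ha
      have : (a : ℕ) + 1 < n₀ := by
        have h2 := a.2
        have h3 : (a : ℕ) ≠ n₀ - 1 := fun h => ha (Fin.ext h)
        omega
      rw [if_neg]
      rw [Nat.mod_eq_of_lt this]
      omega
    · exact fun h => absurd (Finset.mem_univ _) h
  · have h2 := a'.2
    rw [Finset.sum_eq_single (⟨a' - 1, by omega⟩ : Fin n₀)]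
    · have h1 : (a' : ℕ) - 1 + 1 = a' := by omega
      simp only [h1, Nat.mod_eq_of_lt h2, if_true, Nat.div_eq_of_lt h2, pow_zero, one_smul, h2,
        dif_pos]
    · intro a _ ha
      have h3 : (a : ℕ) + 1 ≠ a' := fun h => ha (Fin.ext (by simp only; omega))
      rw [if_neg]
      have h4 := a.2
      rcases Nat.lt_or_ge ((a : ℕ) + 1) n₀ with h5 | h5
      · rw [Nat.mod_eq_of_lt h5]
        omega
      · have h6 : (a : ℕ) + 1 = n₀ := by omega
        rw [h6, Nat.mod_self]
        omega
    · exact fun h => absurd (Finset.mem_univ _) h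

/-- Let the rows and the columns of two matrices have types, with equal sums, such that an entry
whose row has a smaller type than its column is divisible by `α`, the matrices are congruent
modulo `β`, and they agree where the type of the row is at most that of the column. If `α β = 0`
then the determinants agree: in a term of the Leibniz expansion which involves an entry with a row
of larger type there is also a factor divisible by `α`. -/
theorem det_eq_of_types {ι : Type*} [Fintype ι] [DecidableEq ι] (rt ct : ι → ℕ)
    (hsum : ∑ i, rt i = ∑ i, ct i) {α β : W} (hαβ : α * β = 0) {M M' : Matrix ι ι W}
    (h1 : ∀ i j, rt i ≤ ct j → M i j = M' i j) (h2 : ∀ i j, rt i < ct j → α ∣ M i j)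
    (h3 : ∀ i j, β ∣ M i j - M' i j) : M.det = M'.det := by
  rw [Matrix.det_apply, Matrix.det_apply]
  refine Finset.sum_congr rfl fun π _ => ?_
  congr 1
  by_cases hle : ∀ i, rt (π i) ≤ ct i
  · exact Finset.prod_congr rfl fun i _ => h1 _ _ (hle i)
  · push Not at hle
    obtain ⟨i, hi⟩ := hle
    obtain ⟨j, hj⟩ : ∃ j, rt (π j) < ct j := by
      by_contra! hcon
      have : ∑ j, ct j < ∑ j, rt (π j) :=
        Finset.sum_lt_sum (fun j _ => hcon j) ⟨i, Finset.mem_univ _, hi⟩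
      rw [Equiv.sum_comp π rt, hsum] at this
      exact lt_irrefl _ this
    rw [← Finset.mul_prod_erase _ _ (Finset.mem_univ j),
      ← Finset.mul_prod_erase _ (fun i => M' (π i) i) (Finset.mem_univ j), ← h1 _ _ hj.le]
    obtain ⟨c, hc⟩ := h2 _ _ hj
    have hd : β ∣ ∏ i ∈ Finset.univ.erase j, M (π i) i - ∏ i ∈ Finset.univ.erase j, M' (π i) i := by
      rw [← Ideal.mem_span_singleton, ← Ideal.Quotient.eq, map_prod, map_prod]
      refine Finset.prod_congr rfl fun i _ => ?_
      rw [Ideal.Quotient.eq, Ideal.mem_span_singleton]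
      exact h3 _ _
    obtain ⟨d, hd⟩ := hd
    rw [← sub_eq_zero, ← mul_sub, hd, hc]
    linear_combination c * d * hαβ

end PiFiltration

/-- The types of the rows and of the columns of `g(x)` have equal sums, as `k₀` is invertible modulo
`n₀`. -/
theorem sum_types {n₀ k₀ r : ℕ} (hc : Nat.Coprime k₀ n₀) :
    ∑ i : Fin (r * n₀), ((finProdFinEquiv.symm i).2 : ℕ) = ∑ j : Fin (r * n₀), k₀ * j % n₀ := by
  rw [← Equiv.sum_comp finProdFinEquiv, ← Equiv.sum_comp finProdFinEquiv (fun j => k₀ * (j : ℕ) % n₀),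
    Fintype.sum_prod_type, Fintype.sum_prod_type]
  refine Finset.sum_congr rfl fun ρ _ => ?_
  simp only [Equiv.symm_apply_apply]
  rcases Nat.eq_zero_or_pos n₀ with rfl | hn
  · simp
  let f : Fin n₀ → Fin n₀ := fun a => ⟨k₀ * a % n₀, Nat.mod_lt _ hn⟩
  have hf : Function.Injective f := by
    intro a b hab
    have h1 : k₀ * a ≡ k₀ * b [MOD n₀] := congrArg Fin.val hab
    have h2 := Nat.ModEq.cancel_left_of_coprime (by rw [Nat.gcd_comm]; exact hc) h1
    exact Fin.ext (Nat.ModEq.eq_of_lt_of_lt h2 a.2 b.2)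
  rw [← Equiv.sum_comp (Equiv.ofBijective f (Finite.injective_iff_bijective.1 hf))]
  refine Finset.sum_congr rfl fun a _ => ?_
  simp [f, finProdFinEquiv, mul_add, Nat.mul_left_comm k₀ n₀, Nat.add_mod]

section Close

variable {O : Type*} [CommRing O] (ϖ : O) {W : Type*} [CommRing W] [Algebra O W] (σ : W →ₐ[O] W)
  {n₀ : ℕ} (k₀ : ℕ)

/-- Two vectors whose images under `Φ_j` are congruent modulo `β`, and agree in the coordinates up
to the type of `j`. -/
def Close (β : O) (v w : Fin n₀ → W) : Prop :=
  ∀ j, (∃ u, Phi ϖ σ k₀ j v - Phi ϖ σ k₀ j w = β • u) ∧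
    ∀ a' : Fin n₀, (a' : ℕ) ≤ k₀ * j % n₀ → Phi ϖ σ k₀ j v a' = Phi ϖ σ k₀ j w a'

variable {ϖ σ k₀}

theorem exists_Phi_apply_eq_smul {j : ℕ} {a' : Fin n₀} (ha : (a' : ℕ) < k₀ * j % n₀)
    (v : Fin n₀ → W) : ∃ c, Phi ϖ σ k₀ j v a' = ϖ • c := by
  rw [Phi_eq]
  exact exists_piL_pow_apply_eq_smul ϖ ha _

theorem det_gMat_eq_of_close (hc : Nat.Coprime k₀ n₀) {β : O}
    (hβ : algebraMap O W ϖ * algebraMap O W β = 0) {r : ℕ} {x x' : Fin r → Fin n₀ → W}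
    (hx : ∀ ρ, Close ϖ σ k₀ β (x ρ) (x' ρ)) :
    (gMat ϖ σ k₀ x).det = (gMat ϖ σ k₀ x').det := by
  refine det_eq_of_types (fun i => ((finProdFinEquiv.symm i).2 : ℕ)) (fun j => k₀ * j % n₀)
    (sum_types hc) hβ (fun i j hij => ?_) (fun i j hij => ?_) fun i j => ?_
  · exact (hx (finProdFinEquiv.symm i).1 j).2 _ hij
  · obtain ⟨c, hc⟩ := exists_Phi_apply_eq_smul (ϖ := ϖ) (σ := σ) hij (x (finProdFinEquiv.symm i).1)
    exact ⟨c, by rw [gMat, Matrix.of_apply, hc, Algebra.smul_def]⟩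
  · obtain ⟨u, hu⟩ := (hx (finProdFinEquiv.symm i).1 j).1
    refine ⟨u (finProdFinEquiv.symm i).2, ?_⟩
    rw [← Algebra.smul_def]
    exact congrFun hu _

theorem twPoly_apply_eq_of_close (hc : Nat.Coprime k₀ n₀) {β : O}
    (hβ : algebraMap O W ϖ * algebraMap O W β = 0) {j₀ : ℕ}
    {y y' : Fin j₀ → Fin n₀ → W} {v v' : Fin n₀ → W}
    (hy : ∀ ρ, Close ϖ σ k₀ β (y ρ) (y' ρ)) (hv : Close ϖ σ k₀ β v v') {a : Fin n₀}
    (ha : (a : ℕ) = 0) : twPoly ϖ σ k₀ y v a = twPoly ϖ σ k₀ y' v' a := by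
  rw [twPoly_apply, twPoly_apply]
  refine det_eq_of_types
    (fun i => (Fin.cons 0 (fun t => ((finProdFinEquiv.symm t).2 : ℕ)) : Fin (j₀ * n₀ + 1) → ℕ) i)
    (fun j => k₀ * j % n₀) ?_ hβ (fun i j hij => ?_) (fun i j hij => ?_) fun i j => ?_
  · rw [Fin.sum_univ_succ, Fin.sum_univ_castSucc]
    simp only [Fin.cons_zero, Fin.cons_succ, Fin.val_castSucc, Fin.val_last]
    rw [sum_types hc, ← mul_assoc, Nat.mul_mod_left, zero_add, add_zero]
  · induction i using Fin.cases with
    | zero =>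
      simp only [Matrix.of_apply, Fin.cons_zero]
      exact (hv j).2 _ (by rw [ha]; exact Nat.zero_le _)
    | succ i =>
      simp only [Matrix.of_apply, Fin.cons_succ] at hij ⊢
      exact (hy _ j).2 _ hij
  · induction i using Fin.cases with
    | zero =>
      simp only [Fin.cons_zero] at hij
      obtain ⟨c, hc⟩ := exists_Phi_apply_eq_smul (ϖ := ϖ) (σ := σ) (a' := a)
        (by rw [ha]; exact hij) v
      simp only [Matrix.of_apply, Fin.cons_zero]
      exact ⟨c, by rw [hc, Algebra.smul_def]⟩
    | succ i =>
      simp only [Fin.cons_succ] at hij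
      obtain ⟨c, hc⟩ := exists_Phi_apply_eq_smul (ϖ := ϖ) (σ := σ) hij
        (y (finProdFinEquiv.symm i).1)
      simp only [Matrix.of_apply, Fin.cons_succ]
      exact ⟨c, by rw [hc, Algebra.smul_def]⟩
  · induction i using Fin.cases with
    | zero =>
      obtain ⟨u, hu⟩ := (hv j).1
      simp only [Matrix.of_apply, Fin.cons_zero]
      exact ⟨u a, by rw [← Algebra.smul_def]; exact congrFun hu a⟩
    | succ i =>
      obtain ⟨u, hu⟩ := (hy (finProdFinEquiv.symm i).1 j).1
      simp only [Matrix.of_apply, Fin.cons_succ]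
      exact ⟨u _, by rw [← Algebra.smul_def]; exact congrFun hu _⟩

/-- A ring homomorphism which kills `β` does not separate the values at close vectors. -/
theorem map_twPoly_apply_eq_of_close {W' : Type*} [CommRing W'] (f : W →+* W') {β : O}
    (hf : ∀ u, f (β • u) = 0) {j₀ : ℕ}
    {y y' : Fin j₀ → Fin n₀ → W} {v v' : Fin n₀ → W}
    (hy : ∀ ρ, Close ϖ σ k₀ β (y ρ) (y' ρ)) (hv : Close ϖ σ k₀ β v v') (a : Fin n₀) :
    f (twPoly ϖ σ k₀ y v a) = f (twPoly ϖ σ k₀ y' v' a) := by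
  rw [twPoly_apply, twPoly_apply, RingHom.map_det, RingHom.map_det]
  congr 1
  ext i j
  simp only [RingHom.mapMatrix_apply, Matrix.map_apply, Matrix.of_apply]
  rw [← sub_eq_zero, ← map_sub]
  induction i using Fin.cases with
  | zero =>
    obtain ⟨u, hu⟩ := (hv j).1
    simp only [Fin.cons_zero]
    rw [← Pi.sub_apply, hu, Pi.smul_apply, hf]
  | succ i =>
    obtain ⟨u, hu⟩ := (hy (finProdFinEquiv.symm i).1 j).1
    simp only [Fin.cons_succ]
    rw [← Pi.sub_apply, hu, Pi.smul_apply, hf]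

end Close

section Lifts

variable {O : Type u} [CommRing O] [IsDomain O] [IsDiscreteValuationRing O]
  [Finite (IsLocalRing.ResidueField O)] {ϖ : O} [hϖ : Fact (Irreducible ϖ)] {h : ℕ} [NeZero h]
  {R S : PerfAlg O} {n₀ k₀ : ℕ}

/-- The vectors over `𝕎_h` whose image in the truncated vectors is zero. -/
def Negl (v : Fin n₀ → TruncWitt O h R) : Prop := ∀ a, wRed (lev_le h a) (v a) = 0

/-- The exponent of the power of `Π` whose image is the kernel of the truncation of vectors. -/
def truncExp (n₀ h : ℕ) : ℕ := n₀ * (h - 1) + 1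

theorem piL_truncExp (v : Fin n₀ → TruncWitt O h R) :
    (piL ϖ ^ truncExp n₀ h) v = ϖ ^ (h - 1) • piL ϖ v := by
  rw [truncExp, pow_add, Module.End.mul_apply, piL_pow_mul_self, pow_one]

theorem uniformizer_smul_pow_pred (w : TruncWitt O h R) : ϖ ^ (h - 1) • ϖ • w = 0 := by
  rw [smul_smul, ← pow_succ, Nat.sub_add_cancel (Nat.one_le_iff_ne_zero.2 (NeZero.ne h)),
    uniformizer_pow_smul_eq_zero le_rfl]

variable (ϖ) in
/-- The kernel of the truncation of vectors is the image of a power of `Π`. -/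
theorem negl_iff (hn : 0 < n₀) {v : Fin n₀ → TruncWitt O h R} :
    Negl v ↔ ∃ w, v = (piL ϖ ^ truncExp n₀ h) w := by
  constructor
  · intro hv
    have h1 : ∀ a, ∃ c, v a = ϖ ^ (h - 1) • c ∧ ((a : ℕ) = 0 → c = 0) := by
      intro a
      obtain ⟨c, hc⟩ := (wRed_eq_zero_iff ϖ (lev_le h a)).1 (hv a)
      by_cases ha : (a : ℕ) = 0
      · refine ⟨0, ?_, fun _ => rfl⟩
        rw [hc, lev, if_pos ha, uniformizer_pow_smul_eq_zero le_rfl, smul_zero]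
      · exact ⟨c, by rw [hc, lev, if_neg ha], fun h0 => absurd h0 ha⟩
    choose c hc hc0 using h1
    obtain ⟨w, hw⟩ := exists_eq_piL ϖ hn (v := c) (c := 0) (by rw [hc0 _ rfl, smul_zero])
    refine ⟨w, ?_⟩
    rw [piL_truncExp, ← hw]
    funext a
    exact hc a
  · rintro ⟨w, rfl⟩ a
    rw [wRed_eq_zero_iff ϖ, piL_truncExp]
    by_cases ha : (a : ℕ) = 0
    · obtain ⟨c, hc⟩ := exists_piL_pow_apply_eq_smul ϖ (i := 1) (a' := a) (by omega) w
      refine ⟨0, ?_⟩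
      rw [pow_one] at hc
      rw [Pi.smul_apply, hc, uniformizer_smul_pow_pred, smul_zero]
    · exact ⟨piL ϖ w a, by rw [lev, if_neg ha]; rfl⟩

theorem Negl.add {v w : Fin n₀ → TruncWitt O h R} (hv : Negl v) (hw : Negl w) : Negl (v + w) :=
  fun a => by rw [Pi.add_apply, map_add, hv a, hw a, add_zero]

theorem Negl.zero : Negl (0 : Fin n₀ → TruncWitt O h R) := fun a => by
  rw [Pi.zero_apply, map_zero]

theorem Negl.sum {ι : Type*} (s : Finset ι) {v : ι → Fin n₀ → TruncWitt O h R}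
    (hv : ∀ i ∈ s, Negl (v i)) : Negl (∑ i ∈ s, v i) :=
  Finset.sum_induction _ Negl (fun _ _ => Negl.add) Negl.zero hv

theorem Negl.piL_pow {v : Fin n₀ → TruncWitt O h R} (hv : Negl v) (i : ℕ) :
    Negl ((piL ϖ ^ i) v) := by
  rcases Nat.eq_zero_or_pos n₀ with rfl | hn
  · exact fun a => a.elim0
  obtain ⟨w, rfl⟩ := (negl_iff ϖ hn).1 hv
  rw [piL_pow_pow_apply, add_comm, ← piL_pow_pow_apply]
  exact (negl_iff ϖ hn).2 ⟨_, rfl⟩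

/-- Cancellation of powers of `Π` below the truncation level: this is the flatness of `𝕎_h` in terms
of `Π`. -/
theorem res_eq_zero_of_negl_piL_pow (hn : 0 < n₀) {i : ℕ} (hi : i < truncExp n₀ h)
    {v : Fin n₀ → TruncWitt O h R} (hv : Negl ((piL ϖ ^ i) v)) : res (v ⟨0, hn⟩) = 0 := by
  obtain ⟨w, hw⟩ := (negl_iff ϖ hn).1 hv
  obtain ⟨m, hm⟩ := Nat.exists_eq_add_of_lt hi
  rw [hm, add_assoc, ← piL_pow_pow_apply, ← sub_eq_zero, ← map_sub] at hw
  have h1 : (piL ϖ ^ (n₀ * (h - 1))) (v - (piL ϖ ^ (m + 1)) w) = 0 := by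
    have : n₀ * (h - 1) = (n₀ * (h - 1) - i) + i := by
      rw [truncExp] at hi
      omega
    rw [this, ← piL_pow_pow_apply, hw, map_zero]
  rw [piL_pow_mul_self] at h1
  have h2 := congrFun h1 ⟨0, hn⟩
  have h3 := res_eq_zero_of_smul_eq_zero
    (Nat.sub_lt (Nat.pos_of_ne_zero (NeZero.ne h)) one_pos) h2
  obtain ⟨c, hc⟩ := exists_piL_pow_apply_eq_smul ϖ (i := m + 1) (a' := ⟨0, hn⟩) (Nat.succ_pos m) w
  rw [Pi.sub_apply, map_sub, hc, res_uniformizer_smul, sub_zero] at h3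
  exact h3

theorem exists_eq_piL_of_res_eq_zero (hn : 0 < n₀) {v : Fin n₀ → TruncWitt O h R}
    (hv : res (v ⟨0, hn⟩) = 0) : ∃ w, v = piL ϖ w := by
  obtain ⟨c, hc⟩ := exists_eq_smul_of_res_eq_zero ϖ hv
  exact exists_eq_piL ϖ hn hc

theorem Negl.close {v w : Fin n₀ → TruncWitt O h R} (hvw : Negl (v - w)) :
    Close ϖ (sigmaAlg h R) k₀ (ϖ ^ (h - 1)) v w := by
  rcases Nat.eq_zero_or_pos n₀ with rfl | hn
  · exact fun j => ⟨⟨0, funext fun a => a.elim0⟩, fun a => a.elim0⟩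
  intro j
  obtain ⟨z, hz⟩ := (negl_iff ϖ hn).1 hvw
  have h0 : Phi ϖ (sigmaAlg h R) k₀ j v =
      Phi ϖ (sigmaAlg h R) k₀ j (v - w) + Phi ϖ (sigmaAlg h R) k₀ j w := by
    rw [← Phi_add, sub_add_cancel]
  have h1 : Phi ϖ (sigmaAlg h R) k₀ j (v - w) =
      ϖ ^ (h - 1) • (piL ϖ ^ (k₀ * j % n₀ + 1)) fun a => (sigmaAlg h R ^ j) (z a) := by
    rw [hz, Phi_piL_pow, piL_truncExp, Phi_eq, add_comm, ← piL_pow_pow_apply, pow_one]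
  refine ⟨⟨_, by rw [h0, add_sub_cancel_right, h1]⟩, fun a' ha => ?_⟩
  obtain ⟨c, hc⟩ := exists_piL_pow_apply_eq_smul ϖ (Nat.lt_succ_of_le ha)
    fun a => (sigmaAlg h R ^ j) (z a)
  rw [h0, h1, Pi.add_apply, Pi.smul_apply, hc, uniformizer_smul_pow_pred, zero_add]

theorem truncWitt_smul_def (c : O) (w : TruncWitt O h R) :
    c • w = algebraMap O (TruncWitt O h R) c * w := Algebra.smul_def c w

theorem algebraMap_mul_pow_pred :
    algebraMap O (TruncWitt O h R) ϖ * algebraMap O (TruncWitt O h R) (ϖ ^ (h - 1)) = 0 := by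
  have := uniformizer_smul_pow_pred (ϖ := ϖ) (1 : TruncWitt O h R)
  rw [truncWitt_smul_def, truncWitt_smul_def, mul_one] at this
  rw [mul_comm, this]

theorem det_gMat_congr (hc : Nat.Coprime k₀ n₀) {r : ℕ} {x x' : Fin r → Fin n₀ → TruncWitt O h R}
    (hx : ∀ ρ, Negl (x ρ - x' ρ)) :
    (gMat ϖ (sigmaAlg h R) k₀ x).det = (gMat ϖ (sigmaAlg h R) k₀ x').det := by
  have h1 := fun ρ => (hx ρ).close (ϖ := ϖ) (k₀ := k₀)
  have h2 := algebraMap_mul_pow_pred (ϖ := ϖ) (h := h) (R := R)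
  exact det_gMat_eq_of_close hc h2 h1

theorem negl_twPoly_sub (hc : Nat.Coprime k₀ n₀) {j₀ : ℕ}
    {y y' : Fin j₀ → Fin n₀ → TruncWitt O h R} {v v' : Fin n₀ → TruncWitt O h R}
    (hy : ∀ ρ, Negl (y ρ - y' ρ)) (hv : Negl (v - v')) :
    Negl (twPoly ϖ (sigmaAlg h R) k₀ y v - twPoly ϖ (sigmaAlg h R) k₀ y' v') := by
  have h1 := fun ρ => (hy ρ).close (ϖ := ϖ) (k₀ := k₀)
  have h1' := hv.close (ϖ := ϖ) (k₀ := k₀)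
  have h2 := algebraMap_mul_pow_pred (ϖ := ϖ) (h := h) (R := R)
  intro a
  rw [Pi.sub_apply, map_sub, sub_eq_zero]
  by_cases ha : (a : ℕ) = 0
  · have h3 := twPoly_apply_eq_of_close hc h2 h1 h1' ha
    rw [h3]
  · have hf : ∀ u : TruncWitt O h R, wRed (lev_le h a) (ϖ ^ (h - 1) • u) = 0 := fun u => by
      rw [wRed_smul, uniformizer_pow_smul_eq_zero (by rw [lev, if_neg ha])]
    exact map_twPoly_apply_eq_of_close (wRed (lev_le h a)) hf h1 h1' a

/-- A vector over `𝕎_h` lifts a truncated vector. -/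
def IsLift {r : ℕ} (x' : Fin r → Fin n₀ → TruncWitt O h R) (x : Z n₀ r h R) : Prop :=
  ∀ ρ a, wRed (lev_le h a) (x' ρ a) = x ρ a

/-- The chosen lift of a truncated vector. -/
noncomputable def liftZ {r : ℕ} (x : Z n₀ r h R) : Fin r → Fin n₀ → TruncWitt O h R :=
  fun ρ a => wLift a (x ρ a)

theorem wRed_wLift (a : Fin n₀) (w : TruncWitt O (lev h a) R) :
    wRed (lev_le h a) (wLift a w) = w :=
  Function.surjInv_eq (wRed_surjective (lev_le h a)) w

theorem isLift_liftZ {r : ℕ} (x : Z n₀ r h R) : IsLift (liftZ x) x :=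
  fun ρ a => wRed_wLift a (x ρ a)

theorem IsLift.negl_sub {r : ℕ} {x' x'' : Fin r → Fin n₀ → TruncWitt O h R} {x : Z n₀ r h R}
    (h' : IsLift x' x) (h'' : IsLift x'' x) (ρ : Fin r) : Negl (x' ρ - x'' ρ) := fun a => by
  rw [Pi.sub_apply, map_sub, h' ρ a, h'' ρ a, sub_self]

theorem gEntry_eq {r : ℕ} (x : Z n₀ r h R) (p : Fin r × Fin n₀) (j : ℕ) :
    gEntry ϖ k₀ x p j = Phi ϖ (sigmaAlg h R) k₀ j (liftZ x p.1) p.2 := by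
  simp only [gEntry, Phi, liftZ, AlgHom.coe_pow, coe_sigmaAlg]

/-- `|g(x)|` may be computed with any lift of `x`. -/
theorem IsLift.detG (hc : Nat.Coprime k₀ n₀) {r : ℕ} {x' : Fin r → Fin n₀ → TruncWitt O h R}
    {x : Z n₀ r h R} (hx : IsLift x' x) :
    LoopDL.detG ϖ k₀ x = (gMat ϖ (sigmaAlg h R) k₀ x').det := by
  rw [← det_gMat_congr hc (fun ρ => (isLift_liftZ x).negl_sub hx ρ)]
  rw [LoopDL.detG]
  congr 1
  ext i j
  rw [Matrix.of_apply, gEntry_eq]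
  rfl

/-- The minors may be computed with any lift of `x`. -/
theorem IsLift.minor (hc : Nat.Coprime k₀ n₀) {i₀ j₀ : ℕ}
    {x' : Fin (i₀ + j₀) → Fin n₀ → TruncWitt O h R} {x : Z n₀ (i₀ + j₀) h R} (hx : IsLift x' x)
    (ρ : Fin i₀) (a : Fin n₀) :
    LoopDL.minor ϖ k₀ x ρ a = wRed (lev_le h a) (twPoly ϖ (sigmaAlg h R) k₀
      (fun j => x' (Fin.natAdd i₀ j)) (x' (Fin.castAdd j₀ ρ)) a) := by
  have h1 : LoopDL.minor ϖ k₀ x ρ a = wRed (lev_le h a) (twPoly ϖ (sigmaAlg h R) k₀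
      (fun j => liftZ x (Fin.natAdd i₀ j)) (liftZ x (Fin.castAdd j₀ ρ)) a) := by
    rw [twPoly_apply, LoopDL.minor]
    congr 2
    ext i j
    simp only [Matrix.of_apply, gEntry_eq]
    refine Fin.cases ?_ (fun i => ?_) i
    · simp only [Fin.cons_zero]
    · simp only [Fin.cons_succ]
  rw [h1, ← sub_eq_zero, ← map_sub, ← Pi.sub_apply]
  exact negl_twPoly_sub hc (fun j => (isLift_liftZ x).negl_sub hx _)
    ((isLift_liftZ x).negl_sub hx _) a

end Lifts

/-! ### Naturality and commuting blocks -/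

section Natural

variable {O : Type*} [CommRing O] {ϖ : O} {W W' : Type*} [CommRing W] [Algebra O W] [CommRing W']
  [Algebra O W'] {σ : W →ₐ[O] W} {σ' : W' →ₐ[O] W'} {n₀ k₀ : ℕ} (f : W →ₐ[O] W')
  (hf : ∀ w, f (σ w) = σ' (f w))
include hf

theorem map_sigma_pow (j : ℕ) (w : W) : f ((σ ^ j) w) = (σ' ^ j) (f w) := by
  induction j with
  | zero => rfl
  | succ j ih => rw [pow_succ', pow_succ', AlgHom.mul_apply, hf, ih, AlgHom.mul_apply]

theorem map_Phi (j : ℕ) (v : Fin n₀ → W) (a : Fin n₀) :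
    f (Phi ϖ σ k₀ j v a) = Phi ϖ σ' k₀ j (fun a => f (v a)) a := by
  simp only [Phi, map_sum, map_smul, map_sigma_pow f hf]

theorem map_det_gMat {r : ℕ} (x : Fin r → Fin n₀ → W) :
    f (gMat ϖ σ k₀ x).det = (gMat ϖ σ' k₀ fun ρ a => f (x ρ a)).det := by
  rw [AlgHom.map_det]
  congr 1
  ext i j
  simp only [AlgHom.mapMatrix_apply, Matrix.map_apply, gMat, Matrix.of_apply, map_Phi f hf]

theorem map_cof {j₀ : ℕ} (y : Fin j₀ → Fin n₀ → W) (t : ℕ) :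
    f (cof ϖ σ k₀ y t) = cof ϖ σ' k₀ (fun ρ a => f (y ρ a)) t := by
  rw [cof, cof, map_mul, map_pow, map_neg, map_one, AlgHom.map_det]
  congr 2
  ext i j
  simp only [AlgHom.mapMatrix_apply, Matrix.map_apply, Matrix.of_apply, map_Phi f hf]

theorem map_twPoly {j₀ : ℕ} (y : Fin j₀ → Fin n₀ → W) (v : Fin n₀ → W) (a : Fin n₀) :
    f (twPoly ϖ σ k₀ y v a) =
      twPoly ϖ σ' k₀ (fun ρ a => f (y ρ a)) (fun a => f (v a)) a := by
  simp only [twPoly, Finset.sum_apply, Pi.smul_apply, smul_eq_mul, map_sum, map_mul,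
    map_Phi f hf, map_cof f hf]

end Natural

section BlockAct

variable {O : Type*} [CommRing O] (ϖ : O) {W : Type*} [CommRing W] [Algebra O W] (σ : W →ₐ[O] W)
  {n₀ : ℕ} (k₀ l : ℕ)

/-- The action of the block with parameters `a` on `W ^ n₀`. -/
noncomputable def blockAct (a : Fin n₀ → W) (v : Fin n₀ → W) : Fin n₀ → W :=
  ∑ t : Fin n₀, (piL ϖ ^ (k₀ * t % n₀)) fun p => (σ ^ ((p : ℕ) * l)) (a t) * v p

theorem blockAct_add_right (a v w : Fin n₀ → W) :
    blockAct ϖ σ k₀ l a (v + w) = blockAct ϖ σ k₀ l a v + blockAct ϖ σ k₀ l a w := by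
  simp only [blockAct, ← Finset.sum_add_distrib, ← map_add]
  refine Finset.sum_congr rfl fun t _ => ?_
  congr 1
  funext p
  simp only [Pi.add_apply, mul_add]

theorem blockAct_add_left (a b v : Fin n₀ → W) :
    blockAct ϖ σ k₀ l (a + b) v = blockAct ϖ σ k₀ l a v + blockAct ϖ σ k₀ l b v := by
  simp only [blockAct, ← Finset.sum_add_distrib, ← map_add]
  refine Finset.sum_congr rfl fun t _ => ?_
  congr 1
  funext p
  simp only [Pi.add_apply, map_add, add_mul]

theorem blockAct_zero_left (v : Fin n₀ → W) : blockAct ϖ σ k₀ l 0 v = 0 := by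
  have := blockAct_add_left ϖ σ k₀ l 0 0 v
  rwa [add_zero, left_eq_add] at this

theorem blockAct_zero_right (a : Fin n₀ → W) : blockAct ϖ σ k₀ l a 0 = 0 := by
  have := blockAct_add_right ϖ σ k₀ l a 0 0
  rwa [add_zero, left_eq_add] at this

theorem blockAct_smul (a : Fin n₀ → W) (c : W) (v : Fin n₀ → W) :
    blockAct ϖ σ k₀ l a (c • v) = c • blockAct ϖ σ k₀ l a v := by
  simp only [blockAct, Finset.smul_sum, ← map_smul]
  refine Finset.sum_congr rfl fun t _ => ?_
  congr 1
  funext p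
  simp only [Pi.smul_apply, smul_eq_mul, mul_left_comm]

theorem blockAct_sum {ι : Type*} (s : Finset ι) (a : Fin n₀ → W) (v : ι → Fin n₀ → W) :
    blockAct ϖ σ k₀ l a (∑ i ∈ s, v i) = ∑ i ∈ s, blockAct ϖ σ k₀ l a (v i) :=
  map_sum (AddMonoidHom.mk' (blockAct ϖ σ k₀ l a) (blockAct_add_right ϖ σ k₀ l a)) v s

theorem sigma_pow_mod {α : W} (hα : (σ ^ n₀) α = α) {i j : ℕ} (hij : i ≡ j [MOD n₀]) :
    (σ ^ i) α = (σ ^ j) α := by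
  have key : ∀ i, (σ ^ i) α = (σ ^ (i % n₀)) α := by
    intro i
    have h1 : ∀ m, (σ ^ (n₀ * m)) α = α := by
      intro m
      induction m with
      | zero => rfl
      | succ m ih => rw [Nat.mul_succ, pow_add, AlgHom.mul_apply, hα, ih]
    conv_lhs => rw [← Nat.mod_add_div i n₀, pow_add, AlgHom.mul_apply, h1]
  rw [key i, key j, hij]

variable {l}

/-- The diagonal matrices in the definition of `N_h` commute with `c σ`, because
`σ^{k₀ l} = σ` on elements fixed by `σ^{n₀}`. -/
theorem Phi_diag (hl : k₀ * l ≡ 1 [MOD n₀]) {α : W} (hα : (σ ^ n₀) α = α) (j : ℕ)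
    (v : Fin n₀ → W) :
    Phi ϖ σ k₀ j (fun p => (σ ^ ((p : ℕ) * l)) α * v p) =
      fun p : Fin n₀ => (σ ^ ((p : ℕ) * l)) α * Phi ϖ σ k₀ j v p := by
  funext a'
  simp only [Phi, Finset.mul_sum]
  refine Finset.sum_congr rfl fun a _ => ?_
  rw [scaledPow, Matrix.of_apply]
  split_ifs with ha
  · rw [map_mul, ← AlgHom.mul_apply, ← pow_add, mul_smul_comm]
    congr 2
    refine sigma_pow_mod σ hα ?_
    have h1 : (a' : ℕ) ≡ a + k₀ * j [MOD n₀] := by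
      rw [ha]
      exact Nat.mod_modEq _ _
    calc j + a * l = 1 * j + a * l := by rw [one_mul]
      _ ≡ k₀ * l * j + a * l [MOD n₀] := (hl.symm.mul_right _).add_right _
      _ = (a + k₀ * j) * l := by ring
      _ ≡ a' * l [MOD n₀] := (h1.symm.mul_right _)
  · simp

theorem Phi_blockAct (hl : k₀ * l ≡ 1 [MOD n₀]) {a : Fin n₀ → W} (ha : ∀ t, (σ ^ n₀) (a t) = a t)
    (j : ℕ) (v : Fin n₀ → W) :
    Phi ϖ σ k₀ j (blockAct ϖ σ k₀ l a v) = blockAct ϖ σ k₀ l a (Phi ϖ σ k₀ j v) := by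
  rw [blockAct, Phi_sum, blockAct]
  refine Finset.sum_congr rfl fun t _ => ?_
  rw [Phi_piL_pow, Phi_diag ϖ σ k₀ hl (ha t)]

theorem twPoly_blockAct (hl : k₀ * l ≡ 1 [MOD n₀]) {a : Fin n₀ → W}
    (ha : ∀ t, (σ ^ n₀) (a t) = a t) {j₀ : ℕ} (y : Fin j₀ → Fin n₀ → W) (v : Fin n₀ → W) :
    twPoly ϖ σ k₀ y (blockAct ϖ σ k₀ l a v) = blockAct ϖ σ k₀ l a (twPoly ϖ σ k₀ y v) := by
  simp only [twPoly, blockAct_sum, blockAct_smul, Phi_blockAct ϖ σ k₀ hl ha]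

theorem map_blockAct {W' : Type*} [CommRing W'] [Algebra O W'] {σ' : W' →ₐ[O] W'} (f : W →ₐ[O] W')
    (hf : ∀ w, f (σ w) = σ' (f w)) (a v : Fin n₀ → W) (p : Fin n₀) :
    f (blockAct ϖ σ k₀ l a v p) =
      blockAct ϖ σ' k₀ l (fun t => f (a t)) (fun t => f (v t)) p := by
  simp only [blockAct, Finset.sum_apply, map_sum, piL_pow_apply, map_smul, map_mul,
    map_sigma_pow f hf]

end BlockAct

/-! ### The action of `N_h` in terms of lifts -/

section Action

variable {O : Type u} [CommRing O] [IsDomain O] [IsDiscreteValuationRing O]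
  [Finite (IsLocalRing.ResidueField O)] {ϖ : O} [hϖ : Fact (Irreducible ϖ)] {h : ℕ} [NeZero h]
  {R S : PerfAlg O} {n₀ k₀ l : ℕ}

/-- Functoriality of `𝕎_h` as a homomorphism of `O`-algebras. -/
noncomputable def wMapAlg (h : ℕ) (f : R →ₐ[GeomField O] S) :
    TruncWitt O h R →ₐ[O] TruncWitt O h S :=
  { wMap h (f.restrictScalars O) with
    commutes' := fun c => by
      change wMap h (f.restrictScalars O) (algebraMap O _ c) = algebraMap O _ c
      rw [Algebra.algebraMap_eq_smul_one, wMap_smul, map_one]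
      exact (Algebra.algebraMap_eq_smul_one c).symm }

theorem wMapAlg_apply (f : R →ₐ[GeomField O] S) (w : TruncWitt O h R) :
    wMapAlg h f w = wMap h (f.restrictScalars O) w := rfl

theorem wMapAlg_sigmaAlg (f : R →ₐ[GeomField O] S) (w : TruncWitt O h R) :
    wMapAlg h f (sigmaAlg h R w) = sigmaAlg h S (wMapAlg h f w) := wMap_sigma f w

theorem IsLift.zMap {r : ℕ} {x' : Fin r → Fin n₀ → TruncWitt O h R} {x : Z n₀ r h R}
    (hx : IsLift x' x) (f : R →ₐ[GeomField O] S) :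
    IsLift (fun ρ a => wMapAlg h f (x' ρ a)) (LoopDL.zMap f x) := fun ρ a => by
  change wRed _ (wMap h _ (x' ρ a)) = _
  rw [wRed_wMap, hx ρ a]
  rfl

theorem detG_zMap (hc : Nat.Coprime k₀ n₀) {r : ℕ} (f : R →ₐ[GeomField O] S) (x : Z n₀ r h R) :
    detG ϖ k₀ (zMap f x) = wMapAlg h f (detG ϖ k₀ x) := by
  rw [(isLift_liftZ x).detG hc, ((isLift_liftZ x).zMap f).detG hc]
  exact (map_det_gMat (wMapAlg h f) (wMapAlg_sigmaAlg f) _).symm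

theorem alpha_zMap (hc : Nat.Coprime k₀ n₀) {i₀ j₀ : ℕ} (f : R →ₐ[GeomField O] S)
    (x : Z n₀ (i₀ + j₀) h R) :
    alpha ϖ k₀ (zMap f x) = Prod.map (zMap f) (zMap f) (alpha ϖ k₀ x) := by
  refine Prod.ext ?_ rfl
  funext ρ a
  change minor ϖ k₀ (zMap f x) ρ a = wMap _ _ (minor ϖ k₀ x ρ a)
  rw [(isLift_liftZ x).minor hc, ((isLift_liftZ x).zMap f).minor hc, ← wRed_wMap]
  congr 1
  exact (map_twPoly (wMapAlg h f) (wMapAlg_sigmaAlg f) _ _ a).symm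

theorem negl_blockAct_right {v : Fin n₀ → TruncWitt O h R} (hv : Negl v)
    (a : Fin n₀ → TruncWitt O h R) : Negl (blockAct ϖ (sigmaAlg h R) k₀ l a v) := by
  refine Negl.sum _ fun t _ => Negl.piL_pow (fun p => ?_) _
  rw [map_mul, hv p, mul_zero]

theorem negl_blockAct_left (hc : Nat.Coprime k₀ n₀) {a : Fin n₀ → TruncWitt O h R} (ha : Negl a)
    (v : Fin n₀ → TruncWitt O h R) : Negl (blockAct ϖ (sigmaAlg h R) k₀ l a v) := by
  refine Negl.sum _ fun t _ => ?_
  obtain ⟨c, hc'⟩ := (wRed_eq_zero_iff ϖ (lev_le h t)).1 (ha t)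
  by_cases ht : (t : ℕ) = 0
  · rw [lev, if_pos ht, uniformizer_pow_smul_eq_zero le_rfl] at hc'
    have : (fun p : Fin n₀ => (sigmaAlg h R ^ ((p : ℕ) * l)) (a t) * v p) = 0 := by
      funext p
      rw [hc', map_zero, zero_mul, Pi.zero_apply]
    rw [this, map_zero]
    exact Negl.zero
  · rw [lev, if_neg ht] at hc'
    have hpos : 0 < k₀ * t % n₀ := by
      refine Nat.pos_of_ne_zero fun h0 => ?_
      have := Nat.Coprime.dvd_of_dvd_mul_left hc.symm (Nat.dvd_of_mod_eq_zero h0)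
      exact absurd (Nat.le_of_dvd (Nat.pos_of_ne_zero ht) this) (not_le.2 t.2)
    obtain ⟨e, he⟩ := Nat.exists_eq_succ_of_ne_zero hpos.ne'
    have h1 : (fun p : Fin n₀ => (sigmaAlg h R ^ ((p : ℕ) * l)) (a t) * v p) =
        ϖ ^ (h - 1) • fun p : Fin n₀ => (sigmaAlg h R ^ ((p : ℕ) * l)) c * v p := by
      funext p
      rw [hc', map_smul, Pi.smul_apply, smul_mul_assoc]
    have h2 : ϖ ^ (h - 1) • (fun p : Fin n₀ => (sigmaAlg h R ^ ((p : ℕ) * l)) c * v p) =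
        (piL ϖ ^ (n₀ * (h - 1))) fun p : Fin n₀ => (sigmaAlg h R ^ ((p : ℕ) * l)) c * v p :=
      by rw [piL_pow_mul_self]
    have h3 : k₀ * t % n₀ + n₀ * (h - 1) = truncExp n₀ h + e := by
      rw [truncExp]
      omega
    rw [h1, h2, piL_pow_pow_apply, h3, ← piL_pow_pow_apply]
    exact (negl_iff ϖ t.pos).2 ⟨_, rfl⟩

/-- The map `𝕎_h(\overline{𝔽}_q) → 𝕎_h(R)`. -/
noncomputable def wBase (h : ℕ) (R : PerfAlg O) :
    TruncWitt O h (PerfAlg.base O) →ₐ[O] TruncWitt O h R := wMapAlg h R.ofBase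

theorem wMapAlg_wBase (f : R →ₐ[GeomField O] S) (w : TruncWitt O h (PerfAlg.base O)) :
    wMapAlg h f (wBase h R w) = wBase h S w := by
  rw [wBase, wBase, wMapAlg_apply, wMapAlg_apply, wMapAlg_apply, ← wMap_comp]
  congr 2
  ext x
  exact f.commutes x

theorem wBase_sigma_pow_fixed {w : TruncWitt O h (PerfAlg.base O)} (hw : sigma^[n₀] w = w) :
    (sigmaAlg h R ^ n₀) (wBase h R w) = wBase h R w := by
  rw [wBase, ← map_sigma_pow (wMapAlg h R.ofBase) (wMapAlg_sigmaAlg _), AlgHom.coe_pow,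
    coe_sigmaAlg, hw]

theorem blockMat_mulVec (a : (t : Fin n₀) → TruncWitt O (lev h t) (PerfAlg.base O))
    (v : Fin n₀ → TruncWitt O h R) :
    ((blockMat ϖ k₀ l a).map (wMap h (R.ofBase.restrictScalars O))).mulVec v =
      blockAct ϖ (sigmaAlg h R) k₀ l (fun t => wBase h R (wLift t (a t))) v := by
  funext p
  rw [blockAct, Finset.sum_apply]
  simp only [piL_pow_apply, ← scaledPow_eq_cyc_pow]
  rw [Finset.sum_comm, Matrix.mulVec, dotProduct]
  refine Finset.sum_congr rfl fun b _ => ?_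
  rw [Matrix.map_apply, blockMat, Matrix.sum_apply, map_sum, Finset.sum_mul]
  refine Finset.sum_congr rfl fun t _ => ?_
  rw [Matrix.mul_diagonal, Matrix.map_apply, ← truncWitt_smul_def, wMap_smul, wMap_sigma_iterate,
    smul_mul_assoc, AlgHom.coe_pow, coe_sigmaAlg]
  rfl

variable {i₀ j₀ : ℕ}

/-- A lift of the parameters of an element of `N_h`. -/
def IsParamLift
    (a : Fin i₀ → Fin j₀ → Fin n₀ → TruncWitt O h (PerfAlg.base O))
    (u : Fin i₀ → Fin j₀ → (t : Fin n₀) → TruncWitt O (lev h t) (PerfAlg.base O)) : Prop :=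
  ∀ i j t, wRed (lev_le h t) (a i j t) = u i j t

variable (ϖ k₀ l) in
/-- The action of a block matrix on vectors over `𝕎_h`. -/
noncomputable def actLift (a : Fin i₀ → Fin j₀ → Fin n₀ → TruncWitt O h (PerfAlg.base O))
    (x' : Fin (i₀ + j₀) → Fin n₀ → TruncWitt O h R) : Fin (i₀ + j₀) → Fin n₀ → TruncWitt O h R :=
  Fin.addCases (fun i => x' (Fin.castAdd j₀ i) + ∑ j : Fin j₀, blockAct ϖ (sigmaAlg h R) k₀ l
    (fun t => wBase h R (a i j t)) (x' (Fin.natAdd i₀ j))) fun j => x' (Fin.natAdd i₀ j)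

/-- The action of `N_h` may be computed with any lifts. -/
theorem isLift_actLift (hc : Nat.Coprime k₀ n₀)
    {a : Fin i₀ → Fin j₀ → Fin n₀ → TruncWitt O h (PerfAlg.base O)}
    {u : Fin i₀ → Fin j₀ → (t : Fin n₀) → TruncWitt O (lev h t) (PerfAlg.base O)}
    (ha : IsParamLift a u) {x' : Fin (i₀ + j₀) → Fin n₀ → TruncWitt O h R} {x : Z n₀ (i₀ + j₀) h R}
    (hx : IsLift x' x) : IsLift (actLift ϖ k₀ l a x') (act ϖ k₀ l u x) := by
  intro ρ p
  induction ρ using Fin.addCases with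
  | right j =>
    rw [actLift, act, Fin.addCases_right, Fin.addCases_right]
    exact hx _ p
  | left i =>
    rw [actLift, act, Fin.addCases_left, Fin.addCases_left, Pi.add_apply, map_add, hx, add_right_inj,
      Finset.sum_apply, ← sub_eq_zero, ← map_sub, ← Finset.sum_sub_distrib, map_sum]
    refine Finset.sum_eq_zero fun j _ => ?_
    rw [blockMat_mulVec]
    set A : Fin n₀ → TruncWitt O h R := fun t => wBase h R (a i j t)
    set B : Fin n₀ → TruncWitt O h R := fun t => wBase h R (wLift t (u i j t))
    set v : Fin n₀ → TruncWitt O h R := x' (Fin.natAdd i₀ j)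
    set w : Fin n₀ → TruncWitt O h R := fun b => wLift b (x (Fin.natAdd i₀ j) b)
    have h1 : blockAct ϖ (sigmaAlg h R) k₀ l A v = blockAct ϖ (sigmaAlg h R) k₀ l B w +
        blockAct ϖ (sigmaAlg h R) k₀ l B (v - w) + blockAct ϖ (sigmaAlg h R) k₀ l (A - B) v := by
      rw [← blockAct_add_right, add_sub_cancel, ← blockAct_add_left, add_sub_cancel]
    have h2 : Negl (v - w) := hx.negl_sub (isLift_liftZ x) _
    have h3 : Negl (A - B) := fun t => by
      change wRed _ (wBase h R (a i j t) - wBase h R (wLift t (u i j t))) = 0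
      rw [← map_sub, wBase, wMapAlg_apply, wRed_wMap, map_sub, ha i j t, wRed_wLift, sub_self,
        map_zero]
    rw [h1, Pi.add_apply, Pi.add_apply, add_assoc, add_sub_cancel_left, map_add,
      negl_blockAct_right h2 B p, negl_blockAct_left hc h3 v p, add_zero]

theorem IsLift.eq {r : ℕ} {x' : Fin r → Fin n₀ → TruncWitt O h R} {x y : Z n₀ r h R}
    (hx : IsLift x' x) (hy : IsLift x' y) : x = y := by
  funext ρ a
  rw [← hx, hy]

theorem isParamLift_wLift
    (u : Fin i₀ → Fin j₀ → (t : Fin n₀) → TruncWitt O (lev h t) (PerfAlg.base O)) :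
    IsParamLift (fun i j t => wLift t (u i j t)) u := fun _ _ t => wRed_wLift t _

theorem act_zero (hc : Nat.Coprime k₀ n₀) (x : Z n₀ (i₀ + j₀) h R) : act ϖ k₀ l 0 x = x := by
  have h0 : IsParamLift (0 : Fin i₀ → Fin j₀ → Fin n₀ → TruncWitt O h (PerfAlg.base O)) 0 :=
    fun _ _ _ => map_zero _
  have h1 := isLift_actLift (ϖ := ϖ) (l := l) hc h0 (isLift_liftZ x)
  have h2 : actLift ϖ k₀ l (0 : Fin i₀ → Fin j₀ → Fin n₀ → TruncWitt O h (PerfAlg.base O))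
      (liftZ x) = liftZ x := by
    funext ρ
    induction ρ using Fin.addCases with
    | right j => rw [actLift, Fin.addCases_right]
    | left i =>
      rw [actLift, Fin.addCases_left, add_eq_left]
      refine Finset.sum_eq_zero fun j _ => ?_
      have : (fun t : Fin n₀ => wBase h R
          ((0 : Fin i₀ → Fin j₀ → Fin n₀ → TruncWitt O h (PerfAlg.base O)) i j t)) = 0 :=
        funext fun t => map_zero (wBase h R)
      rw [this, blockAct_zero_left]
  rw [h2] at h1
  exact h1.eq (isLift_liftZ x)

theorem act_add (hc : Nat.Coprime k₀ n₀)
    (u v : Fin i₀ → Fin j₀ → (t : Fin n₀) → TruncWitt O (lev h t) (PerfAlg.base O))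
    (x : Z n₀ (i₀ + j₀) h R) :
    act ϖ k₀ l (u + v) x = act ϖ k₀ l u (act ϖ k₀ l v x) := by
  have hu := isParamLift_wLift (h := h) u
  have hv := isParamLift_wLift (h := h) v
  have huv : IsParamLift (fun i j t => wLift t (u i j t) + wLift t (v i j t)) (u + v) :=
    fun i j t => by rw [map_add, wRed_wLift, wRed_wLift]; rfl
  have h1 := isLift_actLift (ϖ := ϖ) (l := l) hc huv (isLift_liftZ x)
  have h2 := isLift_actLift (ϖ := ϖ) (l := l) hc hu
    (isLift_actLift (ϖ := ϖ) (l := l) hc hv (isLift_liftZ x))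
  refine h1.eq ?_
  convert h2 using 1
  funext ρ
  induction ρ using Fin.addCases with
  | right j => simp only [actLift, Fin.addCases_right]
  | left i =>
    simp only [actLift, Fin.addCases_left, Fin.addCases_right]
    rw [add_assoc, ← Finset.sum_add_distrib]
    congr 1
    refine Finset.sum_congr rfl fun j _ => ?_
    rw [add_comm (blockAct _ _ _ _ _ _), ← blockAct_add_left]
    congr 1
    funext t
    exact map_add (wBase h R) _ _

theorem act_zMap (hc : Nat.Coprime k₀ n₀)
    (u : Fin i₀ → Fin j₀ → (t : Fin n₀) → TruncWitt O (lev h t) (PerfAlg.base O))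
    (f : R →ₐ[GeomField O] S) (x : Z n₀ (i₀ + j₀) h R) :
    act ϖ k₀ l u (zMap f x) = zMap f (act ϖ k₀ l u x) := by
  have hu := isParamLift_wLift (h := h) u
  have h1 := isLift_actLift (ϖ := ϖ) (l := l) hc hu ((isLift_liftZ x).zMap f)
  have h2 := (isLift_actLift (ϖ := ϖ) (l := l) hc hu (isLift_liftZ x)).zMap f
  refine h1.eq ?_
  convert h2 using 1
  funext ρ p
  induction ρ using Fin.addCases with
  | right j => simp only [actLift, Fin.addCases_right]
  | left i =>
    simp only [actLift, Fin.addCases_left, Pi.add_apply, Finset.sum_apply, map_add, map_sum,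
      map_blockAct ϖ (sigmaAlg h R) k₀ (wMapAlg h f) (wMapAlg_sigmaAlg f), wMapAlg_wBase]

theorem exists_pow_sub_self (m : ℕ) (hm : 1 < m) (r : PerfAlg.base O) :
    ∃ c : PerfAlg.base O, c ^ m - c = r := by
  suffices H : ∀ r : GeomField O, ∃ c : GeomField O, c ^ m - c = r from H r
  intro r
  have hd : (Polynomial.X ^ m - Polynomial.X - Polynomial.C r).natDegree = m := by
    rw [sub_sub, Polynomial.natDegree_sub_eq_left_of_natDegree_lt, Polynomial.natDegree_X_pow]
    rw [Polynomial.natDegree_X_add_C, Polynomial.natDegree_X_pow]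
    exact hm
  obtain ⟨c, hc⟩ := IsAlgClosed.exists_root
    (Polynomial.X ^ m - Polynomial.X - Polynomial.C r)
    (Polynomial.degree_ne_of_natDegree_ne (n := 0) (by rw [hd]; omega))
  refine ⟨c, ?_⟩
  simpa [Polynomial.IsRoot, sub_eq_zero] using hc

/-- Points of `N_h` lift to parameters over `𝕎_h` which are still fixed by `σ^{n₀}`: the obstruction
is removed by solving an Artin–Schreier equation over `\overline{𝔽}_q`. -/
theorem exists_fixed_paramLift (hn : 0 < n₀)
    {u : Fin i₀ → Fin j₀ → (t : Fin n₀) → TruncWitt O (lev h t) (PerfAlg.base O)}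
    (hu : u ∈ N O n₀ i₀ j₀ h) :
    ∃ a, IsParamLift a u ∧ ∀ i j t, sigma^[n₀] (a i j t) = a i j t := by
  obtain ⟨ϖ, hϖ⟩ := IsDiscreteValuationRing.exists_irreducible O
  have := Fact.mk hϖ
  have key : ∀ i j t, ∃ w : TruncWitt O h (PerfAlg.base O),
      wRed (lev_le h t) w = u i j t ∧ sigma^[n₀] w = w := by
    intro i j t
    obtain ⟨w, hw⟩ := wRed_surjective (lev_le h t) (u i j t)
    have h1 : wRed (lev_le h t) (sigma^[n₀] w - w) = 0 := by
      rw [map_sub, wRed_sigma_iterate, hw, hu i j t, sub_self]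
    obtain ⟨v, hv⟩ := (wRed_eq_zero_iff ϖ (lev_le h t)).1 h1
    obtain ⟨c, hc⟩ := exists_pow_sub_self (resCard O ^ n₀)
      (Nat.one_lt_pow hn.ne' (one_lt_resCard O)) (-res v)
    have h2 : res (v + (teich (c ^ resCard O ^ n₀) - teich c)) = 0 := by
      rw [map_add, map_sub, res_teich, res_teich, hc, add_neg_cancel]
    obtain ⟨z, hz⟩ := exists_eq_smul_of_res_eq_zero ϖ h2
    refine ⟨w + ϖ ^ lev h t • teich c, ?_, ?_⟩
    · rw [map_add, hw, wRed_smul, uniformizer_pow_smul_eq_zero le_rfl, add_zero]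
    · rw [iterate_map_add, sigma_iterate_smul, sigma_iterate_teich]
      have h3 : sigma^[n₀] w = w + ϖ ^ lev h t • v := by rw [← hv]; ring
      have h4 : ϖ ^ lev h t • (v + (teich (c ^ resCard O ^ n₀) - teich c)) =
          (0 : TruncWitt O h (PerfAlg.base O)) := by
        rw [hz, smul_smul, ← pow_succ, uniformizer_pow_smul_eq_zero]
        rw [lev]
        split_ifs <;> omega
      rw [smul_add, smul_sub] at h4
      rw [h3]
      linear_combination h4
  choose a ha ha' using key
  exact ⟨a, ha, ha'⟩

theorem alpha_act (hc : Nat.Coprime k₀ n₀) (hn : 0 < n₀) (hl : k₀ * l ≡ 1 [MOD n₀])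
    {u : Fin i₀ → Fin j₀ → (t : Fin n₀) → TruncWitt O (lev h t) (PerfAlg.base O)}
    (hu : u ∈ N O n₀ i₀ j₀ h) (x : Z n₀ (i₀ + j₀) h R) :
    alpha ϖ k₀ (act ϖ k₀ l u x) = alpha ϖ k₀ x := by
  obtain ⟨a, ha, ha'⟩ := exists_fixed_paramLift hn hu
  have h1 := isLift_actLift (ϖ := ϖ) (l := l) hc ha (isLift_liftZ x)
  refine Prod.ext ?_ ?_
  · funext ρ p
    change minor ϖ k₀ _ ρ p = minor ϖ k₀ _ ρ p
    rw [h1.minor hc, (isLift_liftZ x).minor hc]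
    have h2 : (fun j => actLift ϖ k₀ l a (liftZ x) (Fin.natAdd i₀ j)) =
        fun j => liftZ x (Fin.natAdd i₀ j) := by
      funext j
      rw [actLift, Fin.addCases_right]
    rw [h2, actLift, Fin.addCases_left, twPoly_add, twPoly_sum]
    have h3 : ∀ j, twPoly ϖ (sigmaAlg h R) k₀ (fun j => liftZ x (Fin.natAdd i₀ j))
        (blockAct ϖ (sigmaAlg h R) k₀ l (fun t => wBase h R (a ρ j t))
          (liftZ x (Fin.natAdd i₀ j))) = 0 := by
      intro j
      rw [twPoly_blockAct ϖ (sigmaAlg h R) k₀ hl fun t => wBase_sigma_pow_fixed (ha' ρ j t)]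
      rw [twPoly_self ϖ (sigmaAlg h R) k₀ (fun j => liftZ x (Fin.natAdd i₀ j)) j,
        blockAct_zero_right]
    simp only [h3, Finset.sum_const_zero, add_zero]
  · funext j
    change act ϖ k₀ l u x (Fin.natAdd i₀ j) = x (Fin.natAdd i₀ j)
    rw [act, Fin.addCases_right]

variable (O) in
theorem finite_fixed_truncWitt (h m : ℕ) (hm : 0 < m) :
    {w : TruncWitt O h (PerfAlg.base O) | sigma^[m] w = w}.Finite := by
  obtain ⟨ϖ, hϖ⟩ := IsDiscreteValuationRing.exists_irreducible O
  have := Fact.mk hϖ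
  have hfin : {t : PerfAlg.base O | t ^ resCard O ^ m = t}.Finite := by
    have hq : 1 < resCard O ^ m := Nat.one_lt_pow hm.ne' (one_lt_resCard O)
    have := Polynomial.finite_setOfPred_isRoot (FiniteField.X_pow_card_sub_X_ne_zero (GeomField O) hq)
    refine this.subset fun t ht => ?_
    change Polynomial.IsRoot _ (t : GeomField O)
    have ht' : (t : GeomField O) ^ resCard O ^ m = t := ht
    simp [Polynomial.IsRoot, ht']
  refine ((Set.Finite.pi' fun _ : Fin h => hfin).image fun t =>
    (∑ k : Fin h, ϖ ^ (k : ℕ) • teich (t k))).subset fun w hw => ?_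
  obtain ⟨t, rfl⟩ := (teich_expansion_bijective ϖ h (PerfAlg.base O)).surjective w
  refine ⟨t, fun k => ?_, rfl⟩
  have h1 : sigma^[m] (∑ k : Fin h, ϖ ^ (k : ℕ) • teich (t k) : TruncWitt O h (PerfAlg.base O)) =
      ∑ k : Fin h, ϖ ^ (k : ℕ) • teich (t k ^ resCard O ^ m) := by
    rw [← coe_sigmaAlg, ← AlgHom.coe_pow, map_sum]
    refine Finset.sum_congr rfl fun k _ => ?_
    rw [AlgHom.coe_pow, coe_sigmaAlg, sigma_iterate_smul, sigma_iterate_teich]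
  have h2 := (teich_expansion_bijective ϖ h (PerfAlg.base O)).injective
    (a₁ := fun k => t k ^ resCard O ^ m) (a₂ := t) (h1.symm.trans hw)
  exact congrFun h2 k

theorem finite_N (hn : 0 < n₀) : Finite (N O n₀ i₀ j₀ h) := by
  refine Set.Finite.subset (Set.Finite.pi' fun _ : Fin i₀ => Set.Finite.pi' fun _ : Fin j₀ =>
    Set.Finite.pi' fun t : Fin n₀ => finite_fixed_truncWitt O (lev h t) n₀ hn) ?_
  exact fun u hu i j t => hu i j t

end Action

/-! ### Moore determinants -/

section Moore

variable {k : Type*} [Field k] (F : k →+* k) {r : ℕ} (y : Fin r → k)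

/-- No nonzero linear form vanishes on all the vectors `(F^ν(y_1), …, F^ν(y_r))`; this is linear
independence of the `y_ρ` over the fixed field of `F`. -/
def MooreIndep {k : Type*} [CommRing k] (F : k →+* k) {r : ℕ} (y : Fin r → k) : Prop :=
  ∀ v : Fin r → k, (∀ ν, ∑ ρ, v ρ * F^[ν] (y ρ) = 0) → v = 0

/-- The Moore matrix. -/
def mooreMat {k : Type*} [CommRing k] (F : k →+* k) {r : ℕ} (y : Fin r → k) :
    Matrix (Fin r) (Fin r) k := Matrix.of fun ρ ν => F^[ν] (y ρ)

theorem exists_mem_span_lt : ∃ d ≤ r, (fun ρ => F^[d] (y ρ)) ∈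
    Submodule.span k ((fun ν ρ => F^[ν] (y ρ)) '' Set.Iio d) := by
  by_contra! hcon
  have key : ∀ d ≤ r + 1, LinearIndependent k fun (i : Fin d) ρ => F^[i] (y ρ) := by
    intro d
    induction d with
    | zero => exact fun _ => linearIndependent_empty_type
    | succ d ih =>
      intro hd
      rw [linearIndependent_finSucc']
      refine ⟨ih (by omega), fun hmem => hcon d (by omega) ?_⟩
      refine Submodule.span_mono ?_ hmem
      rintro _ ⟨i, rfl⟩
      exact ⟨i, i.2, rfl⟩
  have := (key (r + 1) le_rfl).fintype_card_le_finrank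
  simp at this

/-- If the Moore determinant vanishes, the same linear form kills all Frobenius twists, because the
span of the first twists is stable under Frobenius. -/
theorem MooreIndep.det_ne_zero {y : Fin r → k} (hy : MooreIndep F y) : (mooreMat F y).det ≠ 0 := by
  intro h0
  obtain ⟨v, hv, hv0⟩ := Matrix.exists_vecMul_eq_zero_iff.2 h0
  refine hv (hy v ?_)
  obtain ⟨d, hd, hmem⟩ := exists_mem_span_lt F y
  set X : ℕ → Fin r → k := fun ν ρ => F^[ν] (y ρ) with hX
  set V := Submodule.span k (X '' Set.Iio d) with hV
  have hstab : ∀ w ∈ V, (fun ρ => F (w ρ)) ∈ V := by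
    intro w hw
    induction hw using Submodule.span_induction with
    | mem w hw =>
      obtain ⟨ν, hν, rfl⟩ := hw
      have h1 : (fun ρ => F (X ν ρ)) = X (ν + 1) := by
        funext ρ
        exact (Function.iterate_succ_apply' F ν (y ρ)).symm
      rw [h1]
      rcases Nat.lt_or_ge (ν + 1) d with h2 | h2
      · exact Submodule.subset_span ⟨_, h2, rfl⟩
      · have : ν + 1 = d := le_antisymm hν h2
        rw [this]
        exact hmem
    | zero =>
      have : (fun ρ => F ((0 : Fin r → k) ρ)) = 0 := funext fun ρ => map_zero F
      rw [this]
      exact zero_mem _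
    | add a b _ _ ha hb =>
      have : (fun ρ => F ((a + b) ρ)) = (fun ρ => F (a ρ)) + fun ρ => F (b ρ) :=
        funext fun ρ => map_add F _ _
      rw [this]
      exact add_mem ha hb
    | smul c a _ ha =>
      have : (fun ρ => F ((c • a) ρ)) = F c • fun ρ => F (a ρ) := funext fun ρ => map_mul F _ _
      rw [this]
      exact V.smul_mem _ ha
  have hall : ∀ n, X (d + n) ∈ V := by
    intro n
    induction n with
    | zero => exact hmem
    | succ n ih =>
      have h1 : (fun ρ => F (X (d + n) ρ)) = X (d + (n + 1)) := by
        funext ρ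
        exact (Function.iterate_succ_apply' F (d + n) (y ρ)).symm
      rw [← h1]
      exact hstab _ ih
  have hkill : ∀ w ∈ V, ∑ ρ, v ρ * w ρ = 0 := by
    intro w hw
    induction hw using Submodule.span_induction with
    | mem w hw =>
      obtain ⟨ν, hν, rfl⟩ := hw
      exact congrFun hv0 ⟨ν, lt_of_lt_of_le hν hd⟩
    | zero => simp
    | add a b _ _ ha hb => simp only [Pi.add_apply, mul_add, Finset.sum_add_distrib, ha, hb, add_zero]
    | smul c a _ ha =>
      simp only [Pi.smul_apply, smul_eq_mul, mul_left_comm _ c, ← Finset.mul_sum, ha, mul_zero]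
  intro ν
  refine hkill (X ν) ?_
  rcases Nat.lt_or_ge ν d with h2 | h2
  · exact Submodule.subset_span ⟨_, h2, rfl⟩
  · obtain ⟨n, rfl⟩ := Nat.exists_eq_add_of_le h2
    exact hall n

theorem map_iterate_comp (ν : ℕ) (a : k) : F (F^[ν] a) = F^[ν + 1] a :=
  (Function.iterate_succ_apply' F ν a).symm

/-- The kernel of an additive polynomial with unit leading coefficient which kills the `y_ρ` is the
span of the `y_ρ` over the fixed field of Frobenius. -/
theorem MooreIndep.exists_eq_sum {y : Fin r → k} (hy : MooreIndep F y) {c : ℕ → k} (hc : c r ≠ 0)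
    (hcy : ∀ ρ, ∑ ν ∈ Finset.range (r + 1), c ν * F^[ν] (y ρ) = 0) {τ : k}
    (hτ : ∑ ν ∈ Finset.range (r + 1), c ν * F^[ν] τ = 0) :
    ∃ a : Fin r → k, (∀ ρ, F (a ρ) = a ρ) ∧ τ = ∑ ρ, a ρ * y ρ := by
  have hdet := hy.det_ne_zero
  have hunit : IsUnit (mooreMat F y).det := isUnit_iff_ne_zero.2 hdet
  set M := mooreMat F y with hM
  let a : Fin r → k := Matrix.vecMul (fun ν : Fin r => F^[ν] τ) M⁻¹
  have ha : Matrix.vecMul a M = fun ν : Fin r => F^[ν] τ := by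
    rw [Matrix.vecMul_vecMul, Matrix.nonsing_inv_mul _ hunit, Matrix.vecMul_one]
  have h1 : ∀ ν < r, ∑ ρ, a ρ * F^[ν] (y ρ) = F^[ν] τ := fun ν hν => congrFun ha ⟨ν, hν⟩
  have h2 : ∑ ρ, a ρ * F^[r] (y ρ) = F^[r] τ := by
    have h3 : ∑ ν ∈ Finset.range (r + 1), c ν * ∑ ρ, a ρ * F^[ν] (y ρ) = 0 := by
      simp only [Finset.mul_sum]
      rw [Finset.sum_comm]
      refine Finset.sum_eq_zero fun ρ _ => ?_
      simp only [mul_left_comm _ (a ρ), ← Finset.mul_sum, hcy ρ, mul_zero]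
    rw [Finset.sum_range_succ] at h3 hτ
    rw [Finset.sum_congr rfl fun ν hν => by rw [h1 ν (Finset.mem_range.1 hν)], ← hτ,
      add_right_inj] at h3
    exact mul_left_cancel₀ hc h3
  have h3 : ∀ ν ≤ r, ∑ ρ, a ρ * F^[ν] (y ρ) = F^[ν] τ := fun ν hν => by
    rcases hν.lt_or_eq with h | rfl
    · exact h1 ν h
    · exact h2
  refine ⟨a, fun ρ => ?_, (h3 0 (Nat.zero_le _)).symm⟩
  have h4 : Matrix.vecMul (fun ρ => F (a ρ) - a ρ) (M.map F) = 0 := by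
    funext ν
    change ∑ ρ, (F (a ρ) - a ρ) * F (F^[ν] (y ρ)) = 0
    simp only [sub_mul, Finset.sum_sub_distrib]
    have h5 := congrArg F (h1 ν ν.2)
    simp only [map_sum, map_mul, map_iterate_comp] at h5
    simp only [map_iterate_comp]
    rw [h5, h3 (ν + 1) ν.2, sub_self]
  have h5 : (M.map F).det ≠ 0 := by
    have := RingHom.map_det F M
    rw [RingHom.mapMatrix_apply] at this
    rw [← this]
    exact (map_ne_zero F).2 hdet
  exact sub_eq_zero.1 (congrFun (Matrix.eq_zero_of_vecMul_eq_zero h5 h4) ρ)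

theorem MooreIndep.coeff_zero_ne_zero {y : Fin r → k} (hy : MooreIndep F y) {c : ℕ → k}
    (hc : c r ≠ 0) (hcy : ∀ ρ, ∑ ν ∈ Finset.range (r + 1), c ν * F^[ν] (y ρ) = 0) : c 0 ≠ 0 := by
  intro h0
  have h5 : ((mooreMat F y).map F).det ≠ 0 := by
    have := RingHom.map_det F (mooreMat F y)
    rw [RingHom.mapMatrix_apply] at this
    rw [← this]
    exact (map_ne_zero F).2 hy.det_ne_zero
  have h4 : Matrix.mulVec ((mooreMat F y).map F) (fun ν : Fin r => c (ν + 1)) = 0 := by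
    funext ρ
    change ∑ ν : Fin r, F (F^[ν] (y ρ)) * c (ν + 1) = 0
    have h6 := hcy ρ
    rw [Finset.sum_range_succ', h0, zero_mul, add_zero, Finset.sum_range] at h6
    rw [← h6]
    exact Finset.sum_congr rfl fun ν _ => by rw [map_iterate_comp, mul_comm]
  have h6 := Matrix.eq_zero_of_mulVec_eq_zero h5 h4
  rcases Nat.eq_zero_or_pos r with rfl | hr
  · exact hc h0
  · have := congrFun h6 ⟨r - 1, by omega⟩
    simp only [Pi.zero_apply, Nat.sub_add_cancel hr] at this
    exact hc this

end Moore

/-! ### Residues of the matrices `g(x)` -/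

theorem piL_pow_apply_self {O : Type*} [CommRing O] (ϖ : O) {W : Type*} [CommRing W] [Algebra O W]
    {n₀ : ℕ} (a' : Fin n₀) (v : Fin n₀ → W) :
    (piL ϖ ^ (a' : ℕ)) v a' = v ⟨0, a'.pos⟩ := by
  rw [piL_pow_apply', Finset.sum_eq_single (⟨0, a'.pos⟩ : Fin n₀)]
  · simp [Nat.mod_eq_of_lt a'.2, Nat.div_eq_of_lt a'.2]
  · intro a _ ha
    rw [if_neg]
    have h0 : (a : ℕ) ≠ 0 := fun h => ha (Fin.ext h)
    have h1 := a.2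
    have h2 := a'.2
    rcases Nat.lt_or_ge ((a : ℕ) + a') n₀ with h3 | h3
    · rw [Nat.mod_eq_of_lt h3]
      omega
    · rw [Nat.mod_eq_sub_mod h3, Nat.mod_eq_of_lt (by omega)]
      omega
  · exact fun h => absurd (Finset.mem_univ _) h

theorem mul_mod_eq_zero_iff {n₀ k₀ j : ℕ} (hc : Nat.Coprime k₀ n₀) :
    k₀ * j % n₀ = 0 ↔ n₀ ∣ j :=
  ⟨fun h => Nat.Coprime.dvd_of_dvd_mul_left hc.symm (Nat.dvd_of_mod_eq_zero h),
    fun h => Nat.mod_eq_zero_of_dvd (h.mul_left _)⟩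

theorem exists_mul_mod_eq {n₀ k₀ : ℕ} (hc : Nat.Coprime k₀ n₀) (a : Fin n₀) :
    ∃ t : Fin n₀, k₀ * t % n₀ = a := by
  let f : Fin n₀ → Fin n₀ := fun t => ⟨k₀ * t % n₀, Nat.mod_lt _ a.pos⟩
  have hf : Function.Injective f := by
    intro b d hbd
    have h1 : k₀ * b ≡ k₀ * d [MOD n₀] := congrArg Fin.val hbd
    have h2 := Nat.ModEq.cancel_left_of_coprime (by rw [Nat.gcd_comm]; exact hc) h1
    exact Fin.ext (Nat.ModEq.eq_of_lt_of_lt h2 b.2 d.2)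
  obtain ⟨t, ht⟩ := (Finite.injective_iff_surjective.1 hf) a
  exact ⟨t, congrArg Fin.val ht⟩

section Residues

variable {O : Type u} [CommRing O] [IsDomain O] [IsDiscreteValuationRing O]
  [Finite (IsLocalRing.ResidueField O)] {ϖ : O} [hϖ : Fact (Irreducible ϖ)] {h : ℕ} [NeZero h]
  {R S : PerfAlg O} {n₀ k₀ : ℕ}

/-- The Frobenius `a ↦ a ^ (q ^ n)` as a ring homomorphism. -/
noncomputable def frobPow (R : PerfAlg O) (n : ℕ) : R →+* R :=
  ((frob R ^ n : R →ₐ[O] R) : R →+* R)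

theorem frobPow_apply (n : ℕ) (a : R) : frobPow R n a = a ^ resCard O ^ n := by
  change (frob R ^ n) a = _
  rw [AlgHom.coe_pow, frob_iterate_apply]

theorem frobPow_iterate (n ν : ℕ) (a : R) : (frobPow R n)^[ν] a = a ^ resCard O ^ (n * ν) := by
  induction ν with
  | zero => simp
  | succ ν ih =>
    rw [Function.iterate_succ_apply', ih, frobPow_apply, ← pow_mul, ← pow_add, Nat.mul_succ]

theorem res_Phi_eq_zero {j : ℕ} {a' : Fin n₀} (ha : (a' : ℕ) < k₀ * j % n₀)
    (v : Fin n₀ → TruncWitt O h R) : res (Phi ϖ (sigmaAlg h R) k₀ j v a') = 0 := by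
  obtain ⟨c, hc⟩ := exists_Phi_apply_eq_smul (ϖ := ϖ) (σ := sigmaAlg h R) ha v
  rw [hc, res_uniformizer_smul]

theorem res_Phi_eq {j : ℕ} {a' : Fin n₀} (ha : k₀ * j % n₀ = a')
    (v : Fin n₀ → TruncWitt O h R) :
    res (Phi ϖ (sigmaAlg h R) k₀ j v a') = res (v ⟨0, a'.pos⟩) ^ resCard O ^ j := by
  rw [Phi_eq, ha, piL_pow_apply_self, AlgHom.coe_pow, coe_sigmaAlg, res_sigma_iterate]

theorem res_Phi_zero (hc : Nat.Coprime k₀ n₀) (hn : 0 < n₀) (j : ℕ)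
    (v : Fin n₀ → TruncWitt O h R) :
    res (Phi ϖ (sigmaAlg h R) k₀ j v ⟨0, hn⟩) =
      if n₀ ∣ j then res (v ⟨0, hn⟩) ^ resCard O ^ j else 0 := by
  split_ifs with hj
  · exact res_Phi_eq ((mul_mod_eq_zero_iff hc).2 hj) v
  · exact res_Phi_eq_zero (Nat.pos_of_ne_zero fun h0 => hj ((mul_mod_eq_zero_iff hc).1 h0)) v

/-- Modulo `Π` the twisted polynomial becomes an additive polynomial in `x ↦ x ^ (q ^ n₀)`. -/
theorem res_twPoly (hc : Nat.Coprime k₀ n₀) (hn : 0 < n₀) {j₀ : ℕ}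
    (y : Fin j₀ → Fin n₀ → TruncWitt O h R) (v : Fin n₀ → TruncWitt O h R) :
    res (twPoly ϖ (sigmaAlg h R) k₀ y v ⟨0, hn⟩) = ∑ ν ∈ Finset.range (j₀ + 1),
      res (cof ϖ (sigmaAlg h R) k₀ y (n₀ * ν)) * (frobPow R n₀)^[ν] (res (v ⟨0, hn⟩)) := by
  rw [twPoly, Finset.sum_apply, map_sum]
  have h1 : ∀ t, res ((cof ϖ (sigmaAlg h R) k₀ y t • Phi ϖ (sigmaAlg h R) k₀ t v) ⟨0, hn⟩) =
      res (cof ϖ (sigmaAlg h R) k₀ y t) *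
        if n₀ ∣ t then res (v ⟨0, hn⟩) ^ resCard O ^ t else 0 := by
    intro t
    rw [Pi.smul_apply, smul_eq_mul, map_mul, res_Phi_zero hc hn]
  simp only [h1, frobPow_iterate]
  have himg : (Finset.range (j₀ + 1)).image (fun ν => n₀ * ν) ⊆ Finset.range (j₀ * n₀ + 1) := by
    intro t ht
    obtain ⟨ν, hν, rfl⟩ := Finset.mem_image.1 ht
    rw [Finset.mem_range] at hν ⊢
    have : n₀ * ν ≤ n₀ * j₀ := Nat.mul_le_mul_left _ (by omega)
    rw [mul_comm j₀]
    omega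
  rw [← Finset.sum_subset himg, Finset.sum_image]
  · refine Finset.sum_congr rfl fun ν _ => ?_
    rw [if_pos (dvd_mul_right _ _)]
  · intro a _ b _ hab
    exact Nat.eq_of_mul_eq_mul_left hn hab
  · intro t ht htn
    rw [if_neg, mul_zero]
    rintro ⟨ν, rfl⟩
    refine htn (Finset.mem_image.2 ⟨ν, ?_, rfl⟩)
    rw [Finset.mem_range] at ht ⊢
    have : n₀ * ν ≤ n₀ * j₀ := by rw [mul_comm n₀ j₀]; omega
    have := Nat.le_of_mul_le_mul_left this hn
    omega

theorem res_det_gMat {r : ℕ} (x : Fin r → Fin n₀ → TruncWitt O h R) :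
    res (gMat ϖ (sigmaAlg h R) k₀ x).det =
      (Matrix.of fun i j : Fin (r * n₀) => res (gMat ϖ (sigmaAlg h R) k₀ x i j)).det := by
  rw [RingHom.map_det]
  rfl

/-- If `|g(x)|` is invertible then the residues of the leading coordinates are independent. -/
theorem mooreIndep_of_isUnit (hc : Nat.Coprime k₀ n₀) (hn : 0 < n₀) {r : ℕ}
    {x : Fin r → Fin n₀ → TruncWitt O h R} (hx : IsUnit (gMat ϖ (sigmaAlg h R) k₀ x).det) :
    MooreIndep (frobPow R n₀) fun ρ => res (x ρ ⟨0, hn⟩) := by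
  intro v hv
  have hu := hx.map (res : TruncWitt O h R →+* R)
  rw [res_det_gMat] at hu
  set M := Matrix.of fun i j : Fin (r * n₀) => res (gMat ϖ (sigmaAlg h R) k₀ x i j) with hM
  let w : Fin (r * n₀) → R := fun i =>
    if ((finProdFinEquiv.symm i).2 : ℕ) = 0 then v (finProdFinEquiv.symm i).1 else 0
  have hw : Matrix.vecMul w M = 0 := by
    funext j
    change ∑ i, w i * res (Phi ϖ (sigmaAlg h R) k₀ j (x (finProdFinEquiv.symm i).1)
      (finProdFinEquiv.symm i).2) = 0
    rw [← Equiv.sum_comp finProdFinEquiv, Fintype.sum_prod_type]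
    simp only [w, Equiv.symm_apply_apply]
    have h1 : ∀ ρ : Fin r, ∑ a : Fin n₀, (if (a : ℕ) = 0 then v ρ else 0) *
        res (Phi ϖ (sigmaAlg h R) k₀ j (x ρ) a) =
        v ρ * if n₀ ∣ (j : ℕ) then res (x ρ ⟨0, hn⟩) ^ resCard O ^ (j : ℕ) else 0 := by
      intro ρ
      rw [Finset.sum_eq_single (⟨0, hn⟩ : Fin n₀)]
      · rw [if_pos rfl, res_Phi_zero hc hn]
      · intro a _ ha
        rw [if_neg fun h0 => ha (Fin.ext h0), zero_mul]
      · exact fun h => absurd (Finset.mem_univ _) h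
    simp only [h1]
    split_ifs with hj
    · obtain ⟨ν, hν⟩ := hj
      have := hv ν
      simp only [frobPow_iterate] at this
      rw [hν]
      exact this
    · simp
  have hw0 : w = 0 := by
    have h2 := congrArg (fun z => Matrix.vecMul z M⁻¹) hw
    simp only [Matrix.vecMul_vecMul, Matrix.mul_nonsing_inv _ hu, Matrix.vecMul_one,
      Matrix.zero_vecMul] at h2
    exact h2
  funext ρ
  have := congrFun hw0 (finProdFinEquiv (ρ, ⟨0, hn⟩))
  simp only [w, Equiv.symm_apply_apply, if_true] at this
  exact this

theorem MooreIndep.det_ne_zero' {k : Type*} [CommRing k] (hk : IsField k) {F : k →+* k} {r : ℕ}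
    {y : Fin r → k} (hy : MooreIndep F y) : (mooreMat F y).det ≠ 0 := by
  let _ := hk.toField
  exact MooreIndep.det_ne_zero F hy

theorem exists_vecMul_eq_zero' {k : Type*} [CommRing k] (hk : IsField k) {ι : Type*} [Fintype ι]
    [DecidableEq ι] {M : Matrix ι ι k} : (∃ v ≠ 0, Matrix.vecMul v M = 0) ↔ M.det = 0 := by
  let _ := hk.toField
  exact Matrix.exists_vecMul_eq_zero_iff

/-- Over a field the converse holds: modulo `ϖ` the matrix `g(x)` is block triangular for the
types of its rows and columns, and the diagonal blocks are twists of the Moore matrix. -/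
theorem isUnit_of_mooreIndep (hR : IsField R) (hc : Nat.Coprime k₀ n₀) (hn : 0 < n₀) {r : ℕ}
    {x : Fin r → Fin n₀ → TruncWitt O h R}
    (hx : MooreIndep (frobPow R n₀) fun ρ => res (x ρ ⟨0, hn⟩)) :
    IsUnit (gMat ϖ (sigmaAlg h R) k₀ x).det := by
  have hdet := hx.det_ne_zero' hR
  have := hR.isDomain
  rw [isUnit_iff_res, res_det_gMat]
  set M := Matrix.of fun i j : Fin (r * n₀) => res (gMat ϖ (sigmaAlg h R) k₀ x i j) with hM
  suffices hne : M.det ≠ 0 by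
    obtain ⟨b, hb⟩ := hR.mul_inv_cancel hne
    exact IsUnit.of_mul_eq_one _ hb
  intro h0
  obtain ⟨w, hw, hw0⟩ := (exists_vecMul_eq_zero' hR).2 h0
  refine hw ?_
  -- The rows of type `a` are treated by descending induction on `a`: in the columns of type `a` the
  -- rows of smaller type vanish, and the coefficients of those of larger type are known to be zero.
  have key : ∀ m : ℕ, ∀ a : Fin n₀, n₀ - a ≤ m → ∀ ρ : Fin r, w (finProdFinEquiv (ρ, a)) = 0 := by
    intro m
    induction m with
    | zero => exact fun a ha => absurd a.2 (by omega)
    | succ m ih =>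
      intro a ha
      obtain ⟨t, ht⟩ := exists_mul_mod_eq hc a
      have hcol : ∀ ν : Fin r, ∑ ρ, w (finProdFinEquiv (ρ, a)) *
          frobPow R t ((frobPow R n₀)^[ν] (res (x ρ ⟨0, hn⟩))) = 0 := by
        intro ν
        have hlt : (t : ℕ) + n₀ * ν < r * n₀ := by
          have h1 := t.2
          have h2 : n₀ * (ν + 1) ≤ n₀ * r := Nat.mul_le_mul_left _ ν.2
          rw [mul_comm r]
          rw [Nat.mul_succ] at h2
          omega
        have htype : k₀ * (t + n₀ * ν) % n₀ = a := by
          rw [← ht, mul_add, Nat.mul_left_comm, Nat.add_mul_mod_self_left]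
        have h1 := congrFun hw0 ⟨t + n₀ * ν, hlt⟩
        change ∑ i, w i * res (Phi ϖ (sigmaAlg h R) k₀ (t + n₀ * ν) (x (finProdFinEquiv.symm i).1)
          (finProdFinEquiv.symm i).2) = 0 at h1
        rw [← Equiv.sum_comp finProdFinEquiv, Fintype.sum_prod_type] at h1
        simp only [Equiv.symm_apply_apply] at h1
        rw [← h1]
        refine Finset.sum_congr rfl fun ρ _ => ?_
        rw [Finset.sum_eq_single a, res_Phi_eq htype, frobPow_apply, frobPow_iterate, ← pow_mul,
          ← pow_add, add_comm]
        · intro b _ hb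
          rcases lt_or_gt_of_ne hb with hlt' | hgt
          · rw [res_Phi_eq_zero (by rw [htype]; exact hlt'), mul_zero]
          · have : (a : ℕ) < b := hgt
            rw [ih b (by omega) ρ, zero_mul]
        · exact fun h => absurd (Finset.mem_univ _) h
      have h5 : ((mooreMat (frobPow R n₀) fun ρ => res (x ρ ⟨0, hn⟩)).map (frobPow R t)).det ≠ 0 := by
        have h6 := RingHom.map_det (frobPow R t) (mooreMat (frobPow R n₀) fun ρ => res (x ρ ⟨0, hn⟩))
        rw [RingHom.mapMatrix_apply] at h6
        rw [← h6, frobPow_apply]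
        exact pow_ne_zero _ hdet
      have h7 := Matrix.eq_zero_of_vecMul_eq_zero h5
        (v := fun ρ => w (finProdFinEquiv (ρ, a))) (funext hcol)
      exact fun ρ => congrFun h7 ρ
  funext i
  obtain ⟨⟨ρ, a⟩, rfl⟩ := finProdFinEquiv.surjective i
  exact key _ a le_rfl ρ

end Residues

/-! ### Quotients and algebraically closed fields -/

section PerfAlgConstructions

variable {O : Type u} [CommRing O] [IsLocalRing O] [Finite (IsLocalRing.ResidueField O)]

/-- The quotient of a perfect algebra by a radical ideal. -/
noncomputable def PerfAlg.quot (R : PerfAlg O) (I : Ideal R) (hI : I.IsRadical) : PerfAlg O where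
  carrier := R ⧸ I
  perfect := by
    have hp := (resCard_eq_pow O).1
    constructor
    · intro a b hab
      obtain ⟨a, rfl⟩ := Ideal.Quotient.mk_surjective a
      obtain ⟨b, rfl⟩ := Ideal.Quotient.mk_surjective b
      rw [Ideal.Quotient.eq]
      refine hI ⟨ringChar (GeomField O), ?_⟩
      have h1 : a ^ ringChar (GeomField O) =
          (a - b) ^ ringChar (GeomField O) + b ^ ringChar (GeomField O) := by
        have := R.add_pow_ringChar 1 (a - b) b
        simpa using this
      have h2 : (Ideal.Quotient.mk I a) ^ ringChar (GeomField O) =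
        (Ideal.Quotient.mk I b) ^ ringChar (GeomField O) := hab
      rw [← map_pow, ← map_pow, Ideal.Quotient.eq, h1, add_sub_cancel_right] at h2
      exact h2
    · intro a
      obtain ⟨a, rfl⟩ := Ideal.Quotient.mk_surjective a
      obtain ⟨b, rfl⟩ := R.perfect.surjective a
      exact ⟨Ideal.Quotient.mk I b, (map_pow _ _ _).symm⟩

/-- The quotient map. -/
noncomputable def PerfAlg.quotMk (R : PerfAlg O) (I : Ideal R) (hI : I.IsRadical) :
    R →ₐ[GeomField O] R.quot I hI := Ideal.Quotient.mkₐ (GeomField O) I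

theorem PerfAlg.quotMk_eq_zero_iff (R : PerfAlg O) (I : Ideal R) (hI : I.IsRadical) (a : R) :
    R.quotMk I hI a = 0 ↔ a ∈ I := Ideal.Quotient.eq_zero_iff_mem

/-- An algebraically closed extension of `\overline{𝔽}_q` as a perfect algebra. -/
noncomputable def PerfAlg.ofIsAlgClosed (k : Type u) [Field k] [IsAlgClosed k] [Algebra (GeomField O) k] :
    PerfAlg O where
  carrier := k
  perfect := by
    have hp := (resCard_eq_pow O).1
    have := ringChar.charP (GeomField O)
    have : CharP k (ringChar (GeomField O)) :=
      charP_of_injective_algebraMap (algebraMap (GeomField O) k).injective _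
    have : ExpChar k (ringChar (GeomField O)) := ExpChar.prime hp
    exact bijective_frobenius k (ringChar (GeomField O))

/-- An algebraically closed field, as a property of the underlying ring of a perfect algebra. -/
structure PerfAlg.IsGeom (k : PerfAlg O) : Prop where
  isField : IsField k
  exists_root : ∀ p : Polynomial k, p.Monic → p.natDegree ≠ 0 → ∃ c, p.eval c = 0

theorem PerfAlg.isGeom_ofIsAlgClosed (k : Type u) [Field k] [IsAlgClosed k]
    [Algebra (GeomField O) k] : (PerfAlg.ofIsAlgClosed (O := O) k).IsGeom where
  isField := Field.toIsField k
  exists_root := fun p _ hd => by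
    let p' : Polynomial k := p
    have hd' : p'.natDegree ≠ 0 := hd
    exact IsAlgClosed.exists_root p' (Polynomial.degree_ne_of_natDegree_ne (n := 0) hd')

/-- Every prime ideal of an algebra over `\overline{𝔽}_q` is the kernel of a geometric point. -/
theorem exists_geomPoint (E : Type u) [CommRing E] [Algebra (GeomField O) E] (P : Ideal E)
    [P.IsPrime] : ∃ k : PerfAlg O, k.IsGeom ∧
      ∃ f : E →ₐ[GeomField O] k, ∀ e, f e = 0 ↔ e ∈ P := by
  let k := AlgebraicClosure (FractionRing (E ⧸ P))
  let f : E →ₐ[GeomField O] k :=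
    (IsScalarTower.toAlgHom (GeomField O) (E ⧸ P) k).comp (Ideal.Quotient.mkₐ (GeomField O) P)
  refine ⟨PerfAlg.ofIsAlgClosed k, PerfAlg.isGeom_ofIsAlgClosed k, f, fun e => ?_⟩
  have h1 : f e = algebraMap (E ⧸ P) k (Ideal.Quotient.mk P e) := rfl
  have h2 : Function.Injective (algebraMap (E ⧸ P) k) := by
    rw [IsScalarTower.algebraMap_eq (E ⧸ P) (FractionRing (E ⧸ P)) k]
    exact (algebraMap (FractionRing (E ⧸ P)) k).injective.comp (IsFractionRing.injective _ _)
  change f e = 0 ↔ _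
  rw [h1, map_eq_zero_iff _ h2, Ideal.Quotient.eq_zero_iff_mem]

/-- An element of an algebra is nilpotent if it vanishes at all geometric points. -/
theorem isNilpotent_of_geomPoint {E : Type u} [CommRing E] [Algebra (GeomField O) E] {e : E}
    (he : ∀ k : PerfAlg O, k.IsGeom → ∀ f : E →ₐ[GeomField O] k, f e = 0) : IsNilpotent e := by
  rw [← mem_nilradical, nilradical_eq_sInf, Ideal.mem_sInf]
  intro P hP
  have : P.IsPrime := hP
  obtain ⟨k, hk, f, hf⟩ := exists_geomPoint (O := O) E P
  exact (hf e).1 (he k hk f)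

theorem PerfAlg.isUnit_of_geomPoint {R : PerfAlg O} {a : R}
    (ha : ∀ k : PerfAlg O, k.IsGeom → ∀ f : R →ₐ[GeomField O] k, f a ≠ 0) : IsUnit a := by
  by_contra hcon
  obtain ⟨P, hP, haP⟩ := exists_max_ideal_of_mem_nonunits hcon
  have := hP.isPrime
  obtain ⟨k, hk, f, hf⟩ := exists_geomPoint (O := O) R P
  exact ha k hk f ((hf a).2 haP)

theorem PerfAlg.IsGeom.nontrivial {k : PerfAlg O} (hk : k.IsGeom) : Nontrivial k :=
  hk.isField.nontrivial

end PerfAlgConstructions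

section SubBlocks

variable {O : Type u} [CommRing O] [IsDomain O] [IsDiscreteValuationRing O]
  [Finite (IsLocalRing.ResidueField O)] {ϖ : O} [hϖ : Fact (Irreducible ϖ)] {h : ℕ} [NeZero h]
  {R S : PerfAlg O} {n₀ k₀ : ℕ}

theorem MooreIndep.natAdd {k : Type*} [CommRing k] {F : k →+* k} {i₀ j₀ : ℕ}
    {y : Fin (i₀ + j₀) → k} (hy : MooreIndep F y) : MooreIndep F fun j => y (Fin.natAdd i₀ j) := by
  intro v hv
  have h1 := hy (Fin.addCases (fun _ => 0) v) fun ν => by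
    rw [Fin.sum_univ_add]
    simp only [Fin.addCases_left, Fin.addCases_right, zero_mul, Finset.sum_const_zero, zero_add]
    exact hv ν
  funext j
  have := congrFun h1 (Fin.natAdd i₀ j)
  simpa only [Fin.addCases_right, Pi.zero_apply] using this

/-- If `|g(x)|` is invertible, so is `|g(x')|`. -/
theorem isUnit_det_natAdd (hc : Nat.Coprime k₀ n₀) (hn : 0 < n₀) {i₀ j₀ : ℕ}
    {x : Fin (i₀ + j₀) → Fin n₀ → TruncWitt O h R} (hx : IsUnit (gMat ϖ (sigmaAlg h R) k₀ x).det) :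
    IsUnit (gMat ϖ (sigmaAlg h R) k₀ fun j => x (Fin.natAdd i₀ j)).det := by
  rw [isUnit_iff_res]
  refine PerfAlg.isUnit_of_geomPoint fun k hk f => ?_
  have := hk.nontrivial
  rw [← res_wMap, ← wMapAlg_apply, map_det_gMat (wMapAlg h f) (wMapAlg_sigmaAlg f)]
  have h1 := hx.map (wMapAlg h f)
  rw [map_det_gMat (wMapAlg h f) (wMapAlg_sigmaAlg f)] at h1
  have h2 := isUnit_of_mooreIndep (ϖ := ϖ) (h := h) hk.isField hc hn
    (x := fun j a => wMapAlg h f (x (Fin.natAdd i₀ j) a)) (mooreIndep_of_isUnit hc hn h1).natAdd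
  exact (isUnit_iff_res.1 h2).ne_zero

end SubBlocks

/-! ### The source as the preimage of the target -/

theorem isUnit_and_fixed_iff {W : Type*} [CommRing W] (s : W →+* W) {D M T P E : W}
    (hT : IsUnit T) (hP : IsUnit P) (hE : E * E = 1) (hsE : s E = E)
    (h : D * (T * P) = E * (M * T)) :
    (IsUnit D ∧ s D = D) ↔ IsUnit M ∧ ∃ c, (IsUnit c ∧ s c = c) ∧ M = c * P := by
  have h1 : D * P = E * M := by
    refine hT.mul_right_cancel ?_
    rw [mul_assoc, mul_comm P, h, mul_assoc]
  have hEu : IsUnit E := IsUnit.of_mul_eq_one _ hE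
  have h2 : M = E * D * P := by rw [mul_assoc, h1, ← mul_assoc, hE, one_mul]
  constructor
  · rintro ⟨hD, hsD⟩
    refine ⟨?_, E * D, ⟨hEu.mul hD, by rw [map_mul, hsE, hsD]⟩, h2⟩
    rw [h2]
    exact (hEu.mul hD).mul hP
  · rintro ⟨-, c, ⟨hc, hsc⟩, hM⟩
    have h3 : D = E * c := by
      refine hP.mul_right_cancel ?_
      rw [h1, hM, mul_assoc]
    rw [h3]
    exact ⟨hEu.mul hc, by rw [map_mul, hsE, hsc]⟩

section Fibres

variable {O : Type u} [CommRing O] [IsDomain O] [IsDiscreteValuationRing O]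
  [Finite (IsLocalRing.ResidueField O)] {ϖ : O} [hϖ : Fact (Irreducible ϖ)] {h : ℕ} [NeZero h]
  {R S : PerfAlg O} {n₀ k₀ l i₀ j₀ : ℕ}

theorem isLift_alpha_fst (hc : Nat.Coprime k₀ n₀) {x' : Fin (i₀ + j₀) → Fin n₀ → TruncWitt O h R}
    {x : Z n₀ (i₀ + j₀) h R} (hx : IsLift x' x) :
    IsLift (fun i => twPoly ϖ (sigmaAlg h R) k₀ (fun j => x' (Fin.natAdd i₀ j))
      (x' (Fin.castAdd j₀ i))) (alpha ϖ k₀ x).1 :=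
  fun ρ a => (hx.minor hc ρ a).symm

theorem isLift_alpha_snd {x' : Fin (i₀ + j₀) → Fin n₀ → TruncWitt O h R}
    {x : Z n₀ (i₀ + j₀) h R} (hx : IsLift x' x) :
    IsLift (fun j => x' (Fin.natAdd i₀ j)) (alpha ϖ k₀ x).2 :=
  fun _ a => hx _ a

/-- The product formula for `|g(x)|` shows that `X_h` is the preimage of the target. -/
theorem mem_X_iff (hc : Nat.Coprime k₀ n₀) (hn : 0 < n₀) (hi₀ : 0 < i₀)
    (x : Z n₀ (i₀ + j₀) h R) :
    x ∈ X n₀ (i₀ + j₀) h R ϖ k₀ ↔ alpha ϖ k₀ x ∈ Target n₀ i₀ j₀ h R ϖ k₀ := by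
  have hx := isLift_liftZ x
  have e1 := hx.detG (ϖ := ϖ) hc
  have e2 := (isLift_alpha_fst (ϖ := ϖ) hc hx).detG (ϖ := ϖ) hc
  have e3 := (isLift_alpha_snd (ϖ := ϖ) (k₀ := k₀) hx).detG (ϖ := ϖ) hc
  obtain ⟨ε, hε⟩ := det_gMat_mul_prod ϖ (sigmaAlg h R) k₀ (liftZ x)
  rw [← e1, ← e2, ← e3] at hε
  have hT : x ∈ X n₀ (i₀ + j₀) h R ϖ k₀ → IsUnit (detG ϖ k₀ (alpha ϖ k₀ x).2) := by
    intro hX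
    have h1 : IsUnit (detG ϖ k₀ x) := hX.1
    rw [e1] at h1
    have h2 := isUnit_det_natAdd hc hn h1
    rw [e3]
    exact h2
  have hprod : ∏ j ∈ Finset.range (i₀ * n₀), (sigmaAlg h R ^ j) (detG ϖ k₀ (alpha ϖ k₀ x).2) =
      detG ϖ k₀ (alpha ϖ k₀ x).2 *
        ∏ j ∈ Finset.Icc 1 (n₀ * i₀ - 1), sigma^[j] (detG ϖ k₀ (alpha ϖ k₀ x).2) := by
    obtain ⟨s, hs⟩ : ∃ s, i₀ * n₀ = s + 1 :=
      Nat.exists_eq_succ_of_ne_zero (Nat.mul_pos hi₀ hn).ne'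
    rw [mul_comm n₀, hs, Nat.add_sub_cancel, Finset.range_eq_Ico, Finset.prod_eq_prod_Ico_succ_bot
      (Nat.succ_pos s)]
    simp only [AlgHom.coe_pow, coe_sigmaAlg]
    rfl
  rw [hprod] at hε
  have hP : IsUnit (detG ϖ k₀ (alpha ϖ k₀ x).2) →
      IsUnit (∏ j ∈ Finset.Icc 1 (n₀ * i₀ - 1), sigma^[j] (detG ϖ k₀ (alpha ϖ k₀ x).2)) := by
    intro hu
    refine IsUnit.prod_iff.2 fun j _ => ?_
    have h1 := hu.map (sigmaAlg h R ^ j)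
    rw [AlgHom.coe_pow, coe_sigmaAlg] at h1
    exact h1
  have hE : ((ε : ℤ) : TruncWitt O h R) * ((ε : ℤ) : TruncWitt O h R) = 1 := by
    rw [← Int.cast_mul, ← Units.val_mul, Int.units_mul_self, Units.val_one, Int.cast_one]
  have key : IsUnit (detG ϖ k₀ (alpha ϖ k₀ x).2) → _ := fun hu =>
    isUnit_and_fixed_iff (sigma (h := h) (R := R)) hu (hP hu) hE (map_intCast _ _) hε
  constructor
  · intro hX
    have h1 := (key (hT hX)).1 hX
    exact ⟨h1.1, hT hX, h1.2⟩
  · rintro ⟨h1, h2, h3⟩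
    exact (key h2).2 ⟨h1, h3⟩

theorem isFqUnit_wMap (f : R →ₐ[GeomField O] S) {w : TruncWitt O h R} (hw : IsFqUnit w) :
    IsFqUnit (wMapAlg h f w) := by
  refine ⟨hw.1.map _, ?_⟩
  have h1 := wMapAlg_sigmaAlg f w
  rw [coe_sigmaAlg, coe_sigmaAlg, hw.2] at h1
  exact h1.symm

theorem zMap_mem_X (hc : Nat.Coprime k₀ n₀) {r : ℕ} (f : R →ₐ[GeomField O] S) {x : Z n₀ r h R}
    (hx : x ∈ X n₀ r h R ϖ k₀) : zMap f x ∈ X n₀ r h S ϖ k₀ := by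
  change IsFqUnit _
  rw [detG_zMap hc]
  exact isFqUnit_wMap f hx

theorem map_mem_Target (hc : Nat.Coprime k₀ n₀) (f : R →ₐ[GeomField O] S)
    {y : Z n₀ i₀ h R × Z n₀ j₀ h R} (hy : y ∈ Target n₀ i₀ j₀ h R ϖ k₀) :
    Prod.map (zMap f) (zMap f) y ∈ Target n₀ i₀ j₀ h S ϖ k₀ := by
  obtain ⟨h1, h2, c, h3, h4⟩ := hy
  have e1 := detG_zMap (ϖ := ϖ) hc f y.1
  have e2 := detG_zMap (ϖ := ϖ) hc f y.2
  refine ⟨?_, ?_, wMapAlg h f c, isFqUnit_wMap f h3, ?_⟩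
  · change IsUnit (detG ϖ k₀ (zMap f y.1))
    rw [e1]
    exact IsUnit.map _ h1
  · change IsUnit (detG ϖ k₀ (zMap f y.2))
    rw [e2]
    exact IsUnit.map _ h2
  · change detG ϖ k₀ (zMap f y.1) = _ * ∏ j ∈ _, sigma^[j] (detG ϖ k₀ (zMap f y.2))
    rw [e1, e2, h4, map_mul, map_prod]
    congr 1
    refine Finset.prod_congr rfl fun j _ => ?_
    exact wMap_sigma_iterate f j _

end Fibres

/-! ### The fibres over algebraically closed fields -/

section Transitive

variable {O : Type u} [CommRing O] [IsDomain O] [IsDiscreteValuationRing O]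
  [Finite (IsLocalRing.ResidueField O)] {ϖ : O} [hϖ : Fact (Irreducible ϖ)] {h : ℕ} [NeZero h]
  {k : PerfAlg O} {n₀ k₀ l i₀ j₀ : ℕ}

theorem MooreIndep.exists_eq_sum' {k : Type*} [CommRing k] (hk : IsField k) {F : k →+* k} {r : ℕ}
    {y : Fin r → k} (hy : MooreIndep F y) {c : ℕ → k} (hc : c r ≠ 0)
    (hcy : ∀ ρ, ∑ ν ∈ Finset.range (r + 1), c ν * F^[ν] (y ρ) = 0) {τ : k}
    (hτ : ∑ ν ∈ Finset.range (r + 1), c ν * F^[ν] τ = 0) :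
    ∃ a : Fin r → k, (∀ ρ, F (a ρ) = a ρ) ∧ τ = ∑ ρ, a ρ * y ρ := by
  let _ := hk.toField
  exact MooreIndep.exists_eq_sum F hy hc hcy hτ

theorem MooreIndep.coeff_zero_ne_zero' {k : Type*} [CommRing k] (hk : IsField k) {F : k →+* k}
    {r : ℕ} {y : Fin r → k} (hy : MooreIndep F y) {c : ℕ → k} (hc : c r ≠ 0)
    (hcy : ∀ ρ, ∑ ν ∈ Finset.range (r + 1), c ν * F^[ν] (y ρ) = 0) : c 0 ≠ 0 := by
  let _ := hk.toField
  exact MooreIndep.coeff_zero_ne_zero F hy hc hcy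

theorem exists_algebraMap_eq_of_pow_eq (hk : IsField k) {Q : ℕ} (hQ : 1 < Q) {α : k}
    (hα : α ^ Q = α) : ∃ β : PerfAlg.base O, β ^ Q = β ∧ k.ofBase β = α := by
  have := hk.nontrivial
  have := hk.isDomain
  have hint : IsIntegral (GeomField O) α := by
    refine ⟨Polynomial.X ^ Q - Polynomial.X, ?_, by simp [hα]⟩
    exact Polynomial.monic_X_pow_sub (by rw [Polynomial.degree_X]; exact_mod_cast hQ)
  obtain ⟨β, hβ⟩ := minpoly.mem_range_of_degree_eq_one (GeomField O) α
    (IsAlgClosed.degree_eq_one_of_irreducible _ (minpoly.irreducible hint))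
  refine ⟨β, (algebraMap (GeomField O) k).injective ?_, hβ⟩
  change algebraMap (GeomField O) k (β ^ Q) = _
  rw [map_pow]
  exact (congrArg (· ^ Q) hβ).trans (hα.trans hβ.symm)

theorem isUnit_res_cof_top {y : Fin j₀ → Fin n₀ → TruncWitt O h k}
    (hy : IsUnit (gMat ϖ (sigmaAlg h k) k₀ y).det) :
    IsUnit (res (cof ϖ (sigmaAlg h k) k₀ y (n₀ * j₀))) := by
  rw [mul_comm, cof_top, map_mul, map_pow, map_neg, map_one]
  exact (isUnit_one.neg.pow _).mul (hy.map res)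

theorem res_cof_top_ne_zero (hk : Nontrivial k) {y : Fin j₀ → Fin n₀ → TruncWitt O h k}
    (hy : IsUnit (gMat ϖ (sigmaAlg h k) k₀ y).det) :
    res (cof ϖ (sigmaAlg h k) k₀ y (n₀ * j₀)) ≠ 0 := (isUnit_res_cof_top hy).ne_zero

theorem sum_res_cof (hc : Nat.Coprime k₀ n₀) (hn : 0 < n₀)
    (y : Fin j₀ → Fin n₀ → TruncWitt O h k) (j : Fin j₀) :
    ∑ ν ∈ Finset.range (j₀ + 1), res (cof ϖ (sigmaAlg h k) k₀ y (n₀ * ν)) *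
      (frobPow k n₀)^[ν] (res (y j ⟨0, hn⟩)) = 0 := by
  rw [← res_twPoly hc hn, twPoly_self, Pi.zero_apply, map_zero]

/-- The element of the group with a single nonzero component, a multiple of a Teichmüller
representative, acts by a power of `Π` up to a diagonal matrix. -/
theorem blockAct_single (i : ℕ) {t : Fin n₀} (ht : k₀ * t % n₀ = i % n₀) (β : PerfAlg.base O)
    (y : Fin n₀ → TruncWitt O h k) :
    blockAct ϖ (sigmaAlg h k) k₀ l (fun s => wBase h k
      ((Pi.single t (ϖ ^ (i / n₀) • teich β) : Fin n₀ → TruncWitt O h (PerfAlg.base O)) s)) y =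
      (piL ϖ ^ i) fun p : Fin n₀ =>
        (sigmaAlg h k ^ ((p : ℕ) * l)) (teich (k.ofBase β)) * y p := by
  rw [blockAct, Finset.sum_eq_single t, ht, piL_pow_mod ϖ i, ← piL_pow_smul]
  · congr 1
    funext p
    rw [Pi.single_eq_same, map_smul, map_smul, Pi.smul_apply, smul_mul_assoc]
    congr 3
    exact wMap_teich _ _
  · intro s _ hs
    have h0 : (fun p : Fin n₀ => (sigmaAlg h k ^ ((p : ℕ) * l)) (wBase h k
        ((Pi.single t (ϖ ^ (i / n₀) • teich β) : Fin n₀ → TruncWitt O h (PerfAlg.base O)) s)) *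
        y p) = 0 := by
      funext p
      rw [Pi.single_eq_of_ne hs, map_zero, map_zero, zero_mul, Pi.zero_apply]
    rw [h0, map_zero]
  · exact fun hs => absurd (Finset.mem_univ _) hs

/-- The kernel of the twisted polynomial of `y` on truncated vectors over a field consists of the
combinations of the components of `y` with coefficients fixed by `σ^{n₀}`. It is found by successive
approximation with respect to the powers of `Π`. -/
theorem exists_sub_sum_blockAct_eq (hk : IsField k) (hc : Nat.Coprime k₀ n₀) (hn : 0 < n₀)
    (hl : k₀ * l ≡ 1 [MOD n₀]) {y : Fin j₀ → Fin n₀ → TruncWitt O h k}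
    (hy : IsUnit (gMat ϖ (sigmaAlg h k) k₀ y).det) {D : Fin n₀ → TruncWitt O h k}
    (hD : Negl (twPoly ϖ (sigmaAlg h k) k₀ y D)) (i : ℕ) (hi : i ≤ truncExp n₀ h) :
    ∃ a : Fin j₀ → Fin n₀ → TruncWitt O h (PerfAlg.base O),
      (∀ j t, sigma^[n₀] (a j t) = a j t) ∧ ∃ v, D - ∑ j, blockAct ϖ (sigmaAlg h k) k₀ l
        (fun t => wBase h k (a j t)) (y j) = (piL ϖ ^ i) v := by
  induction i with
  | zero =>
    refine ⟨0, fun j t => iterate_map_zero _ _, D, ?_⟩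
    have h0 : ∀ j, blockAct ϖ (sigmaAlg h k) k₀ l (fun t => wBase h k
        ((0 : Fin j₀ → Fin n₀ → TruncWitt O h (PerfAlg.base O)) j t)) (y j) = 0 := fun j => by
      have : (fun t => wBase h k
        ((0 : Fin j₀ → Fin n₀ → TruncWitt O h (PerfAlg.base O)) j t)) = 0 :=
        funext fun t => map_zero _
      rw [this, blockAct_zero_left]
    rw [Finset.sum_eq_zero fun j _ => h0 j, sub_zero]
    rfl
  | succ i ih =>
    obtain ⟨a, ha, v, hv⟩ := ih (by omega)
    have hav : Negl ((piL ϖ ^ i) (twPoly ϖ (sigmaAlg h k) k₀ y v)) := by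
      rw [← twPoly_piL_pow, ← hv, twPoly_sub, twPoly_sum]
      have h0 : ∀ j, twPoly ϖ (sigmaAlg h k) k₀ y (blockAct ϖ (sigmaAlg h k) k₀ l
          (fun t => wBase h k (a j t)) (y j)) = 0 := fun j => by
        rw [twPoly_blockAct ϖ (sigmaAlg h k) k₀ hl fun t => wBase_sigma_pow_fixed (ha j t),
          twPoly_self, blockAct_zero_right]
      rw [Finset.sum_eq_zero fun j _ => h0 j, sub_zero]
      exact hD
    have hres := res_eq_zero_of_negl_piL_pow hn hi hav
    rw [res_twPoly hc hn] at hres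
    obtain ⟨α, hα, hαv⟩ := (mooreIndep_of_isUnit hc hn hy).exists_eq_sum' hk
      (res_cof_top_ne_zero hk.nontrivial hy) (sum_res_cof hc hn y) hres
    have hQ : 1 < resCard O ^ n₀ := Nat.one_lt_pow hn.ne' (one_lt_resCard O)
    have hβ : ∀ j, ∃ β : PerfAlg.base O, β ^ resCard O ^ n₀ = β ∧ k.ofBase β = α j := fun j =>
      exists_algebraMap_eq_of_pow_eq hk hQ (by rw [← frobPow_apply, hα j])
    choose β hβ hβα using hβ
    -- The parameter `t` is the one which acts by `Π ^ (i % n₀)`.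
    obtain ⟨t, ht⟩ := exists_mul_mod_eq hc ⟨i % n₀, Nat.mod_lt _ hn⟩
    let δ : Fin j₀ → Fin n₀ → TruncWitt O h (PerfAlg.base O) := fun j =>
      Pi.single t (ϖ ^ (i / n₀) • teich (β j))
    have hδ : ∀ j s, sigma^[n₀] (δ j s) = δ j s := by
      intro j s
      by_cases hs : s = t
      · subst hs
        simp only [δ, Pi.single_eq_same]
        rw [sigma_iterate_smul, sigma_iterate_teich, hβ]
      · simp only [δ, Pi.single_eq_of_ne hs]
        exact iterate_map_zero _ _
    let w : Fin j₀ → Fin n₀ → TruncWitt O h k := fun j p =>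
      (sigmaAlg h k ^ ((p : ℕ) * l)) (teich (k.ofBase (β j))) * y j p
    have hδw : ∀ j, blockAct ϖ (sigmaAlg h k) k₀ l (fun s => wBase h k (δ j s)) (y j) =
        (piL ϖ ^ i) (w j) := fun j => blockAct_single i ht (β j) (y j)
    have hrem : res ((v - ∑ j, w j) ⟨0, hn⟩) = 0 := by
      rw [Pi.sub_apply, map_sub, hαv, Finset.sum_apply, map_sum, sub_eq_zero]
      refine Finset.sum_congr rfl fun j _ => ?_
      simp only [w]
      rw [zero_mul, pow_zero, map_mul, AlgHom.one_apply, res_teich, hβα]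
    obtain ⟨v', hv'⟩ := exists_eq_piL_of_res_eq_zero (ϖ := ϖ) hn hrem
    refine ⟨fun j s => a j s + δ j s, fun j s => ?_, v', ?_⟩
    · rw [iterate_map_add, ha, hδ]
    · have h1 : ∀ j, blockAct ϖ (sigmaAlg h k) k₀ l (fun s => wBase h k (a j s + δ j s)) (y j) =
          blockAct ϖ (sigmaAlg h k) k₀ l (fun s => wBase h k (a j s)) (y j) +
            (piL ϖ ^ i) (w j) := fun j => by
        rw [← hδw, ← blockAct_add_left]
        congr 1
        funext s
        exact map_add _ _ _
      rw [Finset.sum_congr rfl fun j _ => h1 j, Finset.sum_add_distrib, ← sub_sub, hv, ← map_sum,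
        ← map_sub, hv', pow_succ]
      rfl

/-- Two points over a field with the same image under `x ↦ (m, x')` are conjugate under `N_h`. -/
theorem exists_act_eq (hk : IsField k) (hc : Nat.Coprime k₀ n₀) (hn : 0 < n₀)
    (hl : k₀ * l ≡ 1 [MOD n₀]) {x y : Z n₀ (i₀ + j₀) h k}
    (hx : IsUnit (detG ϖ k₀ (alpha ϖ k₀ x).2)) (hxy : alpha ϖ k₀ x = alpha ϖ k₀ y) :
    ∃ u ∈ N O n₀ i₀ j₀ h, act ϖ k₀ l u y = x := by
  have hlx := isLift_liftZ x
  have hly := isLift_liftZ y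
  set X := liftZ x with hX
  set Y := liftZ y with hY
  have htail : ∀ j, X (Fin.natAdd i₀ j) = Y (Fin.natAdd i₀ j) := by
    intro j
    have h1 : x (Fin.natAdd i₀ j) = y (Fin.natAdd i₀ j) := congrFun (congrArg Prod.snd hxy) j
    funext a
    rw [hX, hY, liftZ, liftZ, h1]
  have hunit : IsUnit (gMat ϖ (sigmaAlg h k) k₀ fun j => Y (Fin.natAdd i₀ j)).det := by
    rw [(isLift_alpha_snd (ϖ := ϖ) (k₀ := k₀) hlx).detG hc] at hx
    simp only [htail] at hx
    exact hx
  have hnegl : ∀ i : Fin i₀, Negl (twPoly ϖ (sigmaAlg h k) k₀ (fun j => Y (Fin.natAdd i₀ j))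
      (X (Fin.castAdd j₀ i) - Y (Fin.castAdd j₀ i))) := by
    intro i
    have h1 := isLift_alpha_fst (ϖ := ϖ) hc hlx
    have h2 := isLift_alpha_fst (ϖ := ϖ) hc hly
    rw [← hxy] at h2
    have h3 := h1.negl_sub h2 i
    simp only [htail] at h3
    rw [twPoly_sub]
    exact h3
  have hex := fun i => exists_sub_sum_blockAct_eq hk hc hn hl hunit (hnegl i) _ le_rfl
  choose a ha v hv using hex
  let u : Fin i₀ → Fin j₀ → (t : Fin n₀) → TruncWitt O (lev h t) (PerfAlg.base O) :=
    fun i j t => wRed (lev_le h t) (a i j t)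
  have hau : IsParamLift a u := fun _ _ _ => rfl
  refine ⟨u, fun i j t => ?_, ?_⟩
  · rw [← wRed_sigma_iterate, ha]
  · have h1 := isLift_actLift (ϖ := ϖ) (l := l) hc hau hly
    funext ρ p
    rw [← h1 ρ p, ← hlx ρ p]
    induction ρ using Fin.addCases with
    | right j => rw [actLift, Fin.addCases_right, ← htail]
    | left i =>
      rw [actLift, Fin.addCases_left]
      have h2 := (negl_iff ϖ hn).2 ⟨v i, hv i⟩
      have h3 := h2 p
      rw [sub_sub, Pi.sub_apply, map_sub, sub_eq_zero] at h3
      exact h3.symm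

end Transitive

/-! ### Adjoining roots of additive polynomials -/

section AdjoinRoots

variable {O : Type u} [CommRing O] [IsLocalRing O] [Finite (IsLocalRing.ResidueField O)]

variable (O) in
/-- The `p`-Frobenius of an algebra over `\overline{𝔽}_q`. -/
noncomputable def charFrob (A : Type*) [CommRing A] [Algebra (GeomField O) A] : A →+* A where
  toFun a := a ^ ringChar (GeomField O)
  map_one' := one_pow _
  map_mul' a b := mul_pow a b _
  map_zero' := zero_pow (resCard_eq_pow O).1.ne_zero
  map_add' a b := by
    obtain ⟨r, hr⟩ := exists_add_pow_prime_pow_eq (resCard_eq_pow O).1 a b 1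
    rw [pow_one, natCast_ringChar_geomField] at hr
    rw [hr]
    ring

theorem charFrob_apply (A : Type*) [CommRing A] [Algebra (GeomField O) A] (a : A) :
    charFrob O A a = a ^ ringChar (GeomField O) := rfl

/-- If Frobenius is surjective on a finite free algebra over a perfect algebra, it is injective: it
is a twist of a surjective linear endomorphism. -/
theorem charFrob_injective_of_surjective {B : PerfAlg O} {E : Type u} [CommRing E] [Algebra B E]
    [Algebra (GeomField O) E] {ι : Type*} [Fintype ι] (b : Module.Basis ι B E)
    (hs : Function.Surjective (charFrob O E)) : Function.Injective (charFrob O E) := by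
  classical
  let Λ : E →ₗ[B] E := b.constr B fun i => charFrob O E (b i)
  have hΛ : ∀ z : E, charFrob O E z =
      Λ (∑ i, (b.repr z i) ^ ringChar (GeomField O) • b i) := by
    intro z
    conv_lhs => rw [← b.sum_repr z]
    simp only [map_sum, map_smul, Λ, b.constr_basis]
    refine Finset.sum_congr rfl fun i _ => ?_
    rw [Algebra.smul_def, map_mul, charFrob_apply, ← map_pow, ← Algebra.smul_def]
  have hΛs : Function.Surjective Λ := fun z => by
    obtain ⟨z', rfl⟩ := hs z
    exact ⟨_, (hΛ z').symm⟩
  have := Module.Finite.of_basis b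
  have hΛi := OrzechProperty.injective_of_surjective_endomorphism Λ hΛs
  rw [injective_iff_map_eq_zero]
  intro z hz
  rw [hΛ, map_eq_zero_iff Λ hΛi] at hz
  have h1 := fun i => (Fintype.linearIndependent_iff.1 b.linearIndependent) _ hz i
  have h2 : ∀ i, b.repr z i = 0 := fun i => B.perfect.injective
    ((h1 i).trans (zero_pow (resCard_eq_pow O).1.ne_zero).symm)
  rw [← b.sum_repr z]
  exact Finset.sum_eq_zero fun i _ => by rw [h2, zero_smul]

/-- A morphism `ι : B → E` of perfect algebras which has a `B`-linear retraction, and through which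
all geometric points of `B` factor. -/
structure IsCover {B E : PerfAlg O} (ι : B →ₐ[GeomField O] E) : Prop where
  exists_retraction : ∃ π : E →+ B, (∀ b z, π (ι b * z) = b * π z) ∧ π 1 = 1
  exists_lift : ∀ k : PerfAlg O, k.IsGeom → ∀ f : B →ₐ[GeomField O] k,
    ∃ g : E →ₐ[GeomField O] k, g.comp ι = f

theorem IsCover.id (B : PerfAlg O) : IsCover (AlgHom.id (GeomField O) B) :=
  ⟨⟨AddMonoidHom.id B, fun _ _ => rfl, rfl⟩, fun _ _ f => ⟨f, rfl⟩⟩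

theorem IsCover.comp {B E E' : PerfAlg O} {ι : B →ₐ[GeomField O] E} {ι' : E →ₐ[GeomField O] E'}
    (hι' : IsCover ι') (hι : IsCover ι) : IsCover (ι'.comp ι) := by
  obtain ⟨π, hπ, hπ1⟩ := hι.exists_retraction
  obtain ⟨π', hπ', hπ1'⟩ := hι'.exists_retraction
  refine ⟨⟨π.comp π', fun b z => ?_, ?_⟩, fun k hk f => ?_⟩
  · rw [AddMonoidHom.comp_apply, AlgHom.comp_apply, hπ', hπ, AddMonoidHom.comp_apply]
  · rw [AddMonoidHom.comp_apply, hπ1', hπ1]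
  · obtain ⟨g, hg⟩ := hι.exists_lift k hk f
    obtain ⟨g', hg'⟩ := hι'.exists_lift k hk g
    exact ⟨g', by rw [← AlgHom.comp_assoc, hg', hg]⟩

/-- The monic polynomial `X ^ Q ^ r + ∑_{ν < r} c_ν X ^ Q ^ ν - m`. -/
noncomputable def addPoly {B : Type*} [CommRing B] (Q r : ℕ) (c : ℕ → B) (m : B) : Polynomial B :=
  Polynomial.X ^ Q ^ r + (∑ ν ∈ Finset.range r, Polynomial.C (c ν) * Polynomial.X ^ Q ^ ν -
    Polynomial.C m)

theorem degree_addPoly_aux {B : Type*} [CommRing B] {Q r : ℕ} (hQ : 1 < Q) (c : ℕ → B) (m : B) :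
    (∑ ν ∈ Finset.range r, Polynomial.C (c ν) * Polynomial.X ^ Q ^ ν -
      Polynomial.C m).degree < ((Q ^ r : ℕ) : WithBot ℕ) := by
  rw [← Polynomial.mem_degreeLT]
  refine sub_mem (sum_mem fun ν hν => ?_) ?_
  · rw [Polynomial.mem_degreeLT]
    refine (Polynomial.degree_C_mul_X_pow_le _ _).trans_lt ?_
    exact_mod_cast Nat.pow_lt_pow_right hQ (Finset.mem_range.1 hν)
  · rw [Polynomial.mem_degreeLT]
    refine Polynomial.degree_C_le.trans_lt ?_
    exact_mod_cast Nat.pow_pos (by omega)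

theorem monic_addPoly {B : Type*} [CommRing B] {Q r : ℕ} (hQ : 1 < Q) (c : ℕ → B) (m : B) :
    (addPoly Q r c m).Monic := Polynomial.monic_X_pow_add (degree_addPoly_aux hQ c m)

theorem natDegree_addPoly {B : Type*} [CommRing B] [Nontrivial B] {Q r : ℕ} (hQ : 1 < Q)
    (c : ℕ → B) (m : B) : (addPoly Q r c m).natDegree = Q ^ r := by
  rw [addPoly, Polynomial.natDegree_add_eq_left_of_degree_lt, Polynomial.natDegree_X_pow]
  rw [Polynomial.degree_X_pow]
  exact degree_addPoly_aux hQ c m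

theorem eval₂_addPoly {B E : Type*} [CommRing B] [CommRing E] (f : B →+* E) (Q r : ℕ)
    (c : ℕ → B) (m : B) (t : E) : (addPoly Q r c m).eval₂ f t =
      t ^ Q ^ r + (∑ ν ∈ Finset.range r, f (c ν) * t ^ Q ^ ν - f m) := by
  simp [addPoly, Polynomial.eval₂_finsetSum]

/-- Frobenius is surjective on the algebra obtained by adjoining a root of an additive polynomial
with invertible linear coefficient: this coefficient allows to solve for the root. -/
theorem charFrob_surjective_adjoinRoot {B : PerfAlg O} {a r : ℕ} (ha : a ≠ 0) (hr : r ≠ 0)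
    {c : ℕ → B} (hc0 : IsUnit (c 0)) (m : B) :
    Function.Surjective (charFrob O
      (AdjoinRoot (addPoly (ringChar (GeomField O) ^ a) r c m))) := by
  set f := addPoly (ringChar (GeomField O) ^ a) r c m with hf
  let φ := charFrob O (AdjoinRoot f)
  have hof : ∀ b : B, AdjoinRoot.of f b ∈ φ.range := fun b => by
    obtain ⟨b', rfl⟩ := B.perfect.surjective b
    exact ⟨AdjoinRoot.of f b', (map_pow _ _ _).symm⟩
  have hpow : ∀ ν, ν ≠ 0 →
      AdjoinRoot.root f ^ (ringChar (GeomField O) ^ a) ^ ν ∈ φ.range := fun ν hν => by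
    obtain ⟨e, he⟩ := Nat.exists_eq_succ_of_ne_zero (Nat.mul_ne_zero ha hν)
    refine ⟨AdjoinRoot.root f ^ ringChar (GeomField O) ^ e, ?_⟩
    rw [← pow_mul (ringChar (GeomField O)), he, pow_succ, pow_mul]
    rfl
  have hroot : AdjoinRoot.root f ∈ φ.range := by
    have h1 := (eval₂_addPoly (AdjoinRoot.of f) (ringChar (GeomField O) ^ a) r c m
      (AdjoinRoot.root f)).symm.trans (AdjoinRoot.eval₂_root f)
    obtain ⟨s, rfl⟩ := Nat.exists_eq_add_one_of_ne_zero hr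
    rw [Finset.sum_range_succ', pow_zero, pow_one] at h1
    obtain ⟨d, hd⟩ := hc0.exists_left_inv
    have h2 : AdjoinRoot.root f = AdjoinRoot.of f d * (AdjoinRoot.of f m -
        AdjoinRoot.root f ^ (ringChar (GeomField O) ^ a) ^ (s + 1) -
        ∑ ν ∈ Finset.range s, AdjoinRoot.of f (c (ν + 1)) *
          AdjoinRoot.root f ^ (ringChar (GeomField O) ^ a) ^ (ν + 1)) := by
      have h3 : AdjoinRoot.of f d * AdjoinRoot.of f (c 0) = 1 := by rw [← map_mul, hd, map_one]
      linear_combination AdjoinRoot.of f d * h1 - AdjoinRoot.root f * h3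
    rw [h2]
    refine mul_mem (hof _) (sub_mem (sub_mem (hof _) (hpow _ (Nat.succ_ne_zero s)))
      (sum_mem fun ν _ => mul_mem (hof _) (hpow _ (Nat.succ_ne_zero ν))))
  intro z
  change z ∈ φ.range
  induction z using AdjoinRoot.induction_on with
  | ih p =>
    induction p using Polynomial.induction_on' with
    | add p q hp hq =>
      rw [map_add]
      exact add_mem hp hq
    | monomial n b =>
      rw [← Polynomial.C_mul_X_pow_eq_monomial, map_mul, map_pow, AdjoinRoot.mk_X]
      exact mul_mem (hof b) (pow_mem hroot n)

/-- A root of an additive polynomial with invertible linear and leading coefficients exists after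
passing to a cover. -/
theorem exists_cover_root (B : PerfAlg O) {a r : ℕ} (ha : a ≠ 0) (hr : r ≠ 0) {c : ℕ → B}
    (hc0 : IsUnit (c 0)) (hcr : IsUnit (c r)) (m : B) :
    ∃ (E : PerfAlg O) (ι : B →ₐ[GeomField O] E), IsCover ι ∧ ∃ t : E,
      ∑ ν ∈ Finset.range (r + 1), ι (c ν) * t ^ (ringChar (GeomField O) ^ a) ^ ν = ι m := by
  obtain ⟨d, hd⟩ := hcr.exists_left_inv
  have hdu : IsUnit d := IsUnit.of_mul_eq_one _ hd
  set Q := ringChar (GeomField O) ^ a with hQ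
  have hQ1 : 1 < Q := Nat.one_lt_pow ha (resCard_eq_pow O).1.one_lt
  set f := addPoly Q r (fun ν => d * c ν) (d * m) with hf
  have hmonic : f.Monic := monic_addPoly hQ1 _ _
  have hsurj : Function.Surjective (charFrob O (AdjoinRoot f)) :=
    charFrob_surjective_adjoinRoot ha hr (hdu.mul hc0) (d * m)
  let E : PerfAlg O :=
    { carrier := AdjoinRoot f
      perfect := ⟨charFrob_injective_of_surjective (AdjoinRoot.powerBasisAux' hmonic) hsurj,
        hsurj⟩ }
  let ι : B →ₐ[GeomField O] E := IsScalarTower.toAlgHom (GeomField O) B (AdjoinRoot f)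
  refine ⟨E, ι, ⟨?_, fun k hk g => ?_⟩, AdjoinRoot.root f, ?_⟩
  · rcases subsingleton_or_nontrivial B with hB | hB
    · exact ⟨0, fun _ _ => Subsingleton.elim _ _, Subsingleton.elim _ _⟩
    refine ⟨((Polynomial.lcoeff B 0).comp
      (AdjoinRoot.modByMonicHom hmonic) : AdjoinRoot f →ₗ[B] B), fun b z => ?_, ?_⟩
    · have h1 := map_smul ((Polynomial.lcoeff B 0).comp (AdjoinRoot.modByMonicHom hmonic)) b z
      rw [Algebra.smul_def] at h1
      exact h1
    · have h1 : AdjoinRoot.modByMonicHom hmonic 1 = 1 := by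
        rw [← map_one (AdjoinRoot.mk f), AdjoinRoot.modByMonicHom_mk,
          (Polynomial.modByMonic_eq_self_iff hmonic).2]
        rw [Polynomial.degree_one, Polynomial.degree_eq_natDegree hmonic.ne_zero,
          natDegree_addPoly hQ1]
        exact_mod_cast Nat.pow_pos (by omega)
      change (AdjoinRoot.modByMonicHom hmonic 1).coeff 0 = 1
      rw [h1, Polynomial.coeff_one_zero]
  · have := hk.nontrivial
    have := (g : B →+* k).domain_nontrivial
    obtain ⟨t, ht⟩ := hk.exists_root (f.map (g : B →+* k)) (hmonic.map _) (by
      rw [hmonic.natDegree_map, natDegree_addPoly hQ1]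
      exact (Nat.pow_pos (by omega)).ne')
    rw [Polynomial.eval_map] at ht
    refine ⟨AdjoinRoot.liftAlgHom f g t ht, ?_⟩
    ext b
    exact AdjoinRoot.lift_of ht
  · have h1 := (eval₂_addPoly (AdjoinRoot.of f) Q r (fun ν => d * c ν) (d * m)
      (AdjoinRoot.root f)).symm.trans (AdjoinRoot.eval₂_root f)
    change ∑ ν ∈ Finset.range (r + 1), AdjoinRoot.of f (c ν) * AdjoinRoot.root f ^ Q ^ ν =
      AdjoinRoot.of f m
    rw [Finset.sum_range_succ]
    simp only [map_mul, mul_assoc, ← Finset.mul_sum] at h1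
    have h2 : AdjoinRoot.of f d * AdjoinRoot.of f (c r) = 1 := by rw [← map_mul, hd, map_one]
    linear_combination AdjoinRoot.of f (c r) * h1 - (∑ ν ∈ Finset.range r,
      AdjoinRoot.of f (c ν) * AdjoinRoot.root f ^ Q ^ ν - AdjoinRoot.of f m) * h2

end AdjoinRoots

/-! ### Solving `alpha x = (m, x')` on a cover -/

section Covers

variable {O : Type u} [CommRing O] [IsDomain O] [IsDiscreteValuationRing O]
  [Finite (IsLocalRing.ResidueField O)] {ϖ : O} [hϖ : Fact (Irreducible ϖ)] {h : ℕ} [NeZero h]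
  {R S T : PerfAlg O} {n₀ k₀ l i₀ j₀ : ℕ}

theorem wMapAlg_comp (g : S →ₐ[GeomField O] T) (f : R →ₐ[GeomField O] S) (w : TruncWitt O h R) :
    wMapAlg h (g.comp f) w = wMapAlg h g (wMapAlg h f w) :=
  wMap_comp (f.restrictScalars O) (g.restrictScalars O) w

theorem isUnit_det_map {r : ℕ} {y : Fin r → Fin n₀ → TruncWitt O h R}
    (hy : IsUnit (gMat ϖ (sigmaAlg h R) k₀ y).det) (f : R →ₐ[GeomField O] S) :
    IsUnit (gMat ϖ (sigmaAlg h S) k₀ fun ρ a => wMapAlg h f (y ρ a)).det := by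
  have h1 := hy.map (wMapAlg h f)
  rw [map_det_gMat (wMapAlg h f) (wMapAlg_sigmaAlg f)] at h1
  exact h1

theorem map_res_cof (y : Fin j₀ → Fin n₀ → TruncWitt O h R) (f : R →ₐ[GeomField O] S) (t : ℕ) :
    f (res (cof ϖ (sigmaAlg h R) k₀ y t)) =
      res (cof ϖ (sigmaAlg h S) k₀ (fun ρ a => wMapAlg h f (y ρ a)) t) := by
  rw [← res_wMap, ← wMapAlg_apply, map_cof (wMapAlg h f) (wMapAlg_sigmaAlg f)]

/-- The additive polynomial which is the reduction of the twisted polynomial is étale. -/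
theorem isUnit_res_cof_zero (hc : Nat.Coprime k₀ n₀) (hn : 0 < n₀)
    {y : Fin j₀ → Fin n₀ → TruncWitt O h R} (hy : IsUnit (gMat ϖ (sigmaAlg h R) k₀ y).det) :
    IsUnit (res (cof ϖ (sigmaAlg h R) k₀ y 0)) := by
  refine PerfAlg.isUnit_of_geomPoint fun k hk f => ?_
  rw [map_res_cof]
  have h1 := isUnit_det_map hy f
  exact (mooreIndep_of_isUnit hc hn h1).coeff_zero_ne_zero' hk.isField
    (c := fun ν => res (cof ϖ (sigmaAlg h k) k₀ (fun ρ a => wMapAlg h f (y ρ a)) (n₀ * ν)))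
    (res_cof_top_ne_zero hk.nontrivial h1) (sum_res_cof hc hn _)

/-- On a cover, the twisted polynomial takes any given value up to `Π^i`. -/
theorem exists_cover_twPoly (hc : Nat.Coprime k₀ n₀) (hn : 0 < n₀) (hj₀ : 0 < j₀)
    {y : Fin j₀ → Fin n₀ → TruncWitt O h R} (hy : IsUnit (gMat ϖ (sigmaAlg h R) k₀ y).det)
    (μ : Fin n₀ → TruncWitt O h R) (i : ℕ) :
    ∃ (E : PerfAlg O) (ι : R →ₐ[GeomField O] E), IsCover ι ∧ ∃ v w : Fin n₀ → TruncWitt O h E,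
      (fun a => wMapAlg h ι (μ a)) -
        twPoly ϖ (sigmaAlg h E) k₀ (fun ρ a => wMapAlg h ι (y ρ a)) v = (piL ϖ ^ i) w := by
  induction i with
  | zero => exact ⟨R, AlgHom.id _ R, IsCover.id R, 0, _, rfl⟩
  | succ i ih =>
    obtain ⟨E, ι, hι, v, w, hvw⟩ := ih
    set yE : Fin j₀ → Fin n₀ → TruncWitt O h E := fun ρ a => wMapAlg h ι (y ρ a) with hyE
    have hyE' : IsUnit (gMat ϖ (sigmaAlg h E) k₀ yE).det := isUnit_det_map hy ι
    obtain ⟨-, e, he, hq⟩ := resCard_eq_pow O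
    obtain ⟨E', ι', hι', t, ht⟩ := exists_cover_root E (a := e * n₀) (r := j₀)
      (Nat.mul_pos he hn).ne' hj₀.ne' (c := fun ν => res (cof ϖ (sigmaAlg h E) k₀ yE (n₀ * ν)))
      (isUnit_res_cof_zero hc hn hyE') (isUnit_res_cof_top hyE') (res (w ⟨0, hn⟩))
    set yE' : Fin j₀ → Fin n₀ → TruncWitt O h E' := fun ρ a => wMapAlg h ι' (yE ρ a) with hyE2
    have hcomp : (fun ρ a => wMapAlg h (ι'.comp ι) (y ρ a)) = yE' := by
      funext ρ a
      rw [wMapAlg_comp]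
    let τ : Fin n₀ → TruncWitt O h E' := fun _ => teich t
    have hres : res (((fun a => wMapAlg h ι' (w a)) -
        twPoly ϖ (sigmaAlg h E') k₀ yE' τ) ⟨0, hn⟩) = 0 := by
      rw [Pi.sub_apply, map_sub, sub_eq_zero, wMapAlg_apply, res_wMap, ← ht, res_twPoly hc hn]
      refine Finset.sum_congr rfl fun ν _ => ?_
      rw [map_res_cof, frobPow_iterate, res_teich, hq, ← pow_mul, ← pow_mul, mul_assoc]
    obtain ⟨w', hw'⟩ := exists_eq_piL_of_res_eq_zero (ϖ := ϖ) hn hres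
    refine ⟨E', ι'.comp ι, hι'.comp hι,
      (fun a => wMapAlg h ι' (v a)) + (piL ϖ ^ i) τ, w', ?_⟩
    rw [hcomp, twPoly_add, twPoly_piL_pow, pow_succ, Module.End.mul_apply, ← hw', map_sub, ← sub_sub]
    congr 1
    have h1 : (fun a => wMapAlg h ι' ((piL ϖ ^ i) w a)) =
        (piL ϖ ^ i) fun a => wMapAlg h ι' (w a) :=
      map_piL_pow ϖ (wMapAlg h ι' : TruncWitt O h E →+ TruncWitt O h E')
        (fun c z => map_smul (wMapAlg h ι') c z) i w
    rw [← h1, ← hvw]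
    funext a
    rw [Pi.sub_apply, Pi.sub_apply, map_sub, wMapAlg_comp,
      map_twPoly (wMapAlg h ι') (wMapAlg_sigmaAlg ι')]

theorem Negl.map {v : Fin n₀ → TruncWitt O h R} (hv : Negl v) (f : R →ₐ[GeomField O] S) :
    Negl fun a => wMapAlg h f (v a) := fun a => by
  change wRed (lev_le h a) (wMap h _ (v a)) = 0
  rw [wRed_wMap, hv a, map_zero]

theorem exists_cover_twPoly_finset (hc : Nat.Coprime k₀ n₀) (hn : 0 < n₀) (hj₀ : 0 < j₀)
    {y : Fin j₀ → Fin n₀ → TruncWitt O h R} (hy : IsUnit (gMat ϖ (sigmaAlg h R) k₀ y).det)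
    {ι₀ : Type*} (s : Finset ι₀) (μ : ι₀ → Fin n₀ → TruncWitt O h R) :
    ∃ (E : PerfAlg O) (ι : R →ₐ[GeomField O] E), IsCover ι ∧
      ∃ v : ι₀ → Fin n₀ → TruncWitt O h E, ∀ ρ ∈ s, Negl ((fun a => wMapAlg h ι (μ ρ a)) -
        twPoly ϖ (sigmaAlg h E) k₀ (fun ρ a => wMapAlg h ι (y ρ a)) (v ρ)) := by
  classical
  induction s using Finset.induction_on with
  | empty => exact ⟨R, AlgHom.id _ R, IsCover.id R, 0, fun ρ hρ => absurd hρ (Finset.notMem_empty ρ)⟩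
  | insert ρ₀ s _ ih =>
    obtain ⟨E, ι, hι, v, hv⟩ := ih
    have hyE := isUnit_det_map hy ι
    obtain ⟨E', ι', hι', v', w', hvw'⟩ := exists_cover_twPoly hc hn hj₀ hyE
      (fun a => wMapAlg h ι (μ ρ₀ a)) (truncExp n₀ h)
    refine ⟨E', ι'.comp ι, hι'.comp hι, fun ρ => if ρ = ρ₀ then v' else
      fun a => wMapAlg h ι' (v ρ a), fun ρ hρ => ?_⟩
    simp only [wMapAlg_comp]
    split_ifs with h0
    · rw [h0]
      exact (negl_iff ϖ hn).2 ⟨w', hvw'⟩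
    · have h1 := (hv ρ ((Finset.mem_insert.1 hρ).resolve_left h0)).map ι'
      have h2 : (fun a => wMapAlg h ι' (((fun a => wMapAlg h ι (μ ρ a)) -
          twPoly ϖ (sigmaAlg h E) k₀ (fun ρ a => wMapAlg h ι (y ρ a)) (v ρ)) a)) =
          (fun a => wMapAlg h ι' (wMapAlg h ι (μ ρ a))) - twPoly ϖ (sigmaAlg h E') k₀
            (fun ρ a => wMapAlg h ι' (wMapAlg h ι (y ρ a))) fun a => wMapAlg h ι' (v ρ a) := by
        funext a
        rw [Pi.sub_apply, Pi.sub_apply, map_sub,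
          map_twPoly (wMapAlg h ι') (wMapAlg_sigmaAlg ι')]
      rw [← h2]
      exact h1

/-- Every point of the target comes from a point of `X_h` on a cover. -/
theorem exists_cover_alpha (hc : Nat.Coprime k₀ n₀) (hn : 0 < n₀) (hi₀ : 0 < i₀) (hj₀ : 0 < j₀)
    {z : Z n₀ i₀ h R × Z n₀ j₀ h R} (hz : z ∈ Target n₀ i₀ j₀ h R ϖ k₀) :
    ∃ (E : PerfAlg O) (ι : R →ₐ[GeomField O] E), IsCover ι ∧
      ∃ x ∈ X n₀ (i₀ + j₀) h E ϖ k₀, alpha ϖ k₀ x = Prod.map (zMap ι) (zMap ι) z := by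
  have hy : IsUnit (detG ϖ k₀ z.2) := hz.2.1
  rw [(isLift_liftZ z.2).detG hc] at hy
  obtain ⟨E, ι, hι, v, hv⟩ := exists_cover_twPoly_finset hc hn hj₀ hy Finset.univ (liftZ z.1)
  set yE : Fin j₀ → Fin n₀ → TruncWitt O h E := fun ρ a => wMapAlg h ι (liftZ z.2 ρ a) with hyE
  let x' : Fin (i₀ + j₀) → Fin n₀ → TruncWitt O h E := Fin.addCases v yE
  let x : Z n₀ (i₀ + j₀) h E := fun ρ a => wRed (lev_le h a) (x' ρ a)
  have hx : IsLift x' x := fun _ _ => rfl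
  have hL1 : ∀ i, x' (Fin.castAdd j₀ i) = v i := fun i => Fin.addCases_left i
  have hL2 : ∀ j, x' (Fin.natAdd i₀ j) = yE j := fun j => Fin.addCases_right j
  have halpha : alpha ϖ k₀ x = Prod.map (zMap ι) (zMap ι) z := by
    refine Prod.ext ?_ ?_
    · funext ρ a
      have h1 := isLift_alpha_fst (ϖ := ϖ) hc hx ρ a
      have h2 := (isLift_liftZ z.1).zMap ι ρ a
      have h3 := hv ρ (Finset.mem_univ _) a
      rw [Pi.sub_apply, map_sub, sub_eq_zero] at h3
      simp only [hL1, hL2] at h1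
      rw [← h1]
      exact h3.symm.trans h2
    · funext ρ a
      have h1 := isLift_alpha_snd (ϖ := ϖ) (k₀ := k₀) hx ρ a
      have h2 := (isLift_liftZ z.2).zMap ι ρ a
      rw [← h1]
      simp only [hL2]
      exact h2
  refine ⟨E, ι, hι, x, ?_, halpha⟩
  rw [mem_X_iff hc hn hi₀, halpha]
  exact map_mem_Target hc ι hz

end Covers

/-! ### Representability -/

section Representability

variable {O : Type u} [CommRing O] [IsLocalRing O] [Finite (IsLocalRing.ResidueField O)]

variable (O) in
/-- The free perfect algebra on a set. -/
theorem exists_free (V : Type) : ∃ (A : PerfAlg O) (v : V → A), ∀ (R : PerfAlg O) (t : V → R),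
    ∃! f : A →ₐ[GeomField O] R, ∀ i, f (v i) = t i := by
  obtain ⟨p, hp⟩ : ∃ p, p = ringChar (GeomField O) := ⟨_, rfl⟩
  have hprime : Fact p.Prime := ⟨hp ▸ (resCard_eq_pow O).1⟩
  have hchar : CharP (GeomField O) p := hp ▸ ringChar.charP (GeomField O)
  let K := MvPolynomial V (GeomField O)
  let _ : Algebra (GeomField O) (PerfectClosure K p) :=
    ((PerfectClosure.of K p).comp (algebraMap (GeomField O) K)).toAlgebra
  let A : PerfAlg O :=
    { carrier := PerfectClosure K p
      perfect := by
        rw [← hp]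
        exact bijective_frobenius (PerfectClosure K p) p }
  refine ⟨A, fun i => PerfectClosure.of K p (MvPolynomial.X i), fun R t => ?_⟩
  rcases subsingleton_or_nontrivial R with hR | hR
  · let f : A →ₐ[GeomField O] R :=
      { toFun := fun _ => 0
        map_one' := Subsingleton.elim _ _
        map_mul' := fun _ _ => Subsingleton.elim _ _
        map_zero' := Subsingleton.elim _ _
        map_add' := fun _ _ => Subsingleton.elim _ _
        commutes' := fun _ => Subsingleton.elim _ _ }
    exact ⟨f, fun _ => Subsingleton.elim _ _, fun g _ => AlgHom.ext fun _ => Subsingleton.elim _ _⟩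
  have hcharR : CharP R p :=
    charP_of_injective_algebraMap (algebraMap (GeomField O) R).injective _
  have hperf : PerfectRing R p := ⟨by
    have := R.perfect
    rw [← hp] at this
    exact this⟩
  let F := PerfectClosure.lift K p R (MvPolynomial.aeval t : K →ₐ[GeomField O] R)
  have hF : F.comp (PerfectClosure.of K p) = (MvPolynomial.aeval t : K →ₐ[GeomField O] R) :=
    (PerfectClosure.lift K p R).symm_apply_apply _
  refine ⟨{ F with commutes' := fun c => ?_ }, fun i => ?_, fun g hg => ?_⟩
  · have h1 := RingHom.congr_fun hF (algebraMap (GeomField O) K c)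
    exact h1.trans (AlgHom.commutes (MvPolynomial.aeval t) c)
  · have h1 := RingHom.congr_fun hF (MvPolynomial.X i)
    exact h1.trans (MvPolynomial.aeval_X t i)
  · have h1 : (g : PerfectClosure K p →+* R) = F := by
      refine (PerfectClosure.lift K p R).symm.injective ?_
      change (g : PerfectClosure K p →+* R).comp (PerfectClosure.of K p) =
        F.comp (PerfectClosure.of K p)
      rw [hF]
      refine MvPolynomial.ringHom_ext (fun c => ?_) fun i => ?_
      · exact (g.commutes c).trans (AlgHom.commutes (MvPolynomial.aeval t) c).symm
      · exact (hg i).trans (MvPolynomial.aeval_X t i).symm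
    exact AlgHom.ext fun a => RingHom.congr_fun h1 a

/-- A morphism `g : A → A'` of perfect algebras such that `Spec A' → Spec A` represents the
subfunctor of those `f : A → R` which satisfy `P`. -/
def IsLocus {A A' : PerfAlg O} (g : A →ₐ[GeomField O] A')
    (P : ∀ R : PerfAlg O, (A →ₐ[GeomField O] R) → Prop) : Prop :=
  P A' g ∧ ∀ (R : PerfAlg O) (f : A →ₐ[GeomField O] R), P R f →
    ∃! f' : A' →ₐ[GeomField O] R, f'.comp g = f

/-- The locus where the elements of a set vanish. -/
theorem exists_isLocus_zero (A : PerfAlg O) (s : Set A) : ∃ (A' : PerfAlg O)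
    (g : A →ₐ[GeomField O] A'), IsLocus g fun _ f => ∀ a ∈ s, f a = 0 := by
  refine ⟨A.quot _ (Ideal.radical_isRadical (Ideal.span s)), A.quotMk _ _, fun a ha => ?_,
    fun R f hf => ?_⟩
  · exact (A.quotMk_eq_zero_iff _ _ a).2 (Ideal.le_radical (Ideal.subset_span ha))
  · -- `f` kills the radical because `R` is reduced.
    have h1 : Ideal.span s ≤ RingHom.ker f := Ideal.span_le.2 hf
    have h2 : ∀ a ∈ (Ideal.span s).radical, f a = 0 := fun a ⟨n, hn⟩ => by
      have h3 : f (a ^ n) = 0 := h1 hn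
      rw [map_pow] at h3
      exact eq_zero_of_pow_eq_zero h3
    refine ⟨Ideal.Quotient.liftₐ _ f h2, ?_, fun f' hf' => ?_⟩
    · ext a
      rfl
    · refine AlgHom.ext fun b => ?_
      obtain ⟨a, rfl⟩ := Ideal.Quotient.mk_surjective b
      exact AlgHom.congr_fun hf' a

/-- The locus where an element is invertible. -/
theorem exists_isLocus_isUnit (A : PerfAlg O) (a : A) : ∃ (A' : PerfAlg O)
    (g : A →ₐ[GeomField O] A'), IsLocus g fun _ f => IsUnit (f a) := by
  have hp := (resCard_eq_pow O).1
  let L := Localization.Away a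
  have hcl : Function.Bijective (charFrob O L) := by
    constructor
    · rw [injective_iff_map_eq_zero]
      intro z hz
      obtain ⟨⟨b, s⟩, hbs⟩ := IsLocalization.surj (Submonoid.powers a) z
      obtain ⟨m, hm⟩ := s.2
      have hu : IsUnit (algebraMap A L s) := IsLocalization.map_units L s
      have h1 : algebraMap A L (b ^ ringChar (GeomField O)) = 0 := by
        rw [map_pow, ← hbs, mul_pow, ← charFrob_apply, hz, zero_mul]
      obtain ⟨⟨_, n, rfl⟩, hn⟩ := (IsLocalization.map_eq_zero_iff (Submonoid.powers a) L _).1 h1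
      have h2 : (a ^ n * b) ^ ringChar (GeomField O) = 0 := by
        obtain ⟨e, he⟩ := Nat.exists_eq_add_one_of_ne_zero hp.ne_zero
        have hn' : a ^ n * b ^ ringChar (GeomField O) = 0 := hn
        calc (a ^ n * b) ^ ringChar (GeomField O) =
            (a ^ n) ^ e * (a ^ n * b ^ ringChar (GeomField O)) := by rw [he]; ring
          _ = 0 := by rw [hn', mul_zero]
      have h3 : algebraMap A L b = 0 := (IsLocalization.map_eq_zero_iff (Submonoid.powers a) L _).2
        ⟨⟨_, n, rfl⟩, eq_zero_of_pow_eq_zero h2⟩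
      have h4 : z * algebraMap A L s = 0 := hbs.trans h3
      exact (hu.mul_left_eq_zero).1 h4
    · intro z
      obtain ⟨⟨b, s⟩, hbs⟩ := IsLocalization.surj (Submonoid.powers a) z
      obtain ⟨e, he⟩ := Nat.exists_eq_add_one_of_ne_zero hp.ne_zero
      obtain ⟨c, hc⟩ := A.perfect.surjective (b * (s : A) ^ e)
      have hu : IsUnit (algebraMap A L s) := IsLocalization.map_units L s
      obtain ⟨d, hd⟩ := hu.exists_right_inv
      refine ⟨algebraMap A L c * d, ?_⟩
      have hc' : c ^ ringChar (GeomField O) = b * (s : A) ^ e := hc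
      have hbs' : z * algebraMap A L s = algebraMap A L b := hbs
      rw [charFrob_apply, mul_pow, ← map_pow, hc', map_mul, map_pow, ← hbs', he]
      calc z * algebraMap A L s * algebraMap A L s ^ e * d ^ (e + 1) =
          z * (algebraMap A L s * d) ^ (e + 1) := by ring
        _ = z := by rw [hd, one_pow, mul_one]
  let A' : PerfAlg O := { carrier := L, perfect := hcl }
  let g : A →ₐ[GeomField O] A' := IsScalarTower.toAlgHom (GeomField O) A L
  refine ⟨A', g, IsLocalization.Away.algebraMap_isUnit a, fun R f hf => ?_⟩
  let F : L →+* R := IsLocalization.Away.lift a (g := (f : A →+* R)) hf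
  have hF : ∀ b, F (algebraMap A L b) = f b := fun b => IsLocalization.Away.lift_eq a hf b
  refine ⟨{ F with commutes' := fun c => ?_ }, ?_, fun f' hf' => ?_⟩
  · have h1 := hF (algebraMap (GeomField O) A c)
    exact h1.trans (f.commutes c)
  · exact AlgHom.ext hF
  · have h1 : (f' : L →+* R) = F := by
      refine IsLocalization.ringHom_ext (Submonoid.powers a) (RingHom.ext fun b => ?_)
      exact (AlgHom.congr_fun hf' b).trans (hF b).symm
    exact AlgHom.ext fun b => RingHom.congr_fun h1 b

end Representability

section WittLoci

variable {O : Type u} [CommRing O] [IsDomain O] [IsDiscreteValuationRing O]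
  [Finite (IsLocalRing.ResidueField O)] {ϖ : O} [hϖ : Fact (Irreducible ϖ)] {h : ℕ}
  {R S : PerfAlg O} {n₀ k₀ l i₀ j₀ : ℕ}

variable (ϖ) in
/-- The element with given Teichmüller components. -/
noncomputable def ofComps (t : Fin h → R) : TruncWitt O h R :=
  ∑ k : Fin h, ϖ ^ (k : ℕ) • teich (t k)

theorem wMapAlg_ofComps (f : R →ₐ[GeomField O] S) (t : Fin h → R) :
    wMapAlg h f (ofComps ϖ t) = ofComps ϖ fun k => f (t k) := by
  rw [ofComps, ofComps, map_sum]
  refine Finset.sum_congr rfl fun k _ => ?_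
  rw [map_smul]
  congr 1
  exact wMap_teich _ _

/-- The locus where two elements of `𝕎_h` agree. -/
theorem exists_isLocus_eq (A : PerfAlg O) (w w' : TruncWitt O h A) : ∃ (A' : PerfAlg O)
    (g : A →ₐ[GeomField O] A'), IsLocus g fun _ f => wMapAlg h f w = wMapAlg h f w' := by
  obtain ⟨ϖ, hϖ⟩ := IsDiscreteValuationRing.exists_irreducible O
  have := Fact.mk hϖ
  obtain ⟨t, rfl⟩ := (teich_expansion_bijective ϖ h A).surjective w
  obtain ⟨t', rfl⟩ := (teich_expansion_bijective ϖ h A).surjective w'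
  have key : ∀ (R : PerfAlg O) (f : A →ₐ[GeomField O] R),
      (∀ a ∈ Set.range fun k => t k - t' k, f a = 0) ↔
        wMapAlg h f (ofComps ϖ t) = wMapAlg h f (ofComps ϖ t') := by
    intro R f
    have h1 : ofComps ϖ (fun k => f (t k)) = ofComps ϖ (fun k => f (t' k)) ↔
        (fun k => f (t k)) = fun k => f (t' k) := (teich_expansion_bijective ϖ h R).injective.eq_iff
    rw [wMapAlg_ofComps, wMapAlg_ofComps, h1, Set.forall_mem_range, funext_iff]
    simp only [map_sub, sub_eq_zero]
  obtain ⟨A', g, hg, hu⟩ := exists_isLocus_zero A (Set.range fun k => t k - t' k)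
  exact ⟨A', g, (key _ _).1 hg, fun R f hf => hu R f ((key _ _).2 hf)⟩

variable (ϖ) in
/-- The vector with given Teichmüller components. -/
noncomputable def zOf {r : ℕ} (t : (Σ (_ : Fin r) (a : Fin n₀), Fin (lev h a)) → R) :
    Z n₀ r h R := fun ρ a => ofComps ϖ fun k => t ⟨ρ, a, k⟩

theorem zMap_zOf {r : ℕ} (f : R →ₐ[GeomField O] S)
    (t : (Σ (_ : Fin r) (a : Fin n₀), Fin (lev h a)) → R) :
    zMap f (zOf ϖ t) = zOf ϖ fun i => f (t i) := by
  funext ρ a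
  exact wMapAlg_ofComps f _

theorem zOf_bijective {r : ℕ} : Function.Bijective
    (zOf ϖ : ((Σ (_ : Fin r) (a : Fin n₀), Fin (lev h a)) → R) → Z n₀ r h R) := by
  constructor
  · intro t t' htt
    funext ⟨ρ, a, k⟩
    have h1 : ofComps ϖ (fun k => t ⟨ρ, a, k⟩) = ofComps ϖ (fun k => t' ⟨ρ, a, k⟩) :=
      congrFun (congrFun htt ρ) a
    exact congrFun ((teich_expansion_bijective ϖ (lev h a) R).injective h1) k
  · intro x
    choose t ht using fun ρ a => (teich_expansion_bijective ϖ (lev h a) R).surjective (x ρ a)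
    exact ⟨fun i => t i.1 i.2.1 i.2.2, funext fun ρ => funext fun a => ht ρ a⟩

theorem zMap_comp {T : PerfAlg O} {r : ℕ} (g : S →ₐ[GeomField O] T) (f : R →ₐ[GeomField O] S)
    (x : Z n₀ r h R) : zMap (g.comp f) x = zMap g (zMap f x) := by
  funext ρ a
  exact wMap_comp (f.restrictScalars O) (g.restrictScalars O) (x ρ a)

variable (O) in
/-- The functor `Z_{n₀,i₀,h} × Z_{n₀,j₀,h}` is representable. -/
theorem exists_represents_Z_prod (n₀ i₀ j₀ h : ℕ) : ∃ (A : PerfAlg O)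
    (ζ : Z n₀ i₀ h A × Z n₀ j₀ h A), ∀ R : PerfAlg O, Function.Bijective
      fun f : A →ₐ[GeomField O] R => Prod.map (zMap f) (zMap f) ζ := by
  obtain ⟨ϖ, hϖ⟩ := IsDiscreteValuationRing.exists_irreducible O
  have := Fact.mk hϖ
  obtain ⟨A, v, hv⟩ := exists_free O ((Σ (_ : Fin i₀) (a : Fin n₀), Fin (lev h a)) ⊕
    (Σ (_ : Fin j₀) (a : Fin n₀), Fin (lev h a)))
  refine ⟨A, (zOf ϖ fun i => v (Sum.inl i), zOf ϖ fun i => v (Sum.inr i)), fun R => ⟨?_, ?_⟩⟩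
  · intro f f' hff
    simp only [Prod.map_apply, zMap_zOf, Prod.mk.injEq] at hff
    have h1 := zOf_bijective.injective hff.1
    have h2 := zOf_bijective.injective hff.2
    refine (hv R fun i => f' (v i)).unique (fun i => ?_) fun i => rfl
    rcases i with i | i
    · exact congrFun h1 i
    · exact congrFun h2 i
  · rintro ⟨x, y⟩
    obtain ⟨t, rfl⟩ := (zOf_bijective (ϖ := ϖ)).surjective x
    obtain ⟨t', rfl⟩ := (zOf_bijective (ϖ := ϖ)).surjective y
    obtain ⟨f, hf, -⟩ := hv R (Sum.elim t t')
    refine ⟨f, ?_⟩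
    simp only [Prod.map_apply, zMap_zOf, hf]
    rfl

end WittLoci

section RepresentingAlgebras

section Loci

variable {O : Type u} [CommRing O] [IsLocalRing O] [Finite (IsLocalRing.ResidueField O)]

theorem IsLocus.comp {A A' A'' : PerfAlg O} {g : A →ₐ[GeomField O] A'} {g' : A' →ₐ[GeomField O] A''}
    {P Q₀ : ∀ R : PerfAlg O, (A →ₐ[GeomField O] R) → Prop}
    {Q : ∀ R : PerfAlg O, (A' →ₐ[GeomField O] R) → Prop} (hg : IsLocus g P) (hg' : IsLocus g' Q)
    (hP : ∀ (R S : PerfAlg O) (f : A →ₐ[GeomField O] R) (φ : R →ₐ[GeomField O] S),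
      P R f → P S (φ.comp f))
    (hQ : ∀ (R : PerfAlg O) (f : A' →ₐ[GeomField O] R), Q R f ↔ Q₀ R (f.comp g)) :
    IsLocus (g'.comp g) fun R f => P R f ∧ Q₀ R f := by
  refine ⟨⟨hP _ _ _ _ hg.1, (hQ _ _).1 hg'.1⟩, fun R f hf => ?_⟩
  obtain ⟨f', rfl, huf'⟩ := hg.2 R f hf.1
  obtain ⟨f'', rfl, huf''⟩ := hg'.2 R f' ((hQ _ _).2 hf.2)
  refine ⟨f'', (AlgHom.comp_assoc _ _ _).symm, fun e he => huf'' e (huf' _ ?_)⟩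
  rw [AlgHom.comp_assoc]
  exact he

/-- If `Spec A` represents a functor, then a locus in `Spec A` represents the corresponding
subfunctor. -/
theorem IsLocus.bijOn {F : PerfAlg O → Type*} {A A' : PerfAlg O} {g : A →ₐ[GeomField O] A'}
    {m : ∀ R : PerfAlg O, (A →ₐ[GeomField O] R) → F R} (hm : ∀ R, Function.Bijective (m R))
    {X : ∀ R : PerfAlg O, Set (F R)} (hg : IsLocus g fun R f => m R f ∈ X R)
    (hX : ∀ (R S : PerfAlg O) (f : A →ₐ[GeomField O] R) (φ : R →ₐ[GeomField O] S),
      m R f ∈ X R → m S (φ.comp f) ∈ X S) (R : PerfAlg O) :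
    Set.BijOn (fun f : A' →ₐ[GeomField O] R => m R (f.comp g)) Set.univ (X R) := by
  refine ⟨fun f _ => hX _ _ g f hg.1, fun f _ f' _ hff => ?_, fun x hx => ?_⟩
  · exact (hg.2 R (f'.comp g) (hX _ _ g f' hg.1)).unique ((hm R).injective hff) rfl
  · obtain ⟨f, rfl⟩ := (hm R).surjective x
    obtain ⟨f', hf', -⟩ := hg.2 R f hx
    exact ⟨f', Set.mem_univ _, congrArg (m R) hf'⟩

end Loci

variable {O : Type u} [CommRing O] [IsDomain O] [IsDiscreteValuationRing O]
  [Finite (IsLocalRing.ResidueField O)] {ϖ : O} [hϖ : Fact (Irreducible ϖ)] {h : ℕ} [NeZero h]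
  {R S : PerfAlg O} {n₀ k₀ l i₀ j₀ : ℕ}

/-- The locus where one element of `𝕎_h` is invertible and two other elements agree. -/
theorem exists_isLocus_isUnit_and_eq (A : PerfAlg O) (w w₁ w₂ : TruncWitt O h A) :
    ∃ (A' : PerfAlg O) (g : A →ₐ[GeomField O] A'), IsLocus g fun _ f =>
      IsUnit (wMapAlg h f w) ∧ wMapAlg h f w₁ = wMapAlg h f w₂ := by
  have hunit : ∀ (R : PerfAlg O) (f : A →ₐ[GeomField O] R),
      IsUnit (f (res w)) ↔ IsUnit (wMapAlg h f w) := fun R f => by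
    rw [isUnit_iff_res, wMapAlg_apply, res_wMap]
  obtain ⟨A₁, g₁, hg₁⟩ := exists_isLocus_isUnit A (res w)
  obtain ⟨A₂, g₂, hg₂⟩ := exists_isLocus_eq A₁ (wMapAlg h g₁ w₁) (wMapAlg h g₁ w₂)
  have h1 := hg₁.comp hg₂ (Q₀ := fun _ f => wMapAlg h f w₁ = wMapAlg h f w₂)
    (fun R S f φ hf => hf.map φ) fun R f => by rw [wMapAlg_comp, wMapAlg_comp]
  refine ⟨A₂, g₂.comp g₁, ⟨⟨(hunit _ _).1 h1.1.1, h1.1.2⟩, fun R f hf => ?_⟩⟩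
  exact h1.2 R f ⟨(hunit _ _).2 hf.1, hf.2⟩

/-- `X_h` is an affine perfect scheme. -/
theorem exists_representsX (hc : Nat.Coprime k₀ n₀) (r : ℕ) :
    ∃ (A : PerfAlg O) (ξ : Z n₀ r h A), RepresentsX ϖ n₀ k₀ r h A ξ := by
  obtain ⟨A, ζ, hζ⟩ := exists_represents_Z_prod O n₀ r 0 h
  obtain ⟨A', g, hg⟩ := exists_isLocus_isUnit_and_eq A (detG ϖ k₀ ζ.1)
    (sigma (detG ϖ k₀ ζ.1)) (detG ϖ k₀ ζ.1)
  have hm : ∀ R : PerfAlg O, Function.Bijective fun f : A →ₐ[GeomField O] R => zMap f ζ.1 := by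
    intro R
    refine ⟨fun f f' hff => (hζ R).injective ?_, fun x => ?_⟩
    · exact Prod.ext hff (funext fun i => i.elim0)
    · obtain ⟨f, hf⟩ := (hζ R).surjective (x, fun i => i.elim0)
      exact ⟨f, congrArg Prod.fst hf⟩
  have hcond : ∀ (R : PerfAlg O) (f : A →ₐ[GeomField O] R), zMap f ζ.1 ∈ X n₀ r h R ϖ k₀ ↔
      IsUnit (wMapAlg h f (detG ϖ k₀ ζ.1)) ∧
        wMapAlg h f (sigma (detG ϖ k₀ ζ.1)) = wMapAlg h f (detG ϖ k₀ ζ.1) := by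
    intro R f
    have h1 : wMapAlg h f (sigma (detG ϖ k₀ ζ.1)) = sigma (wMapAlg h f (detG ϖ k₀ ζ.1)) :=
      wMap_sigma f _
    have h2 := detG_zMap (ϖ := ϖ) hc f ζ.1
    rw [h1, ← h2]
    rfl
  simp only [← hcond] at hg
  refine ⟨A', zMap g ζ.1, fun R => ?_⟩
  have h1 := hg.bijOn (F := fun R => Z n₀ r h R) (m := fun R f => zMap f ζ.1)
    (X := fun R => X n₀ r h R ϖ k₀) hm
    (fun R S f φ hf => by rw [zMap_comp]; exact zMap_mem_X hc φ hf) R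
  simp only [zMap_comp] at h1
  exact h1

/-- The condition on the quotient in the definition of the target is an equation. -/
theorem mem_Target_iff (y : Z n₀ i₀ h R × Z n₀ j₀ h R) :
    y ∈ Target n₀ i₀ j₀ h R ϖ k₀ ↔ IsUnit (detG ϖ k₀ y.1 * detG ϖ k₀ y.2) ∧
      sigma (detG ϖ k₀ y.1) * ∏ j ∈ Finset.Icc 1 (n₀ * i₀ - 1), sigma^[j] (detG ϖ k₀ y.2) =
        detG ϖ k₀ y.1 *
          sigma (∏ j ∈ Finset.Icc 1 (n₀ * i₀ - 1), sigma^[j] (detG ϖ k₀ y.2)) := by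
  set M := detG ϖ k₀ y.1 with hM
  set P := ∏ j ∈ Finset.Icc 1 (n₀ * i₀ - 1), sigma^[j] (detG ϖ k₀ y.2) with hP
  constructor
  · rintro ⟨h1, h2, c, ⟨-, hc⟩, h4⟩
    have h4' : M = c * P := h4
    refine ⟨IsUnit.mul h1 h2, ?_⟩
    rw [h4', map_mul, hc, mul_assoc, mul_assoc, mul_comm P]
  · rintro ⟨h1, h2⟩
    have hMu : IsUnit M := isUnit_of_mul_isUnit_left h1
    have hTu : IsUnit (detG ϖ k₀ y.2) := isUnit_of_mul_isUnit_right h1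
    have hPu : IsUnit P := by
      refine IsUnit.prod_iff.2 fun j _ => ?_
      have h3 := hTu.map (sigmaAlg h R ^ j)
      rw [AlgHom.coe_pow, coe_sigmaAlg] at h3
      exact h3
    obtain ⟨d, hd⟩ := hPu.exists_right_inv
    have hdu : IsUnit d := IsUnit.of_mul_eq_one _ ((mul_comm d P).trans hd)
    refine ⟨hMu, hTu, M * d, ⟨hMu.mul hdu, ?_⟩, ?_⟩
    · have h3 : sigma P * sigma d = 1 := by rw [← map_mul, hd, map_one]
      rw [map_mul]
      linear_combination (sigma d * d) * h2 - (sigma M * sigma d) * hd + M * d * h3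
    · change M = M * d * P
      rw [mul_assoc, mul_comm d, hd, mul_one]

/-- The target is an affine perfect scheme. -/
theorem exists_representsTarget (hc : Nat.Coprime k₀ n₀) (i₀ j₀ : ℕ) :
    ∃ (B : PerfAlg O) (ζ : Z n₀ i₀ h B × Z n₀ j₀ h B),
      RepresentsTarget ϖ n₀ k₀ i₀ j₀ h B ζ := by
  obtain ⟨A, ζ, hζ⟩ := exists_represents_Z_prod O n₀ i₀ j₀ h
  set P := ∏ j ∈ Finset.Icc 1 (n₀ * i₀ - 1), sigma^[j] (detG ϖ k₀ ζ.2) with hP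
  obtain ⟨A', g, hg⟩ := exists_isLocus_isUnit_and_eq A (detG ϖ k₀ ζ.1 * detG ϖ k₀ ζ.2)
    (sigma (detG ϖ k₀ ζ.1) * P) (detG ϖ k₀ ζ.1 * sigma P)
  have hcond : ∀ (R : PerfAlg O) (f : A →ₐ[GeomField O] R),
      Prod.map (zMap f) (zMap f) ζ ∈ Target n₀ i₀ j₀ h R ϖ k₀ ↔
      IsUnit (wMapAlg h f (detG ϖ k₀ ζ.1 * detG ϖ k₀ ζ.2)) ∧
        wMapAlg h f (sigma (detG ϖ k₀ ζ.1) * P) = wMapAlg h f (detG ϖ k₀ ζ.1 * sigma P) := by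
    intro R f
    have h1 : ∀ w, wMapAlg h f (sigma w) = sigma (wMapAlg h f w) := fun w => wMap_sigma f w
    have h2 := detG_zMap (ϖ := ϖ) hc f ζ.1
    have h3 := detG_zMap (ϖ := ϖ) hc f ζ.2
    have h4 : wMapAlg h f P =
        ∏ j ∈ Finset.Icc 1 (n₀ * i₀ - 1), sigma^[j] (detG ϖ k₀ (zMap f ζ.2)) := by
      rw [hP, map_prod, h3]
      exact Finset.prod_congr rfl fun j _ => wMap_sigma_iterate f j _
    rw [mem_Target_iff, map_mul, map_mul, map_mul, h1, h1, h4, ← h2, ← h3]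
    rfl
  simp only [← hcond] at hg
  refine ⟨A', Prod.map (zMap g) (zMap g) ζ, fun R => ?_⟩
  have h1 := hg.bijOn (F := fun R => Z n₀ i₀ h R × Z n₀ j₀ h R)
    (m := fun R f => Prod.map (zMap f) (zMap f) ζ)
    (X := fun R => Target n₀ i₀ j₀ h R ϖ k₀) hζ
    (fun R S f φ hf => by
      have h2 := map_mem_Target hc φ hf
      simp only [Prod.map_apply', zMap_comp] at h2 ⊢
      exact h2) R
  simp only [Prod.map_apply', zMap_comp] at h1 ⊢
  exact h1

end RepresentingAlgebras

/-! ### Descent along covers -/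

section Descent

open TensorProduct

variable {O : Type u} [CommRing O] [IsLocalRing O] [Finite (IsLocalRing.ResidueField O)]

theorem charFrob_iterate (A : Type*) [CommRing A] [Algebra (GeomField O) A] (N : ℕ) (a : A) :
    (charFrob O A)^[N] a = a ^ ringChar (GeomField O) ^ N := by
  induction N with
  | zero => rw [pow_zero, pow_one]; rfl
  | succ N ih => rw [Function.iterate_succ_apply', ih, charFrob_apply, ← pow_mul, pow_succ]

variable (O) in
/-- The inverse of the `p ^ N`-Frobenius of a perfect algebra. -/
theorem PerfAlg.exists_root_hom (E : PerfAlg O) (N : ℕ) :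
    ∃ θ : E →+* E, ∀ a, θ (a ^ ringChar (GeomField O) ^ N) = a := by
  let e : E ≃+* E := RingEquiv.ofBijective (charFrob O E) E.perfect
  refine ⟨((e ^ N)⁻¹ : E ≃+* E), fun a => ?_⟩
  have h1 : ∀ N, (e ^ N) a = a ^ ringChar (GeomField O) ^ N := by
    intro N
    rw [← charFrob_iterate]
    induction N with
    | zero => rfl
    | succ N ih =>
      rw [pow_succ', Function.iterate_succ_apply', ← ih]
      rfl
  rw [← h1]
  exact (e ^ N).symm_apply_apply a

/-- Let `ι : B → E` be a cover. An element `z` of `E` comes from `B` as soon as its values at two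
geometric points of `E` over the same point of `B` agree. Indeed `z ⊗ 1 - 1 ⊗ z` is then nilpotent
in `E ⊗_B E`, so that a power `z ^ p ^ N` satisfies `z ^ p ^ N ⊗ 1 = 1 ⊗ z ^ p ^ N`; now the
Frobenius can be inverted on both factors, and the retraction can be applied to the first one. -/
theorem IsCover.exists_eq {B E : PerfAlg O} {ι : B →ₐ[GeomField O] E} (hι : IsCover ι) {z : E}
    (hz : ∀ k : PerfAlg O, k.IsGeom → ∀ f₁ f₂ : E →ₐ[GeomField O] k,
      f₁.comp ι = f₂.comp ι → f₁ z = f₂ z) : ∃ b, z = ι b := by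
  obtain ⟨π, hπ, hπ1⟩ := hι.exists_retraction
  refine ⟨π z, ?_⟩
  algebraize [(ι : B →+* E)]
  have : IsScalarTower (GeomField O) B E := IsScalarTower.of_algebraMap_eq fun c =>
    (ι.commutes c).symm
  have halg : ∀ (b : B) (y : E), b • y = ι b * y := fun b y => Algebra.smul_def b y
  have hnil : IsNilpotent (z ⊗ₜ[B] (1 : E) - (1 : E) ⊗ₜ[B] z) := by
    refine isNilpotent_of_geomPoint (O := O) fun k hk f => ?_
    let f₁ : E →ₐ[GeomField O] k := f.comp Algebra.TensorProduct.includeLeft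
    let f₂ : E →ₐ[GeomField O] k := f.comp
      ((Algebra.TensorProduct.includeRight : E →ₐ[B] E ⊗[B] E).restrictScalars (GeomField O))
    have h1 := hz k hk f₁ f₂ (AlgHom.ext fun b => by
      change f (ι b ⊗ₜ[B] (1 : E)) = f ((1 : E) ⊗ₜ[B] ι b)
      rw [← mul_one (ι b), ← halg, TensorProduct.smul_tmul])
    rw [map_sub, sub_eq_zero]
    exact h1
  obtain ⟨N, hN⟩ := hnil
  have hP : (z ⊗ₜ[B] (1 : E) - (1 : E) ⊗ₜ[B] z) ^ ringChar (GeomField O) ^ N = 0 :=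
    pow_eq_zero_of_le (Nat.lt_pow_self (resCard_eq_pow O).1.one_lt).le hN
  rw [← charFrob_iterate, iterate_map_sub, charFrob_iterate, charFrob_iterate,
    Algebra.TensorProduct.tmul_pow, Algebra.TensorProduct.tmul_pow, one_pow, sub_eq_zero] at hP
  obtain ⟨θ, hθ⟩ := E.exists_root_hom O N
  obtain ⟨θ', hθ'⟩ := B.exists_root_hom O N
  have hθι : ∀ b, θ (ι b) = ι (θ' b) := fun b => by
    obtain ⟨c, hc⟩ := (B.perfect.surjective.iterate N) b
    rw [pow_iterate] at hc
    rw [← hc, hθ', map_pow, hθ]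
  let F : E →+ E →+ E := AddMonoidHom.mk'
    (fun x => (AddMonoidHom.mulLeft (ι (π (θ x)))).comp (θ : E →+ E)) fun x y => by
      ext w
      simp only [map_add, AddMonoidHom.comp_apply, AddMonoidHom.coe_mulLeft, AddMonoidHom.add_apply,
        add_mul]
  have hF : ∀ x y, F x y = ι (π (θ x)) * θ y := fun _ _ => rfl
  have h2 := congrArg (TensorProduct.liftAddHom F fun b x y => by
    rw [hF, hF, halg, halg, map_mul θ (ι b) x, map_mul θ (ι b) y, hθι, hπ, map_mul ι,
      mul_assoc, mul_left_comm]) hP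
  rw [TensorProduct.liftAddHom_tmul, TensorProduct.liftAddHom_tmul, hF, hF, hθ, map_one, mul_one,
    hπ1, map_one, one_mul] at h2
  exact h2.symm

end Descent

/-! ### The quotient of `X_h` -/

section QuotientMap

variable {O : Type u} [CommRing O] [IsDomain O] [IsDiscreteValuationRing O]
  [Finite (IsLocalRing.ResidueField O)] {ϖ : O} [hϖ : Fact (Irreducible ϖ)] {h : ℕ} [NeZero h]
  {n₀ k₀ l i₀ j₀ : ℕ} {A B : PerfAlg O} {ξ : Z n₀ (i₀ + j₀) h A}
  {ζ : Z n₀ i₀ h B × Z n₀ j₀ h B} {φ : B →ₐ[GeomField O] A}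

theorem zMap_id {R : PerfAlg O} {r : ℕ} (x : Z n₀ r h R) : zMap (AlgHom.id (GeomField O) R) x = x := by
  funext ρ a
  exact wMap_id _

theorem RepresentsX.mem (hA : RepresentsX ϖ n₀ k₀ (i₀ + j₀) h A ξ) :
    ξ ∈ X n₀ (i₀ + j₀) h A ϖ k₀ := by
  have h1 := (hA A).mapsTo (Set.mem_univ (AlgHom.id (GeomField O) A))
  rw [zMap_id] at h1
  exact h1

theorem RepresentsTarget.mem (hB : RepresentsTarget ϖ n₀ k₀ i₀ j₀ h B ζ) :
    ζ ∈ Target n₀ i₀ j₀ h B ϖ k₀ := by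
  have h1 := (hB B).mapsTo (Set.mem_univ (AlgHom.id (GeomField O) B))
  simp only [Prod.map_apply', zMap_id] at h1
  exact h1

theorem RepresentsX.hom_ext (hA : RepresentsX ϖ n₀ k₀ (i₀ + j₀) h A ξ) {R : PerfAlg O}
    {f g : A →ₐ[GeomField O] R} (hfg : zMap f ξ = zMap g ξ) : f = g :=
  (hA R).injOn (Set.mem_univ f) (Set.mem_univ g) hfg

theorem RepresentsTarget.hom_ext (hB : RepresentsTarget ϖ n₀ k₀ i₀ j₀ h B ζ) {R : PerfAlg O}
    {f g : B →ₐ[GeomField O] R}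
    (hfg : Prod.map (zMap f) (zMap f) ζ = Prod.map (zMap g) (zMap g) ζ) : f = g :=
  (hB R).injOn (Set.mem_univ f) (Set.mem_univ g) hfg

theorem act_mem_X (hc : Nat.Coprime k₀ n₀) (hn : 0 < n₀) (hi₀ : 0 < i₀)
    (hl : k₀ * l ≡ 1 [MOD n₀]) {R : PerfAlg O} {x : Z n₀ (i₀ + j₀) h R}
    (hx : x ∈ X n₀ (i₀ + j₀) h R ϖ k₀)
    {u : Fin i₀ → Fin j₀ → (t : Fin n₀) → TruncWitt O (lev h t) (PerfAlg.base O)}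
    (hu : u ∈ N O n₀ i₀ j₀ h) : act ϖ k₀ l u x ∈ X n₀ (i₀ + j₀) h R ϖ k₀ := by
  rw [mem_X_iff hc hn hi₀] at hx ⊢
  rwa [alpha_act hc hn hl hu]

theorem mem_invariants_iff {a : A} : a ∈ invariants ϖ k₀ l A ξ ↔
    ∀ u ∈ N O n₀ i₀ j₀ h, ∀ ψ : A →ₐ[GeomField O] A, zMap ψ ξ = act ϖ k₀ l u ξ → ψ a = a := by
  simp only [invariants, Algebra.mem_iInf, AlgHom.mem_equalizer, AlgHom.id_apply]

theorem map_comp_eq (hc : Nat.Coprime k₀ n₀)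
    (hφ : Prod.map (zMap φ) (zMap φ) ζ = alpha ϖ k₀ ξ) {R : PerfAlg O} (f : A →ₐ[GeomField O] R) :
    Prod.map (zMap (f.comp φ)) (zMap (f.comp φ)) ζ = alpha ϖ k₀ (zMap f ξ) := by
  rw [alpha_zMap hc, ← hφ]
  simp only [Prod.map_apply', zMap_comp]

theorem apply_mem_invariants (hc : Nat.Coprime k₀ n₀) (hn : 0 < n₀) (hl : k₀ * l ≡ 1 [MOD n₀])
    (hB : RepresentsTarget ϖ n₀ k₀ i₀ j₀ h B ζ)
    (hφ : Prod.map (zMap φ) (zMap φ) ζ = alpha ϖ k₀ ξ) (b : B) :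
    φ b ∈ invariants ϖ k₀ l A ξ := by
  rw [mem_invariants_iff]
  intro u hu ψ hψ
  have h1 : ψ.comp φ = φ := hB.hom_ext (by
    rw [map_comp_eq hc hφ, hψ, alpha_act hc hn hl hu, hφ])
  exact AlgHom.congr_fun h1 b

/-- The values of an invariant function at two geometric points of `X_h` agree if these have the same
image in the target, because the fibres are orbits. -/
theorem apply_eq_of_comp_eq (hc : Nat.Coprime k₀ n₀) (hn : 0 < n₀) (hi₀ : 0 < i₀)
    (hl : k₀ * l ≡ 1 [MOD n₀]) (hA : RepresentsX ϖ n₀ k₀ (i₀ + j₀) h A ξ)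
    (hφ : Prod.map (zMap φ) (zMap φ) ζ = alpha ϖ k₀ ξ) {a : A}
    (ha : a ∈ invariants ϖ k₀ l A ξ) {k : PerfAlg O} (hk : k.IsGeom) {f g : A →ₐ[GeomField O] k}
    (hfg : f.comp φ = g.comp φ) : f a = g a := by
  have h1 : alpha ϖ k₀ (zMap f ξ) = alpha ϖ k₀ (zMap g ξ) := by
    rw [← map_comp_eq hc hφ, ← map_comp_eq hc hφ, hfg]
  have h2 := (mem_X_iff hc hn hi₀ _).1 (zMap_mem_X hc f hA.mem)
  obtain ⟨u, hu, hug⟩ := exists_act_eq hk.isField hc hn hl h2.2.1 h1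
  obtain ⟨ψ, -, hψ⟩ := (hA A).surjOn (act_mem_X hc hn hi₀ hl hA.mem hu)
  have h3 : f = g.comp ψ := hA.hom_ext (by
    rw [zMap_comp]
    have h4 : zMap ψ ξ = act ϖ k₀ l u ξ := hψ
    rw [h4, ← act_zMap hc, hug])
  rw [h3, AlgHom.comp_apply, mem_invariants_iff.1 ha u hu ψ hψ]

theorem bijective_codRestrict (hc : Nat.Coprime k₀ n₀) (hn : 0 < n₀) (hi₀ : 0 < i₀) (hj₀ : 0 < j₀)
    (hl : k₀ * l ≡ 1 [MOD n₀]) (hA : RepresentsX ϖ n₀ k₀ (i₀ + j₀) h A ξ)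
    (hB : RepresentsTarget ϖ n₀ k₀ i₀ j₀ h B ζ)
    (hφ : Prod.map (zMap φ) (zMap φ) ζ = alpha ϖ k₀ ξ)
    (hinv : ∀ b, φ b ∈ invariants ϖ k₀ l A ξ) :
    Function.Bijective (φ.codRestrict (invariants ϖ k₀ l A ξ) hinv) := by
  obtain ⟨E, ι, hι, x, hx, hxζ⟩ := exists_cover_alpha hc hn hi₀ hj₀ hB.mem
  obtain ⟨g, -, hg⟩ := (hA E).surjOn hx
  have hg' : zMap g ξ = x := hg
  have hgφ : g.comp φ = ι := hB.hom_ext (by rw [map_comp_eq hc hφ, hg', hxζ])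
  constructor
  · intro b b' hbb
    have h1 : φ b = φ b' := congrArg Subtype.val hbb
    have h2 : ι b = ι b' := by rw [← hgφ, AlgHom.comp_apply, AlgHom.comp_apply, h1]
    obtain ⟨π, hπ, hπ1⟩ := hι.exists_retraction
    have h3 : π (ι b * 1) = π (ι b' * 1) := by rw [h2]
    rwa [hπ, hπ, hπ1, mul_one, mul_one] at h3
  · rintro ⟨a, ha⟩
    obtain ⟨b, hb⟩ := hι.exists_eq (z := g a) fun k hk f₁ f₂ hf =>
      apply_eq_of_comp_eq hc hn hi₀ hl hA hφ ha hk (f := f₁.comp g) (g := f₂.comp g) (by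
        rw [AlgHom.comp_assoc, AlgHom.comp_assoc, hgφ, hf])
    refine ⟨b, Subtype.ext ?_⟩
    change φ b = a
    refine (sub_eq_zero.1 ?_).symm
    refine (isNilpotent_of_geomPoint (O := O) fun k hk f => ?_).eq_zero
    obtain ⟨e, he⟩ := hι.exists_lift k hk (f.comp φ)
    have h1 := apply_eq_of_comp_eq hc hn hi₀ hl hA hφ ha hk (f := f) (g := e.comp g) (by
      rw [AlgHom.comp_assoc, hgφ, he])
    rw [map_sub, h1, AlgHom.comp_apply, hb, ← AlgHom.comp_apply, he, AlgHom.comp_apply, sub_self]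

theorem isIso_quotientMap (hinv : ∀ b, φ b ∈ invariants ϖ k₀ l A ξ)
    (hbij : Function.Bijective (φ.codRestrict (invariants ϖ k₀ l A ξ) hinv)) :
    IsIso (quotientMap ϖ k₀ l A ξ φ hinv) := by
  have h1 : IsIso (CommRingCat.ofHom
      (φ.codRestrict (invariants ϖ k₀ l A ξ) hinv).toRingHom) :=
    (RingEquiv.ofBijective
      (φ.codRestrict (invariants ϖ k₀ l A ξ) hinv).toRingHom hbij).toCommRingCatIso.isIso_hom
  have h2 : IsIso (Spec.map (CommRingCat.ofHom
      (φ.codRestrict (invariants ϖ k₀ l A ξ) hinv).toRingHom)) := inferInstance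
  exact h2

end QuotientMap

end LoopDL

theorem mainTheorem9 {K : Type*} [Field K] [ValuativeRel K] [TopologicalSpace K]
    [IsNonarchimedeanLocalField K] (ϖ : 𝒪[K]) (hϖ : Irreducible ϖ)
    (n κ n₀ k₀ i₀ j₀ l h : ℕ) (hn : 2 ≤ n) (hκ : κ < n)
    -- `n' = gcd(n, κ) = i₀ + j₀`, `n = n' n₀`, `κ = n' k₀`
    (hgcd : Nat.gcd n κ = i₀ + j₀) (hn₀ : n = (i₀ + j₀) * n₀) (hk₀ : κ = (i₀ + j₀) * k₀)
    (hi₀ : 1 ≤ i₀) (hj₀ : 1 ≤ j₀) (hl : k₀ * l ≡ 1 [MOD n₀]) (hh : 1 ≤ h) :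
    -- the source and the target are affine perfect schemes
    (∃ (A : LoopDL.PerfAlg 𝒪[K]) (ξ : LoopDL.Z n₀ (i₀ + j₀) h A),
      LoopDL.RepresentsX ϖ n₀ k₀ (i₀ + j₀) h A ξ) ∧
    (∃ (B : LoopDL.PerfAlg 𝒪[K]) (ζ : LoopDL.Z n₀ i₀ h B × LoopDL.Z n₀ j₀ h B),
      LoopDL.RepresentsTarget ϖ n₀ k₀ i₀ j₀ h B ζ) ∧
    -- `N_h` is finite and acts on `X_h`
    Finite (LoopDL.N 𝒪[K] n₀ i₀ j₀ h) ∧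
    (∀ (R : LoopDL.PerfAlg 𝒪[K]), ∀ x ∈ LoopDL.X n₀ (i₀ + j₀) h R ϖ k₀,
      LoopDL.act ϖ k₀ l 0 x = x ∧
      ∀ u ∈ LoopDL.N 𝒪[K] n₀ i₀ j₀ h,
        LoopDL.act ϖ k₀ l u x ∈ LoopDL.X n₀ (i₀ + j₀) h R ϖ k₀ ∧
        (∀ v ∈ LoopDL.N 𝒪[K] n₀ i₀ j₀ h,
          LoopDL.act ϖ k₀ l (u + v) x = LoopDL.act ϖ k₀ l u (LoopDL.act ϖ k₀ l v x)) ∧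
        ∀ (S : LoopDL.PerfAlg 𝒪[K]) (f : R →ₐ[LoopDL.GeomField 𝒪[K]] S),
          LoopDL.act ϖ k₀ l u (LoopDL.zMap f x) = LoopDL.zMap f (LoopDL.act ϖ k₀ l u x)) ∧
    -- `x ↦ (m, x')` is an `N_h`-invariant morphism from `X_h` to the target
    (∀ (R : LoopDL.PerfAlg 𝒪[K]), ∀ x ∈ LoopDL.X n₀ (i₀ + j₀) h R ϖ k₀,
      LoopDL.alpha ϖ k₀ x ∈ LoopDL.Target n₀ i₀ j₀ h R ϖ k₀ ∧
      (∀ (S : LoopDL.PerfAlg 𝒪[K]) (f : R →ₐ[LoopDL.GeomField 𝒪[K]] S),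
        LoopDL.alpha ϖ k₀ (LoopDL.zMap f x) =
          Prod.map (LoopDL.zMap f) (LoopDL.zMap f) (LoopDL.alpha ϖ k₀ x)) ∧
      ∀ u ∈ LoopDL.N 𝒪[K] n₀ i₀ j₀ h,
        LoopDL.alpha ϖ k₀ (LoopDL.act ϖ k₀ l u x) = LoopDL.alpha ϖ k₀ x) ∧
    -- the morphism from `N_h \ X_h` to the target which it induces is an isomorphism of schemes
    (∀ (A : LoopDL.PerfAlg 𝒪[K]) (ξ : LoopDL.Z n₀ (i₀ + j₀) h A),
      LoopDL.RepresentsX ϖ n₀ k₀ (i₀ + j₀) h A ξ →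
      ∀ (B : LoopDL.PerfAlg 𝒪[K]) (ζ : LoopDL.Z n₀ i₀ h B × LoopDL.Z n₀ j₀ h B),
        LoopDL.RepresentsTarget ϖ n₀ k₀ i₀ j₀ h B ζ →
        ∃ (φ : B →ₐ[LoopDL.GeomField 𝒪[K]] A)
          (hφ : ∀ b, φ b ∈ LoopDL.invariants ϖ k₀ l A ξ),
          Prod.map (LoopDL.zMap φ) (LoopDL.zMap φ) ζ = LoopDL.alpha ϖ k₀ ξ ∧
          IsIso (LoopDL.quotientMap ϖ k₀ l A ξ φ hφ)) := by
  have hn₀' : 0 < n₀ := Nat.pos_of_ne_zero fun h0 => by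
    rw [hn₀, h0, mul_zero] at hn
    omega
  have hc : Nat.Coprime k₀ n₀ := Nat.coprime_of_mul_modEq_one l hl
  have : Fact (Irreducible ϖ) := ⟨hϖ⟩
  have : NeZero h := ⟨by omega⟩
  refine ⟨LoopDL.exists_representsX hc _, LoopDL.exists_representsTarget hc _ _,
    LoopDL.finite_N hn₀', fun R x hx => ⟨LoopDL.act_zero hc x, fun u hu =>
      ⟨LoopDL.act_mem_X hc hn₀' hi₀ hl hx hu, fun v _ => LoopDL.act_add hc u v x,
        fun S f => LoopDL.act_zMap hc u f x⟩⟩,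
    fun R x hx => ⟨(LoopDL.mem_X_iff hc hn₀' hi₀ x).1 hx, fun S f => LoopDL.alpha_zMap hc f x,
      fun u hu => LoopDL.alpha_act hc hn₀' hl hu x⟩, fun A ξ hA B ζ hB => ?_⟩
  obtain ⟨φ, -, hφ⟩ := (hB A).surjOn ((LoopDL.mem_X_iff hc hn₀' hi₀ ξ).1 hA.mem)
  exact ⟨φ, LoopDL.apply_mem_invariants hc hn₀' hl hB hφ, hφ, LoopDL.isIso_quotientMap _
    (LoopDL.bijective_codRestrict hc hn₀' hi₀ hj₀ hl hA hB hφ _)⟩
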